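/- Let $k$ be a field, $V$ a finite-dimensional $k$-vector space, $V^{(n)}=V^{\otimes n}$, $S\subseteq\mathbb N_{\ge 2}$ a finite set, and $R_s\subseteq V^{(s)}$ ($s\in S$) subspaces satisfying the minimality condition $$R_s\cap\sum_{t\in S,\,t<s}\ \sum_{j=0}^{s-t}V^{(j)}\otimes R_t\otimes V^{(s-t-j)}=0\qquad(s\in S).$$ Let $R=\bigoplus_{s\in S}R_s$ and let $A=T(V)/\langle R\rangle$ be the corresponding $S$-multi-homogeneous algebra, graded with $V$ in degree $1$. Put $n_s(2l)=sl$, $n_s(2l+1)=sl+1$. Let $\bar J^s_m=\bigcap_{j=0}^{m-s}V^{(j)}\otimes R_s\otimes V^{(m-s-j)}$ for $m\ge s$ and $\bar J^s_m=V^{(m)}$ for $0\le m<s$. Let $J_0=k$, $J_1=V$ and $J_i=\bigoplus_{s\in S}J_i^s$ with $J_i^s=\bar J^s_{n_s(i)}$ for $i\ge2$. The left multi-Koszul complex is $K(A)_i=A\otimes J_i$ with differential $\delta_i$ ($i\ge 1$) given, on $A\otimes J_1$ and on $A\otimes J_i^s$ for $i\geq 2$, by the restriction of $\alpha\otimes v_1\cdots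 v_n\mapsto\alpha v_1\otimes v_2\cdots v_n$ if $i$ is odd and of $\alpha\otimes v_1\cdots v_n\mapsto\alpha v_1\cdots v_{s-1}\otimes v_s\cdots v_n$ if $i$ is even; it is augmented by the augmentation $K(A)_0=A\to k$. The right multi-Koszul complex $J_i\otimes A$ is defined symmetrically. $A$ is left (resp. right) multi-Koszul if its augmented left (resp. right) multi-Koszul complex is a projective resolution of the trivial left (resp. right) $A$-module $k$. The multi-Koszul bimodule complex is $K_{L\text{-}R}(A)_i=A\otimes J_i\otimes A$. Its differential is $\delta'_L-\delta'_R$ if $i$ is odd, and is $\sum_{j=0}^{s-1}(\delta'_L)^j(\delta'_R)^{s-1-j}$ on $A\otimes J_i^s\otimes A$ if $i\ge2$ is even, where $\delta'_L(\alpha\otimes v_1\cdots v_n\otimes\beta)=\alpha v_1\otimes v_2\cdots v_n\otimes\beta$ and $\delta'_R(\alpha\otimes v_1\cdots v_n\otimes\beta)=\alpha\otimes v_1\cdots v_{n-1}\otimes v_n\beta$. It is augmented by the product $K_{L\text{-}R}(A)_0=A\otimes A\to A$. Let $A^e=A\otimes A^{\mathrm{op}}$. **Theorem.** The augmented multi-Koszul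 bimodule complex $$\cdots\to K_{L\text{-}R}(A)_2\to K_{L\text{-}R}(A)_1\to K_{L\text{-}R}(A)_0\to A\to0$$ is a complex, and the following hold. 1. It is exact if and only if $A$ is left multi-Koszul, and if and only if $A$ is right multi-Koszul. 2. If $A$ is multi-Koszul, it is a minimal graded projective resolution of $A$ in the category of left bounded $\mathbb Z$-graded $A$-bimodules: all $K_{L\text{-}R}(A)_i$ are graded projective and left bounded, the maps preserve degrees, and the surjections of $K_{L\text{-}R}(A)_0$ onto $A$ and of each $K_{L\text{-}R}(A)_{i+1}$ onto the kernel of the next map are essential. 3. If $A$ is multi-Koszul, then for all $n\ge0$ there are $k$-linear isomorphisms $HH_n(A)\cong H_n(A\otimes_{A^e}K_{L\text{-}R}(A)_\bullet)$ and $HH^n(A)\cong H^n(\mathrm{Hom}_{A^e}(K_{L\text{-}R}(A)_\bullet,A))$, where $HH_\bullet(A)$ and $HH^\bullet(A)$ are the Hochschild homology and cohomology of $A$ with coefficients in $A$, defined by the Hochschild complexes. Here a surjective homogeneous morphism $f:M\to M'$ of graded modules is essential if every homogeneous morphism $g:N\to M$ of graded modules with $f\circ g$ surjective is itself surjective. 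-/

import Mathlib

open scoped TensorProduct

noncomputable section

namespace MultiKoszul

universe u v w w'

/-! ## Presentations of multi-homogeneous algebras -/

section Presentation

variable (k : Type u) [Field k] (V : Type v) [AddCommGroup V] [Module k V]

/-- `V^{(n)} = V^{⊗ n}`, as the subspace of the tensor algebra `T(V)` spanned by words of length
`n`; the product of subspaces `V^{(a)} * W * V^{(b)}` of `T(V)` is `V^{(a)} ⊗ W ⊗ V^{(b)}`. -/
abbrev word (n : ℕ) : Submodule k (TensorAlgebra k V) :=
  LinearMap.range (TensorAlgebra.ι k : V →ₗ[k] TensorAlgebra k V) ^ n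

/-- A space of relations `R = ⨁_{s ∈ S} R_s`, with `S` a finite set of integers at least `2`,
`R_s ⊆ V^{(s)}`, satisfying the minimality condition: no nonzero element of `R_s` lies in the
ideal generated by the relations of smaller degree. (The values `R t` for `t ∉ S` are never
used.) -/
structure Relations where
  S : Finset ℕ
  two_le : ∀ s ∈ S, 2 ≤ s
  R : ℕ → Submodule k (TensorAlgebra k V)
  le_word : ∀ s ∈ S, R s ≤ word k V s
  minimal : ∀ s ∈ S,
    R s ⊓ (⨆ t ∈ S, ⨆ (_ : t < s), ⨆ j ≤ s - t, word k V j * R t * word k V (s - t - j)) = ⊥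

/-- The function `n_s` with `n_s(2l) = s l` and `n_s(2l+1) = s l + 1`. -/
def koszulDegree (s i : ℕ) : ℕ := s * (i / 2) + i % 2

end Presentation

/-! ## Removing the first or the last letter of a word

Let `B` be an algebra and `φ : V → B` linear. `peelLeft φ` and `peelRight φ` are the `B`-linear
endomorphisms of `B ⊗ T(V)` with `b ⊗ v₁ ⋯ vₙ ↦ b φ(v₁) ⊗ v₂ ⋯ vₙ` and
`b ⊗ v₁ ⋯ vₙ ↦ b φ(vₙ) ⊗ v₁ ⋯ vₙ₋₁` respectively (and `b ⊗ 1 ↦ 0`). -/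

section Peel

variable {k : Type u} [Field k] {V : Type v} [AddCommGroup V] [Module k V]
variable {B : Type w} [Ring B] [Algebra k B]

/-- The action of `T(V)` on `T(V) × (B ⊗ T(V))` with `v • (t, x) = (v t, φ(v) ⊗ t)`. -/
def leftRep (φ : V →ₗ[k] B) :
    TensorAlgebra k V →ₐ[k]
      Module.End k (TensorAlgebra k V × (B ⊗[k] TensorAlgebra k V)) :=
  TensorAlgebra.lift k
    { toFun := fun v =>
        (LinearMap.prod (LinearMap.mulLeft k (TensorAlgebra.ι k v))
          (TensorProduct.mk k B (TensorAlgebra k V) (φ v))) ∘ₗ LinearMap.fst k _ _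
      map_add' := fun v v' => by
        ext <;> simp [add_mul]
      map_smul' := fun c v => by
        ext <;> simp [TensorProduct.smul_tmul'] }

/-- The action of `T(V)ᵒᵖ` on `T(V) × (B ⊗ T(V))` with `(t, x) • v = (t v, φ(v) ⊗ t)`. -/
def rightRep (φ : V →ₗ[k] B) :
    TensorAlgebra k V →ₐ[k]
      (Module.End k (TensorAlgebra k V × (B ⊗[k] TensorAlgebra k V)))ᵐᵒᵖ :=
  TensorAlgebra.lift k
    { toFun := fun v => MulOpposite.op
        ((LinearMap.prod (LinearMap.mulRight k (TensorAlgebra.ι k v))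
          (TensorProduct.mk k B (TensorAlgebra k V) (φ v))) ∘ₗ LinearMap.fst k _ _)
      map_add' := fun v v' => by
        apply MulOpposite.unop_injective
        ext <;> simp [mul_add]
      map_smul' := fun c v => by
        apply MulOpposite.unop_injective
        ext <;> simp [TensorProduct.smul_tmul'] }

/-- `v₁ ⋯ vₙ ↦ φ(v₁) ⊗ v₂ ⋯ vₙ`. -/
def firstLetter (φ : V →ₗ[k] B) : TensorAlgebra k V →ₗ[k] B ⊗[k] TensorAlgebra k V where
  toFun x := (leftRep φ x (1, 0)).2
  map_add' x y := by simp
  map_smul' c x := by simp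

/-- `v₁ ⋯ vₙ ↦ φ(vₙ) ⊗ v₁ ⋯ vₙ₋₁`. -/
def lastLetter (φ : V →ₗ[k] B) : TensorAlgebra k V →ₗ[k] B ⊗[k] TensorAlgebra k V where
  toFun x := ((rightRep φ x).unop (1, 0)).2
  map_add' x y := by simp
  map_smul' c x := by simp

/-- The `B`-linear extension `b ⊗ x ↦ b • f x` of a linear map `f` to a `B`-module. -/
def extend {X : Type w'} [AddCommGroup X] [Module k X] [Module B X] [IsScalarTower k B X]
    (f : TensorAlgebra k V →ₗ[k] X) : B ⊗[k] TensorAlgebra k V →ₗ[B] X :=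
  TensorProduct.AlgebraTensorModule.lift (LinearMap.toSpanSingleton B _ f)

@[simp] theorem extend_tmul {X : Type w'} [AddCommGroup X] [Module k X] [Module B X]
    [IsScalarTower k B X] (f : TensorAlgebra k V →ₗ[k] X) (b : B) (x : TensorAlgebra k V) :
    extend f (b ⊗ₜ x) = b • f x := by
  simp [extend]

def peelLeft (φ : V →ₗ[k] B) : Module.End B (B ⊗[k] TensorAlgebra k V) := extend (firstLetter φ)

def peelRight (φ : V →ₗ[k] B) : Module.End B (B ⊗[k] TensorAlgebra k V) := extend (lastLetter φ)

theorem leftRep_fst (φ : V →ₗ[k] B) (x : TensorAlgebra k V) :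
    ∀ p, (leftRep φ x p).1 = x * p.1 := by
  induction x using TensorAlgebra.induction with
  | algebraMap r => intro p; simp [Algebra.smul_def, Module.algebraMap_end_apply]
  | ι v => intro p; simp [leftRep]
  | mul a b ha hb => intro p; simp [ha, hb, mul_assoc]
  | add a b ha hb => intro p; simp [ha, hb, add_mul]

theorem rightRep_fst (φ : V →ₗ[k] B) (x : TensorAlgebra k V) :
    ∀ p, ((rightRep φ x).unop p).1 = p.1 * x := by
  induction x using TensorAlgebra.induction with
  | algebraMap r =>
    intro p
    simp [Algebra.smul_def, Module.algebraMap_end_apply, MulOpposite.algebraMap_apply,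
      Algebra.commutes r p.1]
  | ι v => intro p; simp [rightRep]
  | mul a b ha hb => intro p; simp [ha, hb, mul_assoc]
  | add a b ha hb => intro p; simp [ha, hb, mul_add]

@[simp] theorem firstLetter_ι_mul (φ : V →ₗ[k] B) (v : V) (x : TensorAlgebra k V) :
    firstLetter φ (TensorAlgebra.ι k v * x) = φ v ⊗ₜ x := by
  have h := leftRep_fst φ x (1, 0)
  simp only [mul_one] at h
  simp only [firstLetter, LinearMap.coe_mk, AddHom.coe_mk, map_mul, Module.End.mul_apply]
  rw [show leftRep φ x (1, 0) = (x, (leftRep φ x (1, 0)).2) from Prod.ext h rfl]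
  simp [leftRep]

@[simp] theorem lastLetter_mul_ι (φ : V →ₗ[k] B) (v : V) (x : TensorAlgebra k V) :
    lastLetter φ (x * TensorAlgebra.ι k v) = φ v ⊗ₜ x := by
  have h := rightRep_fst φ x (1, 0)
  simp only [one_mul] at h
  simp only [lastLetter, LinearMap.coe_mk, AddHom.coe_mk, map_mul, MulOpposite.unop_mul,
    Module.End.mul_apply]
  rw [show (rightRep φ x).unop (1, 0) = (x, ((rightRep φ x).unop (1, 0)).2) from Prod.ext h rfl]
  simp [rightRep]

theorem peelLeft_tmul (φ : V →ₗ[k] B) (b : B) (v : V) (x : TensorAlgebra k V) :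
    peelLeft φ (b ⊗ₜ (TensorAlgebra.ι k v * x)) = (b * φ v) ⊗ₜ x := by
  simp [peelLeft, TensorProduct.smul_tmul']

theorem peelRight_tmul (φ : V →ₗ[k] B) (b : B) (v : V) (x : TensorAlgebra k V) :
    peelRight φ (b ⊗ₜ (x * TensorAlgebra.ι k v)) = (b * φ v) ⊗ₜ x := by
  simp [peelRight, TensorProduct.smul_tmul']

theorem map_mem_of_baseChange {X : Type w'} [AddCommGroup X] [Module B X]
    (f : B ⊗[k] TensorAlgebra k V →ₗ[B] X) (P : Submodule k (TensorAlgebra k V))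
    (Q : Submodule B X) (h : ∀ x ∈ P, f (1 ⊗ₜ x) ∈ Q) : ∀ x ∈ P.baseChange B, f x ∈ Q := by
  intro x hx
  rw [Submodule.baseChange_eq_span] at hx
  induction hx using Submodule.span_induction with
  | mem y hy =>
    obtain ⟨z, hz, rfl⟩ := hy
    simpa using h z hz
  | zero => simp
  | add y z _ _ hy hz => rw [map_add]; exact Q.add_mem hy hz
  | smul c y _ hy => rw [map_smul]; exact Q.smul_mem _ hy

variable [FiniteDimensional k V]

theorem firstLetter_mem (φ : V →ₗ[k] B) {ι : Type} [Nonempty ι]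
    (W : ι → Submodule k (TensorAlgebra k V)) (x : TensorAlgebra k V)
    (hx : ∀ i, x ∈ LinearMap.range (TensorAlgebra.ι k : V →ₗ[k] _) * W i) :
    firstLetter φ x ∈ (⨅ i, W i).baseChange B := by
  classical
  let b := Module.finBasis k V
  let D : Fin (Module.finrank k V) → TensorAlgebra k V →ₗ[k] TensorAlgebra k V :=
    fun i => (TensorProduct.lid k _).toLinearMap ∘ₗ firstLetter (b.coord i)
  have hD : ∀ i v w, D i (TensorAlgebra.ι k v * w) = b.coord i v • w := by
    intro i v w; simp [D]
  have key : ∀ j, ∀ y ∈ LinearMap.range (TensorAlgebra.ι k : V →ₗ[k] _) * W j,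
      firstLetter φ y = ∑ i, φ (b i) ⊗ₜ[k] D i y ∧ ∀ i, D i y ∈ W j := by
    intro j y hy
    induction hy using Submodule.mul_induction_on' with
    | mem_mul_mem m hm n hn =>
      obtain ⟨v, rfl⟩ := hm
      refine ⟨?_, fun i => by rw [hD]; exact (W j).smul_mem _ hn⟩
      rw [firstLetter_ι_mul]
      conv_lhs => rw [← b.sum_repr v]
      simp only [hD, map_sum, map_smul, TensorProduct.sum_tmul, TensorProduct.smul_tmul,
        Module.Basis.coord_apply]
    | add a _ c _ ha hc =>
      refine ⟨?_, fun i => by rw [map_add]; exact (W j).add_mem (ha.2 i) (hc.2 i)⟩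
      simp only [map_add, ha.1, hc.1, TensorProduct.tmul_add, Finset.sum_add_distrib]
  obtain ⟨j₀⟩ := ‹Nonempty ι›
  rw [(key j₀ x (hx j₀)).1]
  refine Submodule.sum_mem _ fun i _ => Submodule.tmul_mem_baseChange_of_mem _ ?_
  exact (Submodule.mem_iInf _).2 fun j => (key j x (hx j)).2 i

theorem lastLetter_mem (φ : V →ₗ[k] B) {ι : Type} [Nonempty ι]
    (W : ι → Submodule k (TensorAlgebra k V)) (x : TensorAlgebra k V)
    (hx : ∀ i, x ∈ W i * LinearMap.range (TensorAlgebra.ι k : V →ₗ[k] _)) :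
    lastLetter φ x ∈ (⨅ i, W i).baseChange B := by
  classical
  let b := Module.finBasis k V
  let D : Fin (Module.finrank k V) → TensorAlgebra k V →ₗ[k] TensorAlgebra k V :=
    fun i => (TensorProduct.lid k _).toLinearMap ∘ₗ lastLetter (b.coord i)
  have hD : ∀ i v w, D i (w * TensorAlgebra.ι k v) = b.coord i v • w := by
    intro i v w; simp [D]
  have key : ∀ j, ∀ y ∈ W j * LinearMap.range (TensorAlgebra.ι k : V →ₗ[k] _),
      lastLetter φ y = ∑ i, φ (b i) ⊗ₜ[k] D i y ∧ ∀ i, D i y ∈ W j := by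
    intro j y hy
    induction hy using Submodule.mul_induction_on' with
    | mem_mul_mem m hm n hn =>
      obtain ⟨v, rfl⟩ := hn
      refine ⟨?_, fun i => by rw [hD]; exact (W j).smul_mem _ hm⟩
      rw [lastLetter_mul_ι]
      conv_lhs => rw [← b.sum_repr v]
      simp only [hD, map_sum, map_smul, TensorProduct.sum_tmul, TensorProduct.smul_tmul,
        Module.Basis.coord_apply]
    | add a _ c _ ha hc =>
      refine ⟨?_, fun i => by rw [map_add]; exact (W j).add_mem (ha.2 i) (hc.2 i)⟩
      simp only [map_add, ha.1, hc.1, TensorProduct.tmul_add, Finset.sum_add_distrib]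
  obtain ⟨j₀⟩ := ‹Nonempty ι›
  rw [(key j₀ x (hx j₀)).1]
  refine Submodule.sum_mem _ fun i _ => Submodule.tmul_mem_baseChange_of_mem _ ?_
  exact (Submodule.mem_iInf _).2 fun j => (key j x (hx j)).2 i

end Peel

/-! ## The algebra `A = T(V)/⟨R⟩` -/

section Algebra

variable {k : Type u} [Field k] {V : Type v} [AddCommGroup V] [Module k V]

namespace Relations

variable (D : Relations k V)

/-- The two-sided ideal of `T(V)` generated by the relations. -/
def ideal : Ideal (TensorAlgebra k V) :=
  (TwoSidedIdeal.span (⋃ s ∈ D.S, (D.R s : Set (TensorAlgebra k V)))).asIdeal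

instance : D.ideal.IsTwoSided := inferInstanceAs (TwoSidedIdeal.asIdeal _).IsTwoSided

/-- `A = T(V)/⟨R⟩`. -/
def Alg : Type (max u v) := TensorAlgebra k V ⧸ D.ideal

instance : Ring D.Alg := inferInstanceAs (Ring (TensorAlgebra k V ⧸ D.ideal))

instance : Algebra k D.Alg := inferInstanceAs (Algebra k (TensorAlgebra k V ⧸ D.ideal))

/-- The canonical projection `T(V) → A`. -/
def proj : TensorAlgebra k V →ₐ[k] D.Alg := Ideal.Quotient.mkₐ k D.ideal

/-- The canonical map `V → A`. -/
def gen : V →ₗ[k] D.Alg := D.proj.toLinearMap ∘ₗ TensorAlgebra.ι k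

/-- The homogeneous component `A_n`, the image of `V^{(n)}`. -/
def component (n : ℕ) : Submodule k D.Alg := (word k V n).map D.proj.toLinearMap

theorem algebraMapInv_word {n : ℕ} (hn : n ≠ 0) {x : TensorAlgebra k V} (hx : x ∈ word k V n) :
    (TensorAlgebra.algebraMapInv x : k) = 0 := by
  obtain ⟨m, rfl⟩ := Nat.exists_eq_succ_of_ne_zero hn
  rw [word, pow_succ'] at hx
  induction hx using Submodule.mul_induction_on' with
  | mem_mul_mem a ha b _ =>
    obtain ⟨v, rfl⟩ := ha
    simp [TensorAlgebra.algebraMapInv]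
  | add a _ b _ ha hb => simp [ha, hb]

theorem ideal_le_ker : ∀ x ∈ D.ideal, (TensorAlgebra.algebraMapInv x : k) = 0 := by
  intro x hx
  have h : TwoSidedIdeal.span (⋃ s ∈ D.S, (D.R s : Set (TensorAlgebra k V))) ≤
      TwoSidedIdeal.ker (TensorAlgebra.algebraMapInv : TensorAlgebra k V →ₐ[k] k) := by
    rw [TwoSidedIdeal.span_le]
    intro y hy
    simp only [Set.mem_iUnion] at hy
    obtain ⟨s, hs, hy⟩ := hy
    have := D.two_le s hs
    exact (TwoSidedIdeal.mem_ker _).2 (algebraMapInv_word (by omega) (D.le_word s hs hy))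
  exact (TwoSidedIdeal.mem_ker _).1 (h (TwoSidedIdeal.mem_asIdeal.1 hx))

/-- The augmentation `A → k`, with kernel `A_{>0}`. -/
def aug : D.Alg →ₐ[k] k := Ideal.Quotient.liftₐ D.ideal TensorAlgebra.algebraMapInv D.ideal_le_ker

/-! ## The spaces `J` -/

/-- `J̄_m^s`: the intersection of the `V^{(j)} ⊗ R_s ⊗ V^{(m-s-j)}`, `0 ≤ j ≤ m - s`, for
`m ≥ s`, and `V^{(m)}` for `m < s`. -/
def Jbar (s m : ℕ) : Submodule k (TensorAlgebra k V) :=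
  if m < s then word k V m
  else ⨅ j : Fin (m - s + 1), word k V j * D.R s * word k V (m - s - j)

/-- `J_i = ⨁_{s ∈ S} J_i^s` with `J_i^s = J̄^s_{n_s(i)}` for `i ≥ 2`, and `J_i = V^{(i)}` for
`i = 0, 1`. For `i ≥ 2` the degrees `n_s(i)`, `s ∈ S`, are distinct, so that the sum of the
subspaces `J_i^s` of `T(V)` is direct. -/
def J (i : ℕ) : Submodule k (TensorAlgebra k V) :=
  if i < 2 then word k V i else ⨆ s ∈ D.S, D.Jbar s (koszulDegree s i)

variable {D} in
theorem Jbar_le_word {s m : ℕ} (hs : s ∈ D.S) : D.Jbar s m ≤ word k V m := by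
  unfold Jbar
  split_ifs with h
  · exact le_rfl
  · refine (iInf_le _ 0).trans ?_
    calc _ ≤ word k V 0 * word k V s * word k V (m - s - 0) :=
          mul_le_mul' (mul_le_mul' le_rfl (D.le_word s hs)) le_rfl
      _ = word k V m := by rw [← pow_add, ← pow_add]; congr 1; omega

end Relations

end Algebra

/-! ## The multi-Koszul complexes -/

section Complexes

variable {k : Type u} [Field k] {V : Type v} [AddCommGroup V] [Module k V]
variable {B : Type w} [Ring B] [Algebra k B]

/-- `B ⊗ f` for the projection `f` of `T(V)` onto `V^{(n)}`. -/
def degreeProj (n : ℕ) : Module.End B (B ⊗[k] TensorAlgebra k V) :=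
  (GradedAlgebra.proj (word k V) n).baseChange B

namespace Relations

variable (D : Relations k V)

variable (B) in
/-- The free `B`-module `B ⊗ J_i`, as a submodule of `B ⊗ T(V)`. -/
abbrev K (i : ℕ) : Submodule B (B ⊗[k] TensorAlgebra k V) := (D.J i).baseChange B

/-- The endomorphism of `B ⊗ T(V)` inducing the differential `B ⊗ J_i → B ⊗ J_{i-1}`, `i ≥ 1`:
it acts on the summand `B ⊗ V^{(n_s(i))}` by `odd` if `i` is odd and by `even s` if `i` is even. -/
def hat (odd : Module.End B (B ⊗[k] TensorAlgebra k V))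
    (even : ℕ → Module.End B (B ⊗[k] TensorAlgebra k V)) (i : ℕ) :
    Module.End B (B ⊗[k] TensorAlgebra k V) :=
  if i = 1 then odd
  else ∑ s ∈ D.S, (if Odd i then odd else even s) * degreeProj (koszulDegree s i)

/-- `f` removes `p` letters: it maps `B ⊗ V^{(m+p)}` to `B ⊗ V^{(m)}` and `B ⊗ J̄^s_{m+p}` to
`B ⊗ J̄^s_m`. -/
def Lowers (f : Module.End B (B ⊗[k] TensorAlgebra k V)) (p s : ℕ) : Prop :=
  ∀ m, ∀ x ∈ (D.Jbar s (m + p)).baseChange B, f x ∈ (D.Jbar s m).baseChange B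

variable {D}

theorem koszulDegree_injective {i : ℕ} (hi : 2 ≤ i) {s t : ℕ}
    (h : koszulDegree s i = koszulDegree t i) : s = t := by
  unfold koszulDegree at h
  exact Nat.eq_of_mul_eq_mul_right (by omega : 0 < i / 2) (by omega)

theorem hat_mem {odd : Module.End B (B ⊗[k] TensorAlgebra k V)}
    {even : ℕ → Module.End B (B ⊗[k] TensorAlgebra k V)}
    (h₁ : ∀ x ∈ (word k V 1).baseChange B, odd x ∈ (word k V 0).baseChange B)
    (ho : ∀ s ∈ D.S, D.Lowers odd 1 s) (he : ∀ s ∈ D.S, D.Lowers (even s) (s - 1) s) (i : ℕ) :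
    ∀ x ∈ D.K B (i + 1), D.hat odd even (i + 1) x ∈ D.K B i := by
  classical
  rcases Nat.eq_zero_or_pos i with rfl | hi
  · simpa [hat, J, K] using h₁
  apply map_mem_of_baseChange
  intro x hx
  have hi2 : ¬ (i + 1 < 2) := by omega
  rw [J, if_neg hi2] at hx
  induction hx using Submodule.iSup_induction' with
  | zero => simp
  | add y z _ _ hy hz => rw [TensorProduct.tmul_add, map_add]; exact Submodule.add_mem _ hy hz
  | mem t y hy =>
    by_cases ht : t ∈ D.S
    swap
    · simp only [ht, iSup_false, Submodule.mem_bot] at hy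
      simp [hy]
    simp only [ht, iSup_pos] at hy
    have hi1 : ¬ (i + 1 = 1) := by omega
    rw [hat, if_neg hi1, LinearMap.sum_apply]
    refine Submodule.sum_mem _ fun s hs => ?_
    have hyw := Jbar_le_word ht hy
    have hpr : degreeProj (B := B) (koszulDegree s (i + 1)) (1 ⊗ₜ y) =
        if s = t then 1 ⊗ₜ[k] y else 0 := by
      rw [degreeProj, LinearMap.baseChange_tmul, GradedAlgebra.proj_apply]
      split_ifs with hst
      · subst hst
        rw [DirectSum.decompose_of_mem_same (word k V) hyw]
      · rw [DirectSum.decompose_of_mem_ne (word k V) hyw, TensorProduct.tmul_zero]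
        exact fun h => hst (koszulDegree_injective (by omega) h).symm
    rw [Module.End.mul_apply, hpr]
    by_cases hst : s = t
    swap
    · simp [hst]
    subst hst
    have hs2 := D.two_le s hs
    have hle : (D.Jbar s (koszulDegree s i)).baseChange B ≤ D.K B i := by
      refine Submodule.baseChange_mono B ?_
      rw [J]
      split_ifs with h2
      · exact Jbar_le_word hs |>.trans (by
          rw [show koszulDegree s i = i by rw [show i = 1 by omega]; simp [koszulDegree]])
      · exact le_iSup₂_of_le s hs le_rfl
    apply hle
    have hmem : (1 : B) ⊗ₜ[k] y ∈ (D.Jbar s (koszulDegree s (i + 1))).baseChange B :=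
      Submodule.tmul_mem_baseChange_of_mem _ hy
    simp only [if_true]
    split_ifs with hodd
    · refine ho s hs _ _ ?_
      rwa [show koszulDegree s i + 1 = koszulDegree s (i + 1) from ?_]
      obtain ⟨l, hl⟩ := hodd
      obtain rfl : i = 2 * l := by omega
      simp [koszulDegree, Nat.add_div]
    · refine he s hs _ _ ?_
      rwa [show koszulDegree s i + (s - 1) = koszulDegree s (i + 1) from ?_]
      obtain ⟨l, hl⟩ := Nat.not_odd_iff_even.1 hodd
      obtain ⟨l, rfl⟩ : ∃ m, l = m + 1 := ⟨l - 1, by omega⟩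
      obtain rfl : i = 2 * l + 1 := by omega
      rw [koszulDegree, koszulDegree, show (2 * l + 1) / 2 = l by omega,
        show (2 * l + 1 + 1) / 2 = l + 1 by omega, show (2 * l + 1) % 2 = 1 by omega,
        show (2 * l + 1 + 1) % 2 = 0 by omega, mul_add]
      omega

/-- The `B`-linear map `B ⊗ J_{i+1} → B ⊗ J_i` induced by `hat odd even (i + 1)`. -/
def diff (odd : Module.End B (B ⊗[k] TensorAlgebra k V))
    (even : ℕ → Module.End B (B ⊗[k] TensorAlgebra k V))
    (h : ∀ i, ∀ x ∈ D.K B (i + 1), D.hat odd even (i + 1) x ∈ D.K B i) (i : ℕ) :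
    D.K B (i + 1) →ₗ[B] D.K B i :=
  (D.hat odd even (i + 1)).restrict (h i)

theorem Lowers.mul {f g : Module.End B (B ⊗[k] TensorAlgebra k V)} {p q s : ℕ}
    (hf : D.Lowers f p s) (hg : D.Lowers g q s) : D.Lowers (f * g) (p + q) s := by
  intro m x hx
  exact hf m _ (hg (m + p) x (by rwa [add_assoc]))

theorem Lowers.pow {f : Module.End B (B ⊗[k] TensorAlgebra k V)} {s : ℕ}
    (hf : D.Lowers f 1 s) (p : ℕ) : D.Lowers (f ^ p) p s := by
  induction p with
  | zero => intro m x hx; simpa using hx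
  | succ p ih => rw [pow_succ]; exact ih.mul hf

theorem Lowers.sub {f g : Module.End B (B ⊗[k] TensorAlgebra k V)} {p s : ℕ}
    (hf : D.Lowers f p s) (hg : D.Lowers g p s) : D.Lowers (f - g) p s :=
  fun m x hx => Submodule.sub_mem _ (hf m x hx) (hg m x hx)

theorem Lowers.sum {ι : Type} (t : Finset ι) {f : ι → Module.End B (B ⊗[k] TensorAlgebra k V)}
    {p s : ℕ} (hf : ∀ i ∈ t, D.Lowers (f i) p s) : D.Lowers (∑ i ∈ t, f i) p s :=
  fun m x hx => by
    rw [LinearMap.sum_apply]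
    exact Submodule.sum_mem _ fun i hi => hf i hi m x hx

variable [FiniteDimensional k V]

theorem peelLeft_word (φ : V →ₗ[k] B) (m : ℕ) :
    ∀ x ∈ (word k V (m + 1)).baseChange B, peelLeft φ x ∈ (word k V m).baseChange B := by
  apply map_mem_of_baseChange
  intro x hx
  rw [word, pow_succ'] at hx
  simpa [peelLeft] using firstLetter_mem φ (fun _ : Unit => word k V m) x fun _ => hx

theorem peelRight_word (φ : V →ₗ[k] B) (m : ℕ) :
    ∀ x ∈ (word k V (m + 1)).baseChange B, peelRight φ x ∈ (word k V m).baseChange B := by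
  apply map_mem_of_baseChange
  intro x hx
  rw [word, pow_succ] at hx
  simpa [peelRight] using lastLetter_mem φ (fun _ : Unit => word k V m) x fun _ => hx

theorem peelLeft_lowers (φ : V →ₗ[k] B) {s : ℕ} (hs : s ∈ D.S) : D.Lowers (peelLeft φ) 1 s := by
  intro m
  by_cases hm : m < s
  · intro x hx
    rw [Jbar, if_pos hm]
    exact peelLeft_word φ m x (Submodule.baseChange_mono B (Jbar_le_word hs) hx)
  · rw [Jbar, if_neg (by omega), Jbar, if_neg hm]
    apply map_mem_of_baseChange
    intro x hx
    rw [peelLeft, extend_tmul, one_smul]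
    refine firstLetter_mem φ _ x fun j => ?_
    have := (Submodule.mem_iInf _).1 hx ⟨j + 1, by omega⟩
    rw [word, pow_succ', mul_assoc, mul_assoc, ← mul_assoc (_ ^ _)] at this
    convert this using 4
    simp only
    omega

theorem peelRight_lowers (φ : V →ₗ[k] B) {s : ℕ} (hs : s ∈ D.S) :
    D.Lowers (peelRight φ) 1 s := by
  intro m
  by_cases hm : m < s
  · intro x hx
    rw [Jbar, if_pos hm]
    exact peelRight_word φ m x (Submodule.baseChange_mono B (Jbar_le_word hs) hx)
  · rw [Jbar, if_neg (by omega), Jbar, if_neg hm]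
    apply map_mem_of_baseChange
    intro x hx
    rw [peelRight, extend_tmul, one_smul]
    refine lastLetter_mem φ _ x fun j => ?_
    have := (Submodule.mem_iInf _).1 hx ⟨j, by omega⟩
    rw [mul_assoc, ← pow_succ]
    convert this using 4
    simp only
    omega

end Relations

end Complexes

/-! ## Resolutions -/

section Resolutions

/-- Exactness of the augmented complex `⋯ → C 2 → C 1 → C 0 → M → 0`. -/
structure IsExactAugmented {C : ℕ → Type*} [∀ i, AddCommGroup (C i)] {M : Type*} [AddCommGroup M]
    (d : ∀ i, C (i + 1) →+ C i) (ε : C 0 →+ M) : Prop where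
  surjective : Function.Surjective ε
  exact_zero : Function.Exact (d 0) ε
  exact_succ : ∀ i, Function.Exact (d (i + 1)) (d i)

variable {k : Type u} [Field k] {B : Type w} [Ring B] [Algebra k B]

/-- `M = ⨁_{n ∈ ℤ} ℳ n` is a `ℤ`-graded module over the `ℕ`-graded algebra `B`. -/
structure IsGradedModule (ℬ : ℕ → Submodule k B) {M : Type w'} [AddCommGroup M] [Module k M]
    [Module B M] (ℳ : ℤ → Submodule k M) : Prop where
  isInternal : DirectSum.IsInternal ℳ
  smul_mem : ∀ p n, ∀ b ∈ ℬ p, ∀ m ∈ ℳ n, b • m ∈ ℳ (p + n)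

/-- `f` is surjective onto the submodule `P` and, as a homogeneous surjection onto `P`, it is
essential: a homogeneous morphism `g` from a graded module into the source of `f` is surjective
as soon as `f ∘ g` maps onto `P`. -/
def IsEssentialOnto (ℬ : ℕ → Submodule k B) {M : Type w'} [AddCommGroup M] [Module k M]
    [Module B M] (ℳ : ℤ → Submodule k M) {N : Type w'} [AddCommGroup N] [Module B N]
    (f : M →ₗ[B] N) (P : Submodule B N) : Prop :=
  LinearMap.range f = P ∧
    ∀ (X : Type w') [AddCommGroup X] [Module k X] [Module B X] [IsScalarTower k B X]
      (𝒳 : ℤ → Submodule k X), IsGradedModule ℬ 𝒳 →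
      ∀ g : X →ₗ[B] M, (∀ n, ∀ x ∈ 𝒳 n, g x ∈ ℳ n) → LinearMap.range (f ∘ₗ g) = P →
        Function.Surjective g

/-- `⋯ → C 1 → C 0 → M → 0` is a minimal projective resolution of the graded module `M`, in the
category of left bounded `ℤ`-graded `B`-modules: a resolution by graded projective modules such
that `C 0 → M` and all `C (i + 1) → Ker (C i → C (i - 1))` are projective covers. -/
structure IsMinimalGradedProjectiveResolution (ℬ : ℕ → Submodule k B)
    {C : ℕ → Type w'} [∀ i, AddCommGroup (C i)] [∀ i, Module k (C i)] [∀ i, Module B (C i)]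
    (𝒞 : ∀ i, ℤ → Submodule k (C i))
    {M : Type w'} [AddCommGroup M] [Module k M] [Module B M] (ℳ : ℤ → Submodule k M)
    (d : ∀ i, C (i + 1) →ₗ[B] C i) (ε : C 0 →ₗ[B] M) : Prop where
  graded_target : IsGradedModule ℬ ℳ
  graded : ∀ i, IsGradedModule ℬ (𝒞 i)
  left_bounded : ∀ i, ∃ n₀ : ℤ, ∀ n < n₀, 𝒞 i n = ⊥
  projective : ∀ i, Module.Projective B (C i)
  ε_homogeneous : ∀ n, ∀ x ∈ 𝒞 0 n, ε x ∈ ℳ n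
  d_homogeneous : ∀ i n, ∀ x ∈ 𝒞 (i + 1) n, d i x ∈ 𝒞 i n
  exact : IsExactAugmented (fun i => (d i).toAddMonoidHom) ε.toAddMonoidHom
  essential_ε : IsEssentialOnto ℬ (𝒞 0) ε ⊤
  essential_zero : IsEssentialOnto ℬ (𝒞 1) (d 0) (LinearMap.ker ε)
  essential_succ : ∀ i, IsEssentialOnto ℬ (𝒞 (i + 2)) (d (i + 1)) (LinearMap.ker (d i))

end Resolutions

/-! ## Homology of sequences of vector spaces -/

section Homology

variable {k : Type u} [Field k]

/-- Cycles of `⋯ → C 1 → C 0 → 0`. -/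
def cycles {C : ℕ → Type w} [∀ n, AddCommGroup (C n)] [∀ n, Module k (C n)]
    (d : ∀ n, C (n + 1) →ₗ[k] C n) : ∀ n, Submodule k (C n)
  | 0 => ⊤
  | n + 1 => LinearMap.ker (d n)

/-- The homology `H_n` of a complex `⋯ → C 1 → C 0 → 0`. -/
abbrev homology {C : ℕ → Type w} [∀ n, AddCommGroup (C n)] [∀ n, Module k (C n)]
    (d : ∀ n, C (n + 1) →ₗ[k] C n) (n : ℕ) : Type w :=
  cycles d n ⧸ (LinearMap.range (d n)).comap (cycles d n).subtype

/-- Coboundaries of `0 → C 0 → C 1 → ⋯`. -/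
def coboundaries {C : ℕ → Type w} [∀ n, AddCommGroup (C n)] [∀ n, Module k (C n)]
    (d : ∀ n, C n →ₗ[k] C (n + 1)) : ∀ n, Submodule k (C n)
  | 0 => ⊥
  | n + 1 => LinearMap.range (d n)

/-- The cohomology `H^n` of a complex `0 → C 0 → C 1 → ⋯`. -/
abbrev cohomology {C : ℕ → Type w} [∀ n, AddCommGroup (C n)] [∀ n, Module k (C n)]
    (d : ∀ n, C n →ₗ[k] C (n + 1)) (n : ℕ) : Type w :=
  LinearMap.ker (d n) ⧸ (coboundaries d n).comap (LinearMap.ker (d n)).subtype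

end Homology

/-! ## Bimodules as modules over the enveloping algebra -/

section Bimodules

variable (k : Type u) [Field k] (A : Type w) [Ring A] [Algebra k A]

/-- The enveloping algebra `A^e = A ⊗ A^{op}`; left `A^e`-modules are `A`-bimodules with
`(a ⊗ b) m = a m b`. -/
def Env : Type w := A ⊗[k] Aᵐᵒᵖ

instance : Ring (Env k A) := inferInstanceAs (Ring (A ⊗[k] Aᵐᵒᵖ))

instance : Algebra k (Env k A) := inferInstanceAs (Algebra k (A ⊗[k] Aᵐᵒᵖ))

variable {k A} in
/-- The element `a ⊗ b` of `A^e`. -/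
def Env.tmul (a b : A) : Env k A := a ⊗ₜ[k] MulOpposite.op b

/-- `A` as a bimodule over itself. -/
instance envModule : Module (Env k A) A :=
  (TensorProduct.Algebra.module : Module (A ⊗[k] Aᵐᵒᵖ) A)

theorem Env.tmul_smul (a b x : A) : (Env.tmul a b : Env k A) • x = a * x * b := by
  have h := TensorProduct.Algebra.smul_def (R := k) a (MulOpposite.op b) x
  exact h.trans (by simp [mul_assoc])

theorem Env.tmul_mul_tmul (a b c d : A) :
    (Env.tmul a b : Env k A) * Env.tmul c d = Env.tmul (a * c) (d * b) :=
  Algebra.TensorProduct.tmul_mul_tmul a c (MulOpposite.op b) (MulOpposite.op d)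

theorem Env.smul_tmul (r : k) (a b : A) : r • (Env.tmul a b : Env k A) = Env.tmul (r • a) b :=
  TensorProduct.smul_tmul' r a (MulOpposite.op b)

theorem Env.smul_tmul_right (r : k) (a b : A) :
    r • (Env.tmul a b : Env k A) = Env.tmul a (r • b) :=
  (TensorProduct.tmul_smul r a (MulOpposite.op b)).symm

theorem Env.induction {P : Env k A → Prop} (x : Env k A) (zero : P 0)
    (tmul : ∀ a b, P (Env.tmul a b)) (add : ∀ x y, P x → P y → P (x + y)) : P x :=
  TensorProduct.induction_on x zero (fun a b => tmul a b.unop) add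

instance : IsScalarTower k (Env k A) A where
  smul_assoc r t x := by
    induction t using Env.induction with
    | zero => rw [smul_zero, zero_smul, smul_zero]
    | tmul a b => rw [Env.smul_tmul, Env.tmul_smul, Env.tmul_smul]; simp
    | add t t' h h' => rw [smul_add, add_smul, h, h', add_smul, smul_add]

/-- `A ⊗_{A^e} M` for an `A`-bimodule `M`: the quotient of `A ⊗ M` by the relations
`a (c ⊗ b) ⊗ m = a ⊗ (c ⊗ b) m`, where `A^e` acts on `A` on the right by
`a (c ⊗ b) = b a c`. -/
def envTensorRel (M : Type w') [AddCommGroup M] [Module k M] [Module (Env k A) M] :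
    Submodule k (A ⊗[k] M) :=
  Submodule.span k {y | ∃ (a b c : A) (m : M),
    y = (b * a * c) ⊗ₜ[k] m - a ⊗ₜ[k] ((Env.tmul c b : Env k A) • m)}

abbrev EnvTensor (M : Type w') [AddCommGroup M] [Module k M] [Module (Env k A) M] :
    Type (max w w') := (A ⊗[k] M) ⧸ envTensorRel k A M

variable {k A} in
/-- `1_A ⊗_{A^e} f`. -/
def envTensorMap {M N : Type w'} [AddCommGroup M] [Module k M] [Module (Env k A) M]
    [IsScalarTower k (Env k A) M] [AddCommGroup N] [Module k N] [Module (Env k A) N]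
    [IsScalarTower k (Env k A) N] (f : M →ₗ[Env k A] N) :
    EnvTensor k A M →ₗ[k] EnvTensor k A N :=
  Submodule.mapQ _ _ ((f.restrictScalars k).lTensor A) (by
    rw [envTensorRel, Submodule.span_le]
    rintro _ ⟨a, b, c, m, rfl⟩
    refine Submodule.subset_span ⟨a, b, c, f m, ?_⟩
    simp)

variable {k A} in
/-- `Hom_{A^e}(f, 1_A)`. -/
def envHomMap {M N : Type w'} [AddCommGroup M] [Module (Env k A) M]
    [AddCommGroup N] [Module (Env k A) N] (f : M →ₗ[Env k A] N) :
    (N →ₗ[Env k A] A) →ₗ[k] (M →ₗ[Env k A] A) where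
  toFun g := g ∘ₗ f
  map_add' _ _ := rfl
  map_smul' _ _ := rfl

end Bimodules

/-! ## Hochschild homology and cohomology -/

section Hochschild

variable (k : Type u) [Field k] (A : Type w) [Ring A] [Algebra k A]

variable {k A} in
theorem contractNth_update {n : ℕ} (a : Fin (n + 1) → A) (j : Fin n) (i : Fin (n + 1)) :
    ∃ (p : Fin n) (g : A →ₗ[k] A), ∀ x,
      Fin.contractNth j.castSucc (· * ·) (Function.update a i x) =
        Function.update (Fin.contractNth j.castSucc (· * ·) a) p (g x) := by
  rcases lt_trichotomy (i : ℕ) j with h | h | h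
  · refine ⟨⟨i, by omega⟩, LinearMap.id, fun x => ?_⟩
    ext l
    simp only [Fin.contractNth, Function.update_apply, Fin.ext_iff, Fin.val_castSucc, Fin.val_succ,
      LinearMap.id_apply]
    split_ifs <;> first | rfl | omega
  · refine ⟨j, LinearMap.mulRight k (a j.succ), fun x => ?_⟩
    ext l
    simp only [Fin.contractNth, Function.update_apply, Fin.ext_iff, Fin.val_castSucc, Fin.val_succ,
      LinearMap.mulRight_apply]
    split_ifs <;> first | rfl | omega | (obtain rfl : l = j := Fin.ext (by omega); rfl)
  · by_cases h' : (i : ℕ) = j + 1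
    · refine ⟨j, LinearMap.mulLeft k (a j.castSucc), fun x => ?_⟩
      ext l
      simp only [Fin.contractNth, Function.update_apply, Fin.ext_iff, Fin.val_castSucc,
        Fin.val_succ, LinearMap.mulLeft_apply]
      split_ifs <;> first | rfl | omega | (obtain rfl : l = j := Fin.ext (by omega); rfl)
    · refine ⟨⟨i - 1, by omega⟩, LinearMap.id, fun x => ?_⟩
      ext l
      simp only [Fin.contractNth, Function.update_apply, Fin.ext_iff, Fin.val_castSucc,
        Fin.val_succ, LinearMap.id_apply]
      split_ifs <;> first | rfl | omega

variable {k A} in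
/-- `(a_0, …, a_n) ↦ f (a_0, …, a_j a_{j+1}, …, a_n)`, for `j < n`. -/
def contract {X : Type w'} [AddCommGroup X] [Module k X] {n : ℕ}
    (f : MultilinearMap k (fun _ : Fin n => A) X) (j : Fin n) :
    MultilinearMap k (fun _ : Fin (n + 1) => A) X where
  toFun a := f (Fin.contractNth j.castSucc (· * ·) a)
  map_update_add' := by
    intro inst a i x y
    rw [Subsingleton.elim inst (instDecidableEqFin _)]
    obtain ⟨p, g, h⟩ := contractNth_update (k := k) a j i
    rw [h, h, h, map_add, f.map_update_add]
  map_update_smul' := by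
    intro inst a i c x
    rw [Subsingleton.elim inst (instDecidableEqFin _)]
    obtain ⟨p, g, h⟩ := contractNth_update (k := k) a j i
    rw [h, h, map_smul, f.map_update_smul]

/-- The Hochschild chains `C_n(A) = A^{⊗ (n + 1)}`. -/
abbrev HochschildChain (n : ℕ) : Type (max u w) := ⨂[k] _ : Fin (n + 1), A

/-- `b(a_0 ⊗ ⋯ ⊗ a_{n+1}) = ∑_{j ≤ n} (-1)^j a_0 ⊗ ⋯ ⊗ a_j a_{j+1} ⊗ ⋯ ⊗ a_{n+1}
  + (-1)^{n+1} a_{n+1} a_0 ⊗ a_1 ⊗ ⋯ ⊗ a_n`. -/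
def hochschildBoundary (n : ℕ) : HochschildChain k A (n + 1) →ₗ[k] HochschildChain k A n :=
  PiTensorProduct.lift
    (∑ j : Fin (n + 1), (-1 : k) ^ (j : ℕ) • contract (PiTensorProduct.tprod k) j +
      (-1 : k) ^ (n + 1) •
        (contract (PiTensorProduct.tprod k) (0 : Fin (n + 1))).domDomCongr
          (finRotate (n + 2)).symm)

/-- `HH_n(A)`. -/
abbrev HochschildHomology (n : ℕ) : Type (max u w) := homology (hochschildBoundary k A) n

/-- The Hochschild cochains `C^n(A) = Hom(A^{⊗ n}, A)`. -/
abbrev HochschildCochain (n : ℕ) : Type w := MultilinearMap k (fun _ : Fin n => A) A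

/-- `(δ f)(a_0, …, a_n) = a_0 f(a_1, …, a_n)
  + ∑_{j < n} (-1)^{j+1} f(a_0, …, a_j a_{j+1}, …, a_n) + (-1)^{n+1} f(a_0, …, a_{n-1}) a_n`. -/
def hochschildCoboundary (n : ℕ) : HochschildCochain k A n →ₗ[k] HochschildCochain k A (n + 1) where
  toFun f :=
    LinearMap.uncurryLeft
        { toFun := fun a => (LinearMap.mulLeft k a).compMultilinearMap f
          map_add' := fun a b => by ext; simp [add_mul]
          map_smul' := fun c a => by ext; simp } +
      ∑ j : Fin n, (-1 : k) ^ ((j : ℕ) + 1) • contract f j +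
      (-1 : k) ^ (n + 1) • ((LinearMap.mul k A).compMultilinearMap f).uncurryRight
  map_add' f g := by
    ext a
    simp [contract, Finset.sum_add_distrib]
    abel
  map_smul' c f := by
    ext a
    simp [contract, Finset.smul_sum, smul_comm c]

/-- `HH^n(A)`. -/
abbrev HochschildCohomology (n : ℕ) : Type w := cohomology (hochschildCoboundary k A) n

theorem hochschildBoundary_tprod (n : ℕ) (a : Fin (n + 2) → A) :
    hochschildBoundary k A n (PiTensorProduct.tprod k a) =
      ∑ j : Fin (n + 1), (-1 : k) ^ (j : ℕ) •
          PiTensorProduct.tprod k (Fin.contractNth j.castSucc (· * ·) a) +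
        (-1 : k) ^ (n + 1) • PiTensorProduct.tprod k
          (Fin.cons (a (Fin.last _) * a 0) (fun i : Fin n => a i.succ.castSucc)) := by
  have h : Fin.contractNth (0 : Fin (n + 1)).castSucc (· * ·)
      (fun i => a (finRotate (n + 2) |>.symm i)) =
      Fin.cons (a (Fin.last _) * a 0) (fun i : Fin n => a i.succ.castSucc) := by
    have hr : ∀ i : Fin (n + 1), (finRotate (n + 2)).symm i.succ = i.castSucc := fun i => by
      rw [Equiv.symm_apply_eq, finRotate_apply, Fin.coeSucc_eq_succ]
    have h0 : (finRotate (n + 2)).symm 0 = Fin.last (n + 1) := by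
      rw [Equiv.symm_apply_eq, finRotate_last]
    ext l
    refine Fin.cases ?_ (fun l => ?_) l
    · have h1 := hr 0
      simp only [Fin.castSucc_zero] at h1
      rw [Fin.contractNth_apply_of_eq _ _ _ _ (by simp)]
      simp only [Fin.castSucc_zero, Fin.cons_zero, h0, h1]
    · rw [Fin.contractNth_apply_of_gt _ _ _ _ (by simp), hr, Fin.cons_succ]
  rw [hochschildBoundary, PiTensorProduct.lift.tprod, add_apply,
    sum_apply, ← h]
  rfl

theorem hochschildCoboundary_apply (n : ℕ) (f : HochschildCochain k A n) (a : Fin (n + 1) → A) :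
    hochschildCoboundary k A n f a =
      a 0 * f (Fin.tail a) +
        ∑ j : Fin n, (-1 : k) ^ ((j : ℕ) + 1) • f (Fin.contractNth j.castSucc (· * ·) a) +
        (-1 : k) ^ (n + 1) • (f (Fin.init a) * a (Fin.last n)) := by
  simp [hochschildCoboundary, contract]

end Hochschild

/-! ## The left, right and bimodule multi-Koszul complexes of `A = T(V)/⟨R⟩` -/

namespace Relations

variable {k : Type u} [Field k] {V : Type v} [AddCommGroup V] [Module k V]
  [FiniteDimensional k V] (D : Relations k V)

/-- The left multi-Koszul complex `K(A)_i = A ⊗ J_i`: the differential is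
`α ⊗ v₁ ⋯ vₙ ↦ α v₁ ⊗ v₂ ⋯ vₙ` for `i` odd and `α ⊗ v₁ ⋯ vₙ ↦ α v₁ ⋯ v_{s-1} ⊗ v_s ⋯ vₙ` on
`A ⊗ J_i^s` for `i` even. -/
def leftDiff : ∀ i, D.K D.Alg (i + 1) →ₗ[D.Alg] D.K D.Alg i :=
  diff (peelLeft D.gen) (fun s => peelLeft D.gen ^ (s - 1))
    (hat_mem (peelLeft_word D.gen 0) (fun _ hs => peelLeft_lowers D.gen hs)
      (fun s hs => (peelLeft_lowers D.gen hs).pow (s - 1)))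

/-- The augmentation `K(A)_0 = A ⊗ V^{(0)} = A → k`. -/
def leftAug : D.K D.Alg 0 →ₗ[k] k :=
  (LinearMap.mul' k k ∘ₗ TensorProduct.map D.aug.toLinearMap
      (TensorAlgebra.algebraMapInv : TensorAlgebra k V →ₐ[k] k).toLinearMap) ∘ₗ
    (D.K D.Alg 0).subtype.restrictScalars k

/-- Right `A`-modules are left `Aᵐᵒᵖ`-modules, and `J_i ⊗ A` is written `Aᵐᵒᵖ ⊗ J_i`. -/
def opGen : V →ₗ[k] D.Algᵐᵒᵖ := (MulOpposite.opLinearEquiv k).toLinearMap ∘ₗ D.gen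

/-- The right multi-Koszul complex `J_i ⊗ A`: the differential is
`vₙ ⋯ v₁ ⊗ α ↦ vₙ ⋯ v₂ ⊗ v₁ α` for `i` odd and `vₙ ⋯ v₁ ⊗ α ↦ vₙ ⋯ v_s ⊗ v_{s-1} ⋯ v₁ α` on
`J_i^s ⊗ A` for `i` even. -/
def rightDiff : ∀ i, D.K D.Algᵐᵒᵖ (i + 1) →ₗ[D.Algᵐᵒᵖ] D.K D.Algᵐᵒᵖ i :=
  diff (peelRight D.opGen) (fun s => peelRight D.opGen ^ (s - 1))
    (hat_mem (peelRight_word D.opGen 0) (fun _ hs => peelRight_lowers D.opGen hs)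
      (fun s hs => (peelRight_lowers D.opGen hs).pow (s - 1)))

/-- The augmentation `V^{(0)} ⊗ A = A → k`. -/
def rightAug : D.K D.Algᵐᵒᵖ 0 →ₗ[k] k :=
  (LinearMap.mul' k k ∘ₗ TensorProduct.map
      (D.aug.toLinearMap ∘ₗ (MulOpposite.opLinearEquiv k).symm.toLinearMap)
      (TensorAlgebra.algebraMapInv : TensorAlgebra k V →ₐ[k] k).toLinearMap) ∘ₗ
    (D.K D.Algᵐᵒᵖ 0).subtype.restrictScalars k

/-- `A` is left multi-Koszul: the augmented left multi-Koszul complex is a projective resolution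
of the trivial left `A`-module `k`. -/
structure IsLeftMultiKoszul : Prop where
  projective : ∀ i, Module.Projective D.Alg (D.K D.Alg i)
  exact : IsExactAugmented (C := fun i => D.K D.Alg i) (fun i => (D.leftDiff i).toAddMonoidHom) D.leftAug.toAddMonoidHom

/-- `A` is right multi-Koszul: the augmented right multi-Koszul complex is a projective resolution
of the trivial right `A`-module `k`. -/
structure IsRightMultiKoszul : Prop where
  projective : ∀ i, Module.Projective D.Algᵐᵒᵖ (D.K D.Algᵐᵒᵖ i)
  exact : IsExactAugmented (C := fun i => D.K D.Algᵐᵒᵖ i) (fun i => (D.rightDiff i).toAddMonoidHom) D.rightAug.toAddMonoidHom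

/-- `v ↦ v ⊗ 1 ∈ A^e`. The free `A`-bimodule `A ⊗ W ⊗ A` on a vector space `W` is written
`A^e ⊗ W`, with `a ⊗ w ⊗ b` corresponding to `(a ⊗ b) ⊗ w`. -/
def envLeft : V →ₗ[k] Env k D.Alg where
  toFun v := Env.tmul (D.gen v) 1
  map_add' v w := by rw [map_add]; exact TensorProduct.add_tmul _ _ _
  map_smul' c v := by rw [map_smul, RingHom.id_apply, Env.smul_tmul]

/-- `v ↦ 1 ⊗ v ∈ A^e`. -/
def envRight : V →ₗ[k] Env k D.Alg where
  toFun v := Env.tmul 1 (D.gen v)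
  map_add' v w := by rw [map_add]; exact TensorProduct.tmul_add _ _ _
  map_smul' c v := by rw [map_smul, RingHom.id_apply, Env.smul_tmul_right]

/-- `δ'_L : α ⊗ v₁ ⋯ vₙ ⊗ β ↦ α v₁ ⊗ v₂ ⋯ vₙ ⊗ β`. -/
def deltaL : Module.End (Env k D.Alg) (Env k D.Alg ⊗[k] TensorAlgebra k V) := peelLeft D.envLeft

/-- `δ'_R : α ⊗ v₁ ⋯ vₙ ⊗ β ↦ α ⊗ v₁ ⋯ vₙ₋₁ ⊗ vₙ β`. -/
def deltaR : Module.End (Env k D.Alg) (Env k D.Alg ⊗[k] TensorAlgebra k V) := peelRight D.envRight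

theorem deltaL_tmul (a b : D.Alg) (v : V) (x : TensorAlgebra k V) :
    D.deltaL (Env.tmul a b ⊗ₜ (TensorAlgebra.ι k v * x)) = Env.tmul (a * D.gen v) b ⊗ₜ x := by
  rw [deltaL, peelLeft_tmul, envLeft, LinearMap.coe_mk, AddHom.coe_mk, Env.tmul_mul_tmul, one_mul]

theorem deltaR_tmul (a b : D.Alg) (v : V) (x : TensorAlgebra k V) :
    D.deltaR (Env.tmul a b ⊗ₜ (x * TensorAlgebra.ι k v)) = Env.tmul a (D.gen v * b) ⊗ₜ x := by
  rw [deltaR, peelRight_tmul, envRight, LinearMap.coe_mk, AddHom.coe_mk, Env.tmul_mul_tmul,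
    mul_one]

theorem deltaL_lowers {s : ℕ} (hs : s ∈ D.S) : D.Lowers D.deltaL 1 s := peelLeft_lowers _ hs

theorem deltaR_lowers {s : ℕ} (hs : s ∈ D.S) : D.Lowers D.deltaR 1 s := peelRight_lowers _ hs

/-- The multi-Koszul bimodule complex `K_{L-R}(A)_i = A ⊗ J_i ⊗ A`: the differential is
`δ'_L - δ'_R` for `i` odd and `∑_{j=0}^{s-1} δ'_L^j δ'_R^{s-1-j}` on `A ⊗ J_i^s ⊗ A` for `i`
even. -/
def bimoduleDiff : ∀ i, D.K (Env k D.Alg) (i + 1) →ₗ[Env k D.Alg] D.K (Env k D.Alg) i :=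
  diff (D.deltaL - D.deltaR)
    (fun s => ∑ j ∈ Finset.range s, D.deltaL ^ j * D.deltaR ^ (s - 1 - j))
    (hat_mem
      (fun x hx => Submodule.sub_mem _ (peelLeft_word D.envLeft 0 x hx)
        (peelRight_word D.envRight 0 x hx))
      (fun _ hs => (D.deltaL_lowers hs).sub (D.deltaR_lowers hs))
      (fun s hs => Lowers.sum _ fun j hj => by
        have h := ((D.deltaL_lowers hs).pow j).mul ((D.deltaR_lowers hs).pow (s - 1 - j))
        rwa [show j + (s - 1 - j) = s - 1 by
          have := Finset.mem_range.1 hj; omega] at h))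

/-- The augmentation `K_{L-R}(A)_0 = A ⊗ A → A` given by the product. -/
def bimoduleAug : D.K (Env k D.Alg) 0 →ₗ[Env k D.Alg] D.Alg :=
  extend D.proj.toLinearMap ∘ₗ (D.K (Env k D.Alg) 0).subtype

/-- The `ℤ`-grading of `A`, zero in negative degrees. -/
def algGrading (n : ℤ) : Submodule k D.Alg := ⨆ (p : ℕ) (_ : (p : ℤ) = n), D.component p

/-- The grading of `A^e`: degree `n` is the sum of the `A_p ⊗ A_q` with `p + q = n`. -/
def envGrading (n : ℕ) : Submodule k (Env k D.Alg) :=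
  Submodule.span k {x | ∃ p q, p + q = n ∧
    ∃ a ∈ D.component p, ∃ b ∈ D.component q, x = Env.tmul a b}

/-- The grading of `A ⊗ J_i ⊗ A` by total degree, induced by that of `A ⊗ T(V) ⊗ A`. -/
def bimoduleGrading (i : ℕ) (n : ℤ) : Submodule k (D.K (Env k D.Alg) i) :=
  (Submodule.span k {x | ∃ p q : ℕ, (p : ℤ) + q = n ∧
    ∃ e ∈ D.envGrading p, ∃ w ∈ word k V q, x = e ⊗ₜ[k] w}).comap
    ((D.K (Env k D.Alg) i).subtype.restrictScalars k)

end Relations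

end MultiKoszul

/-! That the sequence is a complex is a telescoping identity. The operators `δ'_L` and `δ'_R`
commute, so the composite of an odd and an even differential is `δ'_L^s - δ'_R^s`. Each of these
powers multiplies a relation from `R_s` into `A`, where it becomes zero (`bimoduleDiff_comp`).

Exactness is compared with the left complex by filtering `A ⊗ J_i ⊗ A` by the degree of the right
factor. There `δ'_L` preserves that degree and `δ'_R` raises it by one, so the leading part of the
differential is `δ'_L` in odd degrees and `δ'_L^(s-1)` in even ones. The sequence of leading parts
is thus the left multi-Koszul complex tensored with `A` over the field `k`. If the left complex is
exact, so are the leading parts, and successive approximation gives exactness of the bimodule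
complex; it stops because partial degree is bounded by total degree (`filtered_exact`). Conversely,
suppose that the bimodule complex is exact and put a cycle of the left complex in partial degree
zero. Its bimodule differential lies in the next filtration step, and filtered exactness one place
lower, known by induction, allows a correction from that step to a true cycle. Reading off partial
degree zero of a primitive gives the result (`leading_exact`, `diffB_exact`). For the right complex
the two factors exchange roles. The structure `Side` records what the argument needs, so it is
carried out once.

For minimality, every summand of every differential removes at least one letter and hence multiplies
by an element of positive degree. Its image lies in the graded radical, and the graded Nakayama
lemma (`isEssentialOnto`) makes the surjections essential.

For Hochschild theory, the bar complex is an exact projective resolution of `A` over `A^e`, by an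
explicit contracting homotopy. Two projective resolutions are homotopy equivalent, and `A ⊗_{A^e} -`
and `Hom_{A^e}(-, A)` preserve homotopies. On the bar resolution these functors return the
Hochschild complexes. -/

namespace MultiKoszul

universe u v w w'

/-! ## Gradings given by projections -/

section Gradings

variable {k : Type u} [Field k]

/-- `𝒳` is a grading of `X` with projections `p n : X → 𝒳 n`. -/
structure Grading {X : Type*} [AddCommGroup X] [Module k X] (𝒳 : ℕ → Submodule k X)
    (p : ℕ → Module.End k X) : Prop where
  same : ∀ n, ∀ x ∈ 𝒳 n, p n x = x
  ne : ∀ m n, m ≠ n → ∀ x ∈ 𝒳 m, p n x = 0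
  top : ⨆ n, 𝒳 n = ⊤

namespace Grading

variable {X : Type*} [AddCommGroup X] [Module k X] {𝒳 : ℕ → Submodule k X}
  {p : ℕ → Module.End k X} {Y : Type*} [AddCommGroup Y] [Module k Y] {𝒴 : ℕ → Submodule k Y}
  {q : ℕ → Module.End k Y}

@[elab_as_elim]
theorem induction (h : Grading 𝒳 p) {P : X → Prop} (x : X) (mem : ∀ n, ∀ x ∈ 𝒳 n, P x)
    (add : ∀ x y, P x → P y → P (x + y)) : P x := by
  have hx : x ∈ ⨆ n, 𝒳 n := h.top ▸ Submodule.mem_top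
  induction hx using Submodule.iSup_induction' with
  | mem n x hx => exact mem n x hx
  | zero => exact mem 0 0 (Submodule.zero_mem _)
  | add x y _ _ hx hy => exact add x y hx hy

theorem proj_mem (h : Grading 𝒳 p) (n : ℕ) (x : X) : p n x ∈ 𝒳 n := by
  refine h.induction x (fun m y hy => ?_) (fun y z hy hz => ?_)
  · by_cases hm : m = n
    · subst hm; rwa [h.same _ _ hy]
    · rw [h.ne _ _ hm _ hy]; exact Submodule.zero_mem _
  · rw [map_add]; exact Submodule.add_mem _ hy hz

/-- The identity is asserted for every large `M`, so that two elements can be given a common bound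
when they are added. -/
theorem exists_sum (h : Grading 𝒳 p) (x : X) :
    ∃ N, ∀ M, N ≤ M → x = ∑ n ∈ Finset.range M, p n x := by
  refine h.induction x (fun m y hy => ?_) (fun y z hy hz => ?_)
  · refine ⟨m + 1, fun M hM => ?_⟩
    rw [Finset.sum_eq_single m, h.same _ _ hy]
    · exact fun n _ hn => h.ne _ _ hn.symm _ hy
    · intro hm; simp at hm; omega
  · obtain ⟨N, hN⟩ := hy
    obtain ⟨N', hN'⟩ := hz
    refine ⟨max N N', fun M hM => ?_⟩
    simp only [map_add, Finset.sum_add_distrib]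
    rw [← hN M (by omega), ← hN' M (by omega)]

theorem proj_proj (h : Grading 𝒳 p) (n : ℕ) (x : X) : p n (p n x) = p n x :=
  h.same _ _ (h.proj_mem n x)

theorem proj_proj_ne (h : Grading 𝒳 p) {m n : ℕ} (hmn : m ≠ n) (x : X) : p n (p m x) = 0 :=
  h.ne _ _ hmn _ (h.proj_mem m x)

theorem proj_comm (h : Grading 𝒳 p) (h' : Grading 𝒴 q) (f : X →ₗ[k] Y)
    (hf : ∀ n, ∀ x ∈ 𝒳 n, f x ∈ 𝒴 n) (n : ℕ) (x : X) : q n (f x) = f (p n x) := by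
  refine h.induction x (fun m y hy => ?_) (fun y z hy hz => ?_)
  · by_cases hm : m = n
    · subst hm; rw [h.same _ _ hy, h'.same _ _ (hf _ _ hy)]
    · rw [h.ne _ _ hm _ hy, h'.ne _ _ hm _ (hf _ _ hy), map_zero]
  · simp only [map_add, hy, hz]

theorem mem_iff (h : Grading 𝒳 p) {n : ℕ} {x : X} : x ∈ 𝒳 n ↔ p n x = x :=
  ⟨h.same n x, fun hx => hx ▸ h.proj_mem n x⟩

/-- A submodule stable under the projections inherits the grading. -/
theorem restrict (h : Grading 𝒳 p) (P : Submodule k X) (hP : ∀ n, ∀ x ∈ P, p n x ∈ P) :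
    Grading (fun n => (𝒳 n).comap P.subtype) (fun n => (p n).restrict (hP n)) where
  same n x hx := Subtype.ext (h.same n x hx)
  ne m n hmn x hx := Subtype.ext (h.ne m n hmn x hx)
  top := by
    rw [eq_top_iff]
    intro x _
    obtain ⟨N, hN⟩ := h.exists_sum (x : X)
    have : x = ∑ n ∈ Finset.range N, (p n).restrict (hP n) x := by
      apply Subtype.ext
      simpa using hN N le_rfl
    rw [this]
    exact Submodule.sum_mem _ fun n _ =>
      Submodule.mem_iSup_of_mem n (show _ ∈ (𝒳 n) from h.proj_mem n x)

/-- An `ℕ`-grading, extended by zero to negative degrees. -/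
theorem isInternal_int (h : Grading 𝒳 p) (𝒵 : ℤ → Submodule k X)
    (hnat : ∀ n : ℕ, 𝒵 n = 𝒳 n) (hneg : ∀ n < 0, 𝒵 n = ⊥) : DirectSum.IsInternal 𝒵 := by
  -- For each integer degree there is a linear map that is the identity on that component and kills
  -- the others; applying it proves independence.
  have hkey : ∀ n : ℤ, ∃ f : X →ₗ[k] X, (∀ x ∈ 𝒵 n, f x = x) ∧
      ∀ m, m ≠ n → ∀ x ∈ 𝒵 m, f x = 0 := by
    intro n
    rcases lt_or_ge n 0 with hn | hn
    · refine ⟨0, fun x hx => ?_, fun _ _ _ _ => rfl⟩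
      rw [hneg n hn, Submodule.mem_bot] at hx
      simp [hx]
    · lift n to ℕ using hn
      refine ⟨p n, fun x hx => h.same n x (hnat n ▸ hx), fun m hm x hx => ?_⟩
      rcases lt_or_ge m 0 with hm0 | hm0
      · rw [hneg m hm0, Submodule.mem_bot] at hx
        simp [hx]
      · lift m to ℕ using hm0
        exact h.ne m n (by exact_mod_cast hm) x (hnat m ▸ hx)
  rw [DirectSum.isInternal_submodule_iff_iSupIndep_and_iSup_eq_top]
  constructor
  · intro n
    rw [Submodule.disjoint_def]
    intro x hx hx'
    obtain ⟨f, hf, hf'⟩ := hkey n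
    rw [← hf x hx]
    have hle : (⨆ j, ⨆ (_ : j ≠ n), 𝒵 j) ≤ LinearMap.ker f :=
      iSup₂_le fun j hj y hy => hf' j hj y hy
    exact hle hx'
  · rw [eq_top_iff, ← h.top]
    exact iSup_le fun n => (hnat n) ▸ le_iSup 𝒵 (n : ℤ)

end Grading

/-- The total grading of a tensor product. -/
def tensorGrading {X Y : Type*} [AddCommGroup X] [Module k X] [AddCommGroup Y] [Module k Y]
    (𝒳 : ℕ → Submodule k X) (𝒴 : ℕ → Submodule k Y) (n : ℕ) : Submodule k (X ⊗[k] Y) :=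
  Submodule.span k {z | ∃ i j, i + j = n ∧ ∃ x ∈ 𝒳 i, ∃ y ∈ 𝒴 j, z = x ⊗ₜ y}

/-- The projections of the total grading of a tensor product. -/
def tensorProj {X Y : Type*} [AddCommGroup X] [Module k X] [AddCommGroup Y] [Module k Y]
    (p : ℕ → Module.End k X) (q : ℕ → Module.End k Y) (n : ℕ) : Module.End k (X ⊗[k] Y) :=
  ∑ ij ∈ Finset.HasAntidiagonal.antidiagonal n, TensorProduct.map (p ij.1) (q ij.2)

theorem Grading.tensor {X Y : Type*} [AddCommGroup X] [Module k X] [AddCommGroup Y] [Module k Y]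
    {𝒳 : ℕ → Submodule k X} {𝒴 : ℕ → Submodule k Y} {p : ℕ → Module.End k X}
    {q : ℕ → Module.End k Y} (h : Grading 𝒳 p) (h' : Grading 𝒴 q) :
    Grading (tensorGrading 𝒳 𝒴) (tensorProj p q) := by
  -- On a pure tensor of bidegree `(i, j)`, only the pair `(i, j)` of the antidiagonal contributes.
  have key : ∀ i j n, ∀ x ∈ 𝒳 i, ∀ y ∈ 𝒴 j,
      tensorProj p q n (x ⊗ₜ y) = if i + j = n then x ⊗ₜ y else 0 := by
    intro i j n x hx y hy
    have h0 : ∀ ij : ℕ × ℕ, TensorProduct.map (p ij.1) (q ij.2) (x ⊗ₜ[k] y) =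
        if ij = (i, j) then x ⊗ₜ y else 0 := by
      rintro ⟨a, b⟩
      rw [TensorProduct.map_tmul]
      by_cases ha : i = a
      · by_cases hb : j = b
        · subst ha hb; rw [h.same _ _ hx, h'.same _ _ hy, if_pos rfl]
        · rw [h'.ne _ _ hb _ hy, TensorProduct.tmul_zero, if_neg (by simp; omega)]
      · rw [h.ne _ _ ha _ hx, TensorProduct.zero_tmul, if_neg (by simp; omega)]
    rw [tensorProj, LinearMap.sum_apply, Finset.sum_congr rfl fun ij _ => h0 ij,
      Finset.sum_ite_eq']
    simp
  refine ⟨fun n x hx => ?_, fun m n hmn x hx => ?_, ?_⟩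
  · induction hx using Submodule.span_induction with
    | mem x hx =>
      obtain ⟨i, j, hij, x, hx, y, hy, rfl⟩ := hx
      rw [key i j n x hx y hy, if_pos hij]
    | zero => simp
    | add x y _ _ hx hy => rw [map_add, hx, hy]
    | smul c x _ hx => rw [map_smul, hx]
  · induction hx using Submodule.span_induction with
    | mem x hx =>
      obtain ⟨i, j, hij, x, hx, y, hy, rfl⟩ := hx
      rw [key i j n x hx y hy, if_neg (by omega)]
    | zero => simp
    | add x y _ _ hx hy => rw [map_add, hx, hy, add_zero]
    | smul c x _ hx => rw [map_smul, hx, smul_zero]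
  · rw [eq_top_iff]
    rintro z -
    induction z using TensorProduct.induction_on with
    | zero => exact Submodule.zero_mem _
    | add x y hx hy => exact Submodule.add_mem _ hx hy
    | tmul x y =>
      refine h.induction x (fun i x hx => ?_) (fun x x' hx hx' => ?_)
      · refine h'.induction y (fun j y hy => ?_) (fun y y' hy hy' => ?_)
        · exact Submodule.mem_iSup_of_mem (i + j)
            (Submodule.subset_span ⟨i, j, rfl, x, hx, y, hy, rfl⟩)
        · rw [TensorProduct.tmul_add]; exact Submodule.add_mem _ hy hy'
      · rw [TensorProduct.add_tmul]; exact Submodule.add_mem _ hx hx'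

end Gradings

/-! ## The tensor algebra and the operators removing letters -/

section Words

variable {k : Type u} [Field k] {V : Type v} [AddCommGroup V] [Module k V]

theorem iSup_word : ⨆ n, word k V n = ⊤ :=
  (DirectSum.Decomposition.isInternal (word k V)).submodule_iSup_eq_top

theorem word_grading : Grading (word k V) (fun n => GradedAlgebra.proj (word k V) n) where
  same n x hx := by rw [GradedAlgebra.proj_apply, DirectSum.decompose_of_mem_same _ hx]
  ne m n hmn x hx := by rw [GradedAlgebra.proj_apply, DirectSum.decompose_of_mem_ne _ hx hmn]
  top := iSup_word

theorem word_zero_eq (x : TensorAlgebra k V) (hx : x ∈ word k V 0) :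
    ∃ c : k, x = algebraMap k _ c := by
  rw [word, pow_zero, Submodule.one_eq_range] at hx
  obtain ⟨c, rfl⟩ := hx
  exact ⟨c, rfl⟩

@[elab_as_elim]
theorem word_succ_induction_left {n : ℕ} {P : TensorAlgebra k V → Prop}
    (x : TensorAlgebra k V) (hx : x ∈ word k V (n + 1))
    (mul : ∀ (v : V), ∀ y ∈ word k V n, P (TensorAlgebra.ι k v * y))
    (add : ∀ x y, P x → P y → P (x + y)) :
    P x := by
  rw [word, pow_succ'] at hx
  induction hx using Submodule.mul_induction_on' with
  | mem_mul_mem a ha b hb => obtain ⟨v, rfl⟩ := ha; exact mul v b hb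
  | add a _ b _ ha hb => exact add a b ha hb

@[elab_as_elim]
theorem word_succ_induction_right {n : ℕ} {P : TensorAlgebra k V → Prop}
    (x : TensorAlgebra k V) (hx : x ∈ word k V (n + 1))
    (mul : ∀ (v : V), ∀ y ∈ word k V n, P (y * TensorAlgebra.ι k v))
    (add : ∀ x y, P x → P y → P (x + y)) :
    P x := by
  rw [word, pow_succ] at hx
  induction hx using Submodule.mul_induction_on' with
  | mem_mul_mem b hb a ha => obtain ⟨v, rfl⟩ := ha; exact mul v b hb
  | add a _ b _ ha hb => exact add a b ha hb

@[elab_as_elim]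
-- The decomposition `T(V) = k ⊕ V · T(V)`, which is the form in which `peelLeft` can be evaluated.
theorem tensorAlgebra_induction_left {P : TensorAlgebra k V → Prop} (x : TensorAlgebra k V)
    (scalar : ∀ c : k, P (algebraMap k _ c)) (mul : ∀ (v : V) y, P (TensorAlgebra.ι k v * y))
    (add : ∀ x y, P x → P y → P (x + y)) : P x := by
  refine word_grading.induction x (fun n x hx => ?_) add
  rcases n with _ | n
  · obtain ⟨c, rfl⟩ := word_zero_eq x hx; exact scalar c
  · exact word_succ_induction_left x hx (fun v y _ => mul v y) add

@[elab_as_elim]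
theorem tensorAlgebra_induction_right {P : TensorAlgebra k V → Prop} (x : TensorAlgebra k V)
    (scalar : ∀ c : k, P (algebraMap k _ c)) (mul : ∀ (v : V) y, P (y * TensorAlgebra.ι k v))
    (add : ∀ x y, P x → P y → P (x + y)) : P x := by
  refine word_grading.induction x (fun n x hx => ?_) add
  rcases n with _ | n
  · obtain ⟨c, rfl⟩ := word_zero_eq x hx; exact scalar c
  · exact word_succ_induction_right x hx (fun v y _ => mul v y) add

variable {B : Type w} [Ring B] [Algebra k B]

theorem peelLeft_algebraMap (φ : V →ₗ[k] B) (b : B) (c : k) :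
    peelLeft φ (b ⊗ₜ algebraMap k _ c) = 0 := by
  simp [peelLeft, firstLetter, Algebra.algebraMap_eq_smul_one]

theorem peelRight_algebraMap (φ : V →ₗ[k] B) (b : B) (c : k) :
    peelRight φ (b ⊗ₜ algebraMap k _ c) = 0 := by
  simp [peelRight, lastLetter, Algebra.algebraMap_eq_smul_one]

variable {B' : Type w'} [Ring B'] [Algebra k B']

/-- The maps `f` and `g` may differ. Equal maps express that removing a letter is natural in the
coefficients; consecutive degree projections express that it raises a degree by one; `g = 0`
expresses that it lands in the kernel of `f`. -/
theorem peelLeft_rTensor {f g : B →ₗ[k] B'} {φ : V →ₗ[k] B} {φ' : V →ₗ[k] B'}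
    (h : ∀ b v, f (b * φ v) = g b * φ' v) (x : B ⊗[k] TensorAlgebra k V) :
    f.rTensor _ (peelLeft φ x) = peelLeft φ' (g.rTensor _ x) := by
  induction x using TensorProduct.induction_on with
  | zero => simp
  | add x y hx hy => simp only [map_add, hx, hy]
  | tmul b x =>
    refine tensorAlgebra_induction_left x (fun c => ?_) (fun v y => ?_) (fun x y hx hy => ?_)
    · simp only [LinearMap.rTensor_tmul, peelLeft_algebraMap, map_zero]
    · simp only [LinearMap.rTensor_tmul, peelLeft_tmul, h]
    · simp only [TensorProduct.tmul_add, map_add, hx, hy]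

theorem peelRight_rTensor {f g : B →ₗ[k] B'} {φ : V →ₗ[k] B} {φ' : V →ₗ[k] B'}
    (h : ∀ b v, f (b * φ v) = g b * φ' v) (x : B ⊗[k] TensorAlgebra k V) :
    f.rTensor _ (peelRight φ x) = peelRight φ' (g.rTensor _ x) := by
  induction x using TensorProduct.induction_on with
  | zero => simp
  | add x y hx hy => simp only [map_add, hx, hy]
  | tmul b x =>
    refine tensorAlgebra_induction_right x (fun c => ?_) (fun v y => ?_) (fun x y hx hy => ?_)
    · simp only [LinearMap.rTensor_tmul, peelRight_algebraMap, map_zero]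
    · simp only [LinearMap.rTensor_tmul, peelRight_tmul, h]
    · simp only [TensorProduct.tmul_add, map_add, hx, hy]

/-- On words of length at least two the first and last letters are different letters, so only the
order of the two multiplications matters. On shorter words both composites vanish. -/
theorem peel_commute {φ ψ : V →ₗ[k] B} (h : ∀ v w, φ v * ψ w = ψ w * φ v) :
    Commute (peelLeft φ) (peelRight ψ) := by
  refine LinearMap.ext fun x => ?_
  simp only [Module.End.mul_apply]
  induction x using TensorProduct.induction_on with
  | zero => simp
  | add x y hx hy => simp only [map_add, hx, hy]
  | tmul b x =>
    refine tensorAlgebra_induction_left x (fun c => ?_) (fun v y => ?_) (fun x y hx hy => ?_)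
    · rw [peelRight_algebraMap, peelLeft_algebraMap, map_zero, map_zero]
    · refine tensorAlgebra_induction_right y (fun c => ?_) (fun w y => ?_) (fun x y hx hy => ?_)
      · rw [peelLeft_tmul, peelRight_algebraMap, ← Algebra.commutes, peelRight_tmul,
          peelLeft_algebraMap]
      · rw [peelLeft_tmul, peelRight_tmul, ← mul_assoc, peelRight_tmul, peelLeft_tmul, mul_assoc,
          mul_assoc, h]
      · simp only [mul_add, TensorProduct.tmul_add, map_add, hx, hy]
    · simp only [TensorProduct.tmul_add, map_add, hx, hy]

theorem peelLeft_pow_tmul (φ : V →ₗ[k] B) (n : ℕ) (b : B) (x : TensorAlgebra k V)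
    (hx : x ∈ word k V n) (y : TensorAlgebra k V) :
    (peelLeft φ ^ n) (b ⊗ₜ (x * y)) = (b * TensorAlgebra.lift k φ x) ⊗ₜ y := by
  induction n generalizing b x with
  | zero =>
    obtain ⟨c, rfl⟩ := word_zero_eq x hx
    simp [Algebra.algebraMap_eq_smul_one, TensorProduct.smul_tmul]
  | succ n ih =>
    refine word_succ_induction_left x hx (fun v z hz => ?_) (fun x z hx hz => ?_)
    · rw [pow_succ, Module.End.mul_apply, mul_assoc, peelLeft_tmul, ih _ _ hz, map_mul,
        TensorAlgebra.lift_ι_apply, mul_assoc]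
    · simp only [add_mul, TensorProduct.tmul_add, map_add, hx, hz, mul_add, TensorProduct.add_tmul]

/-- Letters leave from the right end, so their images are multiplied in reversed order; hence the
passage through the opposite algebra. -/
theorem peelRight_pow_tmul (φ : V →ₗ[k] B) (n : ℕ) (b : B) (x : TensorAlgebra k V)
    (hx : x ∈ word k V n) (y : TensorAlgebra k V) :
    (peelRight φ ^ n) (b ⊗ₜ (y * x)) = (b * (TensorAlgebra.lift k
      ((MulOpposite.opLinearEquiv k).toLinearMap ∘ₗ φ) x).unop) ⊗ₜ y := by
  induction n generalizing b x with
  | zero =>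
    obtain ⟨c, rfl⟩ := word_zero_eq x hx
    simp [Algebra.algebraMap_eq_smul_one, TensorProduct.smul_tmul]
  | succ n ih =>
    refine word_succ_induction_right x hx (fun v z hz => ?_) (fun x z hx hz => ?_)
    · rw [pow_succ, Module.End.mul_apply, ← mul_assoc, peelRight_tmul, ih _ _ hz, map_mul,
        TensorAlgebra.lift_ι_apply, MulOpposite.unop_mul, mul_assoc]
      rfl
    · simp only [mul_add, TensorProduct.tmul_add, map_add, hx, hz, MulOpposite.unop_add,
        TensorProduct.add_tmul]

end Words

/-! ### The spaces `B ⊗ J_i` and the differentials `hat`, over a general coefficient algebra -/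

section Complexes

variable {k : Type u} [Field k] {V : Type v} [AddCommGroup V] [Module k V]
variable {B : Type w} [Ring B] [Algebra k B]

namespace Relations

variable {D : Relations k V}

theorem eq_of_baseChange {X : Type*} [AddCommGroup X] [Module B X]
    {f g : B ⊗[k] TensorAlgebra k V →ₗ[B] X} {P : Submodule k (TensorAlgebra k V)}
    (h : ∀ x ∈ P, f (1 ⊗ₜ x) = g (1 ⊗ₜ x)) : ∀ x ∈ P.baseChange B, f x = g x := by
  intro x hx
  have := map_mem_of_baseChange (f - g) P ⊥ (fun y hy => by simp [h y hy]) x hx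
  simpa [sub_eq_zero] using this

@[elab_as_elim]
theorem baseChange_induction {P : Submodule k (TensorAlgebra k V)}
    {Q : B ⊗[k] TensorAlgebra k V → Prop} (x : B ⊗[k] TensorAlgebra k V)
    (hx : x ∈ P.baseChange B) (tmul : ∀ b, ∀ y ∈ P, Q (b ⊗ₜ y))
    (add : ∀ x y, Q x → Q y → Q (x + y)) : Q x := by
  rw [Submodule.baseChange_eq_span] at hx
  -- The claim is strengthened to all multiples of `x`, since `Q` itself is not assumed stable under
  -- scalars and the span is taken over `B`.
  suffices h : ∀ b : B, Q (b • x) by simpa using h 1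
  induction hx using Submodule.span_induction with
  | mem y hy =>
    obtain ⟨z, hz, rfl⟩ := hy
    intro b
    simpa [TensorProduct.smul_tmul'] using tmul b z hz
  | zero => simpa using tmul 0 0 P.zero_mem
  | add y z _ _ hy hz => intro b; rw [smul_add]; exact add _ _ (hy b) (hz b)
  | smul c y _ hy => intro b; rw [← mul_smul]; exact hy _

theorem J_of_two_le {i : ℕ} (hi : 2 ≤ i) : D.J i = ⨆ s ∈ D.S, D.Jbar s (koszulDegree s i) :=
  if_neg (by omega)

theorem J_of_lt_two {i : ℕ} (hi : i < 2) : D.J i = word k V i := if_pos hi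

@[elab_as_elim]
theorem J_induction {i : ℕ} (hi : 2 ≤ i) {P : TensorAlgebra k V → Prop} (x : TensorAlgebra k V)
    (hx : x ∈ D.J i) (zero : P 0)
    (mem : ∀ s ∈ D.S, ∀ y ∈ D.Jbar s (koszulDegree s i), P y)
    (add : ∀ x y, P x → P y → P (x + y)) : P x := by
  rw [J_of_two_le hi] at hx
  induction hx using Submodule.iSup_induction' with
  | zero => exact zero
  | add y z _ _ hy hz => exact add y z hy hz
  | mem t y hy =>
    by_cases ht : t ∈ D.S
    · simp only [ht, iSup_pos] at hy
      exact mem t ht y hy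
    · simp only [ht, iSup_false, Submodule.mem_bot] at hy
      exact hy ▸ zero

theorem Jbar_le_J {s i : ℕ} (hs : s ∈ D.S) : D.Jbar s (koszulDegree s i) ≤ D.J i := by
  rcases lt_or_ge i 2 with h | h
  · rw [J_of_lt_two h]
    refine (Jbar_le_word hs).trans (le_of_eq ?_)
    congr 1
    interval_cases i <;> simp [koszulDegree]
  · rw [J_of_two_le h]
    exact le_iSup₂_of_le s hs le_rfl

/-- `J i` is spanned by homogeneous elements. -/
@[elab_as_elim]
theorem J_homogeneous_induction {i : ℕ} {P : TensorAlgebra k V → Prop} (x : TensorAlgebra k V)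
    (hx : x ∈ D.J i) (zero : P 0) (mem : ∀ n, ∀ y ∈ word k V n, y ∈ D.J i → P y)
    (add : ∀ x y, P x → P y → P (x + y)) : P x := by
  rcases lt_or_ge i 2 with h | h
  · exact mem i x (by rwa [J_of_lt_two h] at hx) hx
  · exact J_induction h x hx zero
      (fun s hs y hy => mem _ y (Jbar_le_word hs hy) (Jbar_le_J hs hy)) add

/-- This and the next lemma count the letters removed by a differential: one when it starts in odd
homological degree, `s - 1` when it starts in even degree. Two consecutive differentials remove `s`
letters. -/
theorem koszulDegree_even {s i : ℕ} (hi : Even i) : koszulDegree s (i + 1) = koszulDegree s i + 1 := by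
  obtain ⟨l, rfl⟩ := hi
  simp [koszulDegree, show (l + l + 1) / 2 = l by omega, show (l + l) / 2 = l by omega,
    show (l + l + 1) % 2 = 1 by omega, show (l + l) % 2 = 0 by omega]

theorem koszulDegree_odd {s i : ℕ} (hs : 2 ≤ s) (hi : ¬ Even i) :
    koszulDegree s (i + 1) = koszulDegree s i + (s - 1) := by
  obtain ⟨l, rfl⟩ := Nat.not_even_iff_odd.1 hi
  simp only [koszulDegree, show (2 * l + 1 + 1) / 2 = l + 1 by omega,
    show (2 * l + 1) / 2 = l by omega, show (2 * l + 1 + 1) % 2 = 0 by omega,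
    show (2 * l + 1) % 2 = 1 by omega, mul_add]
  omega

theorem le_koszulDegree {s i : ℕ} (hi : 2 ≤ i) : s ≤ koszulDegree s i := by
  have : 1 ≤ i / 2 := by omega
  calc s = s * 1 := (mul_one s).symm
    _ ≤ s * (i / 2) := Nat.mul_le_mul_left s this
    _ ≤ _ := Nat.le_add_right _ _

theorem hat_one (odd : Module.End B (B ⊗[k] TensorAlgebra k V))
    (even : ℕ → Module.End B (B ⊗[k] TensorAlgebra k V)) : D.hat odd even 1 = odd := if_pos rfl

theorem degreeProj_apply {m n : ℕ} {x : B ⊗[k] TensorAlgebra k V}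
    (hx : x ∈ (word k V m).baseChange B) : degreeProj n x = if m = n then x else 0 := by
  split_ifs with h
  · subst h
    refine eq_of_baseChange (g := LinearMap.id) (fun y hy => ?_) x hx
    rw [degreeProj, LinearMap.baseChange_tmul, word_grading.same _ _ hy, LinearMap.id_apply]
  · refine eq_of_baseChange (g := 0) (fun y hy => ?_) x hx
    rw [degreeProj, LinearMap.baseChange_tmul, word_grading.ne _ _ h _ hy, TensorProduct.tmul_zero,
      LinearMap.zero_apply]

/-- For `i ≥ 2` the degrees `n_s(i)` are distinct for distinct `s`, so the degree projections inside
`hat` leave only the summand belonging to `s`. -/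
theorem hat_apply (odd : Module.End B (B ⊗[k] TensorAlgebra k V))
    (even : ℕ → Module.End B (B ⊗[k] TensorAlgebra k V)) {i s : ℕ} (hi : 2 ≤ i) (hs : s ∈ D.S)
    {x : B ⊗[k] TensorAlgebra k V} (hx : x ∈ (D.Jbar s (koszulDegree s i)).baseChange B) :
    D.hat odd even i x = (if Odd i then odd else even s) x := by
  have hx' := Submodule.baseChange_mono B (Jbar_le_word hs) hx
  rw [hat, if_neg (by omega), LinearMap.sum_apply, Finset.sum_eq_single s]
  · rw [Module.End.mul_apply, degreeProj_apply hx', if_pos rfl]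
  · intro t _ hts
    rw [Module.End.mul_apply, degreeProj_apply hx',
      if_neg fun h => hts (koszulDegree_injective hi h).symm, map_zero]
  · exact fun h => (h hs).elim

theorem K_induction {X : Type*} [AddCommGroup X] [Module B X] {i : ℕ} (hi : 2 ≤ i)
    {f g : B ⊗[k] TensorAlgebra k V →ₗ[B] X}
    (h : ∀ s ∈ D.S, ∀ x ∈ (D.Jbar s (koszulDegree s i)).baseChange B, f x = g x) :
    ∀ x ∈ D.K B i, f x = g x := by
  refine eq_of_baseChange fun y hy => ?_
  refine J_induction hi y hy ?_ (fun s hs z hz => ?_) (fun a b ha hb => ?_)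
  · simp
  · exact h s hs _ (Submodule.tmul_mem_baseChange_of_mem _ hz)
  · simp only [TensorProduct.tmul_add, map_add, ha, hb]

/-- Odd and even differentials alternate, and on the part belonging to `s` both stay in that part.
The composite is therefore one of the two products assumed to vanish. -/
theorem hat_hat {odd : Module.End B (B ⊗[k] TensorAlgebra k V)}
    {even : ℕ → Module.End B (B ⊗[k] TensorAlgebra k V)}
    (ho : ∀ s ∈ D.S, D.Lowers odd 1 s) (he : ∀ s ∈ D.S, D.Lowers (even s) (s - 1) s)
    (h : ∀ s ∈ D.S, ∀ m, s ≤ m → ∀ x ∈ (D.Jbar s m).baseChange B,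
      odd (even s x) = 0 ∧ even s (odd x) = 0) (i : ℕ) :
    ∀ x ∈ D.K B (i + 2), D.hat odd even (i + 1) (D.hat odd even (i + 2) x) = 0 := by
  refine K_induction (f := D.hat odd even (i + 1) * D.hat odd even (i + 2)) (g := 0) (by omega)
    fun s hs x hx => ?_
  have hz := h s hs _ (le_koszulDegree (by omega)) x hx
  rw [Module.End.mul_apply, hat_apply _ _ (by omega) hs hx, LinearMap.zero_apply]
  rcases i with _ | i
  -- Homological degree one is treated apart, because there `hat` is defined without degree
  -- projections.
  · rw [hat_one, if_neg (by decide), hz.1]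
  rw [hat_apply _ _ (by omega) hs]
  · by_cases hi : Odd (i + 1 + 2)
    · rw [if_pos hi, if_neg (by grind), hz.2]
    · rw [if_neg hi, if_pos (by grind), hz.1]
  · by_cases hi : Odd (i + 1 + 2)
    · rw [if_pos hi]
      refine ho s hs _ _ ?_
      rwa [← koszulDegree_even (by grind)]
    · rw [if_neg hi]
      refine he s hs _ _ ?_
      rwa [← koszulDegree_odd (D.two_le s hs) (by grind)]

/-- The member of the intersection with index `j = 0` is `R_s ⊗ V^(m-s)`, so the first `s` letters
form a relation, and removing them multiplies by its image in `B`. -/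
theorem peelLeft_pow_Jbar (φ : V →ₗ[k] B) {s m : ℕ} (hs : s ∈ D.S) (hm : s ≤ m)
    (h : ∀ r ∈ D.R s, TensorAlgebra.lift k φ r = 0) :
    ∀ x ∈ (D.Jbar s m).baseChange B, (peelLeft φ ^ s) x = 0 := by
  refine eq_of_baseChange (g := 0) fun y hy => ?_
  rw [Jbar, if_neg (by omega)] at hy
  have hy' := (Submodule.mem_iInf _).1 hy 0
  clear hy
  simp only [Fin.val_zero, word, pow_zero, one_mul] at hy'
  rw [LinearMap.zero_apply]
  induction hy' using Submodule.mul_induction_on' with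
  | mem_mul_mem a ha b hb =>
    rw [peelLeft_pow_tmul φ s 1 a (D.le_word s hs ha), h a ha, mul_zero, TensorProduct.zero_tmul]
  | add a _ b _ ha hb => rw [TensorProduct.tmul_add, map_add, ha, hb, add_zero]

theorem peelRight_pow_Jbar (φ : V →ₗ[k] B) {s m : ℕ} (hs : s ∈ D.S) (hm : s ≤ m)
    (h : ∀ r ∈ D.R s,
      TensorAlgebra.lift k ((MulOpposite.opLinearEquiv k).toLinearMap ∘ₗ φ) r = 0) :
    ∀ x ∈ (D.Jbar s m).baseChange B, (peelRight φ ^ s) x = 0 := by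
  refine eq_of_baseChange (g := 0) fun y hy => ?_
  rw [Jbar, if_neg (by omega)] at hy
  -- The last index `j = m - s` gives `V^(m-s) ⊗ R_s`: now the final `s` letters form a relation.
  have hy' := (Submodule.mem_iInf _).1 hy (Fin.last _)
  clear hy
  simp only [Fin.val_last, Nat.sub_self, word, pow_zero, mul_one] at hy'
  rw [LinearMap.zero_apply]
  induction hy' using Submodule.mul_induction_on' with
  | mem_mul_mem a ha b hb =>
    rw [peelRight_pow_tmul φ s 1 b (D.le_word s hs hb), h b hb, MulOpposite.unop_zero, mul_zero,
      TensorProduct.zero_tmul]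
  | add a _ b _ ha hb => rw [TensorProduct.tmul_add, map_add, ha, hb, add_zero]

variable {B' : Type w'} [Ring B'] [Algebra k B']

theorem degreeProj_rTensor (f : B →ₗ[k] B') (n : ℕ) (x : B ⊗[k] TensorAlgebra k V) :
    f.rTensor _ (degreeProj n x) = degreeProj n (f.rTensor _ x) := by
  induction x using TensorProduct.induction_on with
  | zero => simp
  | add x y hx hy => simp only [map_add, hx, hy]
  | tmul b x => simp [degreeProj]

/-- The map `f` is only `k`-linear. This covers insertions of a fixed element into a factor of
`A^e`, slices by a functional, degree projections and augmentations. -/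
theorem hat_rTensor (f : B →ₗ[k] B') {odd : Module.End B (B ⊗[k] TensorAlgebra k V)}
    {even : ℕ → Module.End B (B ⊗[k] TensorAlgebra k V)}
    {odd' : Module.End B' (B' ⊗[k] TensorAlgebra k V)}
    {even' : ℕ → Module.End B' (B' ⊗[k] TensorAlgebra k V)}
    (ho : ∀ x, f.rTensor _ (odd x) = odd' (f.rTensor _ x))
    (he : ∀ s ∈ D.S, ∀ x, f.rTensor _ (even s x) = even' s (f.rTensor _ x)) (i : ℕ)
    (x : B ⊗[k] TensorAlgebra k V) :
    f.rTensor _ (D.hat odd even i x) = D.hat odd' even' i (f.rTensor _ x) := by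
  unfold hat
  split_ifs with h1 h2
  · exact ho x
  · simp only [LinearMap.sum_apply, map_sum, Module.End.mul_apply, ho, degreeProj_rTensor]
  · simp only [LinearMap.sum_apply, map_sum, Module.End.mul_apply]
    exact Finset.sum_congr rfl fun s hs => by rw [he s hs, degreeProj_rTensor]

theorem rTensor_mem_K (f : B →ₗ[k] B') (i : ℕ) (x : B ⊗[k] TensorAlgebra k V)
    (hx : x ∈ D.K B i) : f.rTensor _ x ∈ D.K B' i := by
  refine baseChange_induction x hx (fun b y hy => ?_) (fun x y hx hy => ?_)
  · exact Submodule.tmul_mem_baseChange_of_mem _ hy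
  · rw [map_add]; exact Submodule.add_mem _ hx hy

end Relations

end Complexes

/-! ### Linear maps on the enveloping algebra, in terms of the elements `a ⊗ b` -/

section Enveloping

variable {k : Type u} [Field k] {A : Type w} [Ring A] [Algebra k A]

/-- The linear map out of `A^e` induced by a bilinear map. -/
def Env.lift {X : Type*} [AddCommGroup X] [Module k X] (f : A →ₗ[k] A →ₗ[k] X) :
    Env k A →ₗ[k] X :=
  (TensorProduct.lift (f.compl₂ (MulOpposite.opLinearEquiv k).symm.toLinearMap) :
    A ⊗[k] Aᵐᵒᵖ →ₗ[k] X)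

@[simp] theorem Env.lift_tmul {X : Type*} [AddCommGroup X] [Module k X]
    (f : A →ₗ[k] A →ₗ[k] X) (a b : A) : Env.lift f (Env.tmul a b) = f a b :=
  TensorProduct.lift.tmul _ _

theorem Env.add_tmul (a a' b : A) :
    (Env.tmul (a + a') b : Env k A) = Env.tmul a b + Env.tmul a' b := TensorProduct.add_tmul _ _ _

theorem Env.tmul_add (a b b' : A) :
    (Env.tmul a (b + b') : Env k A) = Env.tmul a b + Env.tmul a b' := TensorProduct.tmul_add _ _ _

theorem Env.one_def : (1 : Env k A) = Env.tmul 1 1 := rfl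

/-- The canonical bilinear map to `A^e`. -/
def Env.mk : A →ₗ[k] A →ₗ[k] Env k A :=
  LinearMap.mk₂ k Env.tmul Env.add_tmul (fun c a b => (Env.smul_tmul k A c a b).symm) Env.tmul_add
    (fun c a b => (Env.smul_tmul_right k A c a b).symm)

@[simp] theorem Env.mk_apply (a b : A) : (Env.mk a b : Env k A) = Env.tmul a b := rfl

/-- `f ⊗ g`. -/
def Env.map (f g : A →ₗ[k] A) : Env k A →ₗ[k] Env k A := Env.lift (Env.mk.compl₁₂ f g)

@[simp] theorem Env.map_tmul (f g : A →ₗ[k] A) (a b : A) :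
    Env.map f g (Env.tmul a b : Env k A) = Env.tmul (f a) (g b) := by
  rw [Env.map, Env.lift_tmul]; rfl

@[simp] theorem Env.tmul_zero (a : A) : (Env.tmul a 0 : Env k A) = 0 := TensorProduct.tmul_zero _ _

@[simp] theorem Env.zero_tmul (a : A) : (Env.tmul 0 a : Env k A) = 0 := TensorProduct.zero_tmul _ _

@[ext] theorem Env.hom_ext {X : Type*} [AddCommGroup X] [Module k X] {f g : Env k A →ₗ[k] X}
    (h : ∀ a b, f (Env.tmul a b) = g (Env.tmul a b)) : f = g := by
  ext x
  induction x using Env.induction with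
  | zero => simp
  | tmul a b => exact h a b
  | add x y hx hy => rw [map_add, map_add, hx, hy]

end Enveloping

/-! ### The grading of `A = T(V)/⟨R⟩` -/

section Algebra

variable {k : Type u} [Field k] {V : Type v} [AddCommGroup V] [Module k V]

namespace Relations

variable (D : Relations k V)

theorem proj_surjective : Function.Surjective D.proj := Ideal.Quotient.mkₐ_surjective k D.ideal

theorem proj_eq_zero {s : ℕ} (hs : s ∈ D.S) {r : TensorAlgebra k V} (hr : r ∈ D.R s) :
    D.proj r = 0 := by
  refine Ideal.Quotient.eq_zero_iff_mem.2 ?_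
  refine TwoSidedIdeal.mem_asIdeal.2 (TwoSidedIdeal.subset_span ?_)
  simp only [Set.mem_iUnion]
  exact ⟨s, hs, hr⟩

/-- An algebra map out of `T(V)` that kills the relations kills the ideal they generate. -/
theorem ideal_le_ker_of {B : Type*} [Ring B] [Algebra k B] (f : TensorAlgebra k V →ₐ[k] B)
    (h : ∀ s ∈ D.S, ∀ r ∈ D.R s, f r = 0) : ∀ x ∈ D.ideal, f x = 0 := by
  intro x hx
  have h : TwoSidedIdeal.span (⋃ s ∈ D.S, (D.R s : Set (TensorAlgebra k V))) ≤
      TwoSidedIdeal.ker f := by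
    rw [TwoSidedIdeal.span_le]
    intro y hy
    simp only [Set.mem_iUnion] at hy
    obtain ⟨s, hs, hy⟩ := hy
    exact (TwoSidedIdeal.mem_ker _).2 (h s hs y hy)
  exact (TwoSidedIdeal.mem_ker _).1 (h (TwoSidedIdeal.mem_asIdeal.1 hx))

theorem lift_gen (x : TensorAlgebra k V) : TensorAlgebra.lift k D.gen x = D.proj x := by
  have : TensorAlgebra.lift k D.gen = D.proj := by ext v; simp [gen]
  rw [this]

/-- `v₁ ⋯ vₙ ↦ v₁ ⋯ vₙ Xⁿ` on `T(V)`. -/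
def degreeHom : TensorAlgebra k V →ₐ[k] Polynomial D.Alg :=
  TensorAlgebra.lift k (((Polynomial.monomial 1 : D.Alg →ₗ[D.Alg] _).restrictScalars k) ∘ₗ D.gen)

theorem degreeHom_word {n : ℕ} (x : TensorAlgebra k V) (hx : x ∈ word k V n) :
    D.degreeHom x = Polynomial.monomial n (D.proj x) := by
  induction n generalizing x with
  | zero =>
    obtain ⟨c, rfl⟩ := word_zero_eq x hx
    rw [AlgHom.commutes, AlgHom.commutes, Polynomial.algebraMap_apply]
    rfl
  | succ n ih =>
    refine word_succ_induction_left x hx (fun v y hy => ?_) (fun x y hx hy => ?_)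
    · rw [map_mul, ih y hy, degreeHom, TensorAlgebra.lift_ι_apply, map_mul, add_comm]
      exact Polynomial.monomial_mul_monomial _ _ _ _
    · simp only [map_add, hx, hy]

/-- The projection of `A` onto `A_n`. -/
def componentProj (n : ℕ) : Module.End k D.Alg :=
  ((Polynomial.lcoeff D.Alg n).restrictScalars k) ∘ₗ
    -- Relations are homogeneous, so `degreeHom` sends them to monomials with coefficient zero in
    -- `A` and descends to a map `A → A[X]`; its `n`-th coefficient is the projection sought.
    (Ideal.Quotient.liftₐ D.ideal D.degreeHom (D.ideal_le_ker_of _ fun s hs r hr => by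
      rw [degreeHom_word D r (D.le_word s hs hr), D.proj_eq_zero hs hr, map_zero])).toLinearMap

theorem componentProj_proj (n : ℕ) (x : TensorAlgebra k V) :
    D.componentProj n (D.proj x) = (D.degreeHom x).coeff n := rfl

theorem component_grading : Grading D.component D.componentProj where
  same n a ha := by
    obtain ⟨x, hx, rfl⟩ := ha
    refine (D.componentProj_proj n x).trans ?_
    rw [degreeHom_word D x hx, Polynomial.coeff_monomial, if_pos rfl]
    rfl
  ne m n hmn a ha := by
    obtain ⟨x, hx, rfl⟩ := ha
    refine (D.componentProj_proj n x).trans ?_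
    rw [degreeHom_word D x hx, Polynomial.coeff_monomial, if_neg hmn]
  top := by
    have : D.component = fun n => (word k V n).map D.proj.toLinearMap := rfl
    rw [this, ← Submodule.map_iSup, iSup_word, Submodule.map_top, LinearMap.range_eq_top]
    exact D.proj_surjective

theorem aug_proj (x : TensorAlgebra k V) :
    D.aug (D.proj x) = TensorAlgebra.algebraMapInv x := rfl

theorem aug_gen (v : V) : D.aug (D.gen v) = 0 := by
  refine (D.aug_proj _).trans ?_
  simp [TensorAlgebra.algebraMapInv]

theorem aug_component {n : ℕ} (hn : n ≠ 0) (a : D.Alg) (ha : a ∈ D.component n) : D.aug a = 0 := by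
  obtain ⟨x, hx, rfl⟩ := ha
  exact (D.aug_proj x).trans (algebraMapInv_word hn hx)

theorem component_zero_eq (a : D.Alg) (ha : a ∈ D.component 0) : ∃ c : k, a = algebraMap k _ c := by
  obtain ⟨x, hx, rfl⟩ := ha
  obtain ⟨c, rfl⟩ := word_zero_eq x hx
  exact ⟨c, D.proj.commutes c⟩

theorem one_mem_component : (1 : D.Alg) ∈ D.component 0 :=
  ⟨1, by rw [word, pow_zero]; exact Submodule.one_le.1 le_rfl, map_one D.proj⟩

theorem gen_mem_component (v : V) : D.gen v ∈ D.component 1 :=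
  ⟨TensorAlgebra.ι k v, by rw [word, pow_one]; exact LinearMap.mem_range_self _ v, rfl⟩

theorem mul_mem_component {m n : ℕ} {a b : D.Alg} (ha : a ∈ D.component m)
    (hb : b ∈ D.component n) : a * b ∈ D.component (m + n) := by
  obtain ⟨x, hx, rfl⟩ := ha
  obtain ⟨y, hy, rfl⟩ := hb
  exact ⟨x * y, by rw [word, pow_add]; exact Submodule.mul_mem_mul hx hy, map_mul D.proj x y⟩

/-- Degree zero of `A` consists of the scalars, which the augmentation recovers. -/
theorem componentProj_zero (a : D.Alg) : D.componentProj 0 a = algebraMap k _ (D.aug a) := by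
  refine D.component_grading.induction a (fun n b hb => ?_) (fun b c hb hc => ?_)
  · by_cases hn : n = 0
    · subst hn
      obtain ⟨c, rfl⟩ := D.component_zero_eq b hb
      rw [D.component_grading.same _ _ hb, AlgHom.commutes]
      rfl
    · rw [D.component_grading.ne _ _ hn _ hb, D.aug_component hn b hb, map_zero]
  · simp only [map_add, hb, hc]

theorem componentProj_mul_gen (n : ℕ) (a : D.Alg) (v : V) :
    D.componentProj (n + 1) (a * D.gen v) = D.componentProj n a * D.gen v := by
  refine D.component_grading.induction a (fun m b hb => ?_) (fun b c hb hc => ?_)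
  · have := D.mul_mem_component hb (D.gen_mem_component v)
    by_cases hn : m = n
    · subst hn
      rw [D.component_grading.same _ _ hb, D.component_grading.same _ _ this]
    · rw [D.component_grading.ne _ _ hn _ hb, D.component_grading.ne _ _ (by omega) _ this, zero_mul]
  · simp only [map_add, add_mul, hb, hc]

theorem componentProj_gen_mul (n : ℕ) (a : D.Alg) (v : V) :
    D.componentProj (n + 1) (D.gen v * a) = D.gen v * D.componentProj n a := by
  refine D.component_grading.induction a (fun m b hb => ?_) (fun b c hb hc => ?_)
  · have := D.mul_mem_component (D.gen_mem_component v) hb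
    by_cases hn : m = n
    · subst hn
      rw [D.component_grading.same _ _ hb, D.component_grading.same _ _ (by rwa [add_comm] at this)]
    · rw [D.component_grading.ne _ _ hn _ hb, D.component_grading.ne _ _ (by omega) _ this, mul_zero]
  · simp only [map_add, mul_add, hb, hc]

theorem componentProj_zero_mul_gen (a : D.Alg) (v : V) :
    D.componentProj 0 (a * D.gen v) = 0 := by
  rw [componentProj_zero, map_mul, aug_gen, mul_zero, map_zero]

theorem componentProj_zero_gen_mul (a : D.Alg) (v : V) :
    D.componentProj 0 (D.gen v * a) = 0 := by
  rw [componentProj_zero, map_mul, aug_gen, zero_mul, map_zero]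

/-! ### The grading of `A^e ⊗ T(V)` -/

theorem exists_env_grading : ∃ p, Grading D.envGrading p := by
  -- The grading is transported to `Aᵐᵒᵖ`, after which that of `A^e` is a tensor product grading.
  have hop : Grading (fun n => (D.component n).map (MulOpposite.opLinearEquiv k).toLinearMap)
      (fun n => (MulOpposite.opLinearEquiv k).toLinearMap ∘ₗ D.componentProj n ∘ₗ
        (MulOpposite.opLinearEquiv k).symm.toLinearMap) := by
    refine ⟨?_, ?_, ?_⟩
    · rintro n _ ⟨a, ha, rfl⟩
      simp [D.component_grading.same _ _ ha]
    · rintro m n hmn _ ⟨a, ha, rfl⟩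
      simp [D.component_grading.ne _ _ hmn _ ha]
    · rw [← Submodule.map_iSup, D.component_grading.top, Submodule.map_top, LinearMap.range_eq_top]
      exact (MulOpposite.opLinearEquiv k).surjective
  have h := D.component_grading.tensor hop
  have heq : D.envGrading = (tensorGrading D.component
      (fun n => (D.component n).map (MulOpposite.opLinearEquiv k).toLinearMap) :
      ℕ → Submodule k (D.Alg ⊗[k] D.Algᵐᵒᵖ)) := by
    funext n
    refine congrArg (Submodule.span k) (Set.ext fun x => ?_)
    constructor
    · rintro ⟨p, q, hpq, a, ha, b, hb, rfl⟩
      exact ⟨p, q, hpq, a, ha, MulOpposite.op b, ⟨b, hb, rfl⟩, rfl⟩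
    · rintro ⟨p, q, hpq, a, ha, _, ⟨b, hb, rfl⟩, rfl⟩
      exact ⟨p, q, hpq, a, ha, b, hb, rfl⟩
  rw [heq]
  exact ⟨_, h⟩

/-- The projection of `A^e` onto its component of degree `n`. -/
def envProj : ℕ → Module.End k (Env k D.Alg) := D.exists_env_grading.choose

theorem env_grading : Grading D.envGrading D.envProj := D.exists_env_grading.choose_spec

/-- The total grading of `A^e ⊗ T(V)`. -/
def totalGrading : ℕ → Submodule k (Env k D.Alg ⊗[k] TensorAlgebra k V) :=
  tensorGrading D.envGrading (word k V)

def totalProj : ℕ → Module.End k (Env k D.Alg ⊗[k] TensorAlgebra k V) :=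
  tensorProj D.envProj fun n => GradedAlgebra.proj (word k V) n

theorem total_grading : Grading D.totalGrading D.totalProj := D.env_grading.tensor word_grading

theorem tmul_mem_envGrading {p q n : ℕ} {a b : D.Alg} (ha : a ∈ D.component p)
    (hb : b ∈ D.component q) (h : p + q = n) : Env.tmul a b ∈ D.envGrading n :=
  Submodule.subset_span ⟨p, q, h, a, ha, b, hb, rfl⟩

theorem tmul_mem_totalGrading {p q n : ℕ} {e : Env k D.Alg} {x : TensorAlgebra k V}
    (he : e ∈ D.envGrading p) (hx : x ∈ word k V q) (h : p + q = n) :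
    e ⊗ₜ x ∈ D.totalGrading n :=
  Submodule.subset_span ⟨p, q, h, e, he, x, hx, rfl⟩

theorem envGrading_mul {m n : ℕ} {x y : Env k D.Alg} (hx : x ∈ D.envGrading m)
    (hy : y ∈ D.envGrading n) : x * y ∈ D.envGrading (m + n) := by
  induction hx using Submodule.span_induction with
  | mem x hx =>
    obtain ⟨p, q, hpq, a, ha, b, hb, rfl⟩ := hx
    induction hy using Submodule.span_induction with
    | mem y hy =>
      obtain ⟨p', q', hpq', a', ha', b', hb', rfl⟩ := hy
      rw [Env.tmul_mul_tmul]
      exact D.tmul_mem_envGrading (D.mul_mem_component ha ha') (D.mul_mem_component hb' hb)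
        (by omega)
    | zero => rw [mul_zero]; exact Submodule.zero_mem _
    | add x y _ _ hx hy => rw [mul_add]; exact Submodule.add_mem _ hx hy
    | smul c x _ hx => rw [mul_smul_comm]; exact Submodule.smul_mem _ c hx
  | zero => rw [zero_mul]; exact Submodule.zero_mem _
  | add x y _ _ hx hy => rw [add_mul]; exact Submodule.add_mem _ hx hy
  | smul c x _ hx => rw [smul_mul_assoc]; exact Submodule.smul_mem _ c hx

theorem smul_mem_totalGrading {m n : ℕ} {e : Env k D.Alg} (he : e ∈ D.envGrading m)
    {x : Env k D.Alg ⊗[k] TensorAlgebra k V} (hx : x ∈ D.totalGrading n) :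
    e • x ∈ D.totalGrading (m + n) := by
  induction hx using Submodule.span_induction with
  | mem x hx =>
    obtain ⟨p, q, hpq, a, ha, b, hb, rfl⟩ := hx
    rw [TensorProduct.smul_tmul']
    exact D.tmul_mem_totalGrading (D.envGrading_mul he ha) hb (by omega)
  | zero => rw [smul_zero]; exact Submodule.zero_mem _
  | add x y _ _ hx hy => rw [smul_add]; exact Submodule.add_mem _ hx hy
  | smul c x _ hx => rw [smul_comm]; exact Submodule.smul_mem _ c hx

end Relations

end Algebra

/-! ## Exactness of filtered complexes -/

section Filtered

/-- Projections `P n` onto the components of total degree `n`, and `ρ q` onto those of partial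
degree `q ≤ n`. -/
structure IsBigraded {C : Type*} [AddCommGroup C] (ρ P : ℕ → C →+ C) : Prop where
  same : ∀ q x, ρ q (ρ q x) = ρ q x
  ne : ∀ q r x, q ≠ r → ρ r (ρ q x) = 0
  comm : ∀ n q x, P n (ρ q x) = ρ q (P n x)
  proj : ∀ n x, P n (P n x) = P n x
  bound : ∀ n x, P n x = x → (∀ q ≤ n, ρ q x = 0) → x = 0
  sum : ∀ x, ∃ N, x = ∑ n ∈ Finset.range N, P n x

/-- `D` is the part of `d` preserving the partial degree; the rest of `d` raises it. -/
structure IsLeadingPart {C C' : Type*} [AddCommGroup C] [AddCommGroup C'] (ρ P : ℕ → C →+ C)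
    (ρ' P' : ℕ → C' →+ C') (d D : C →+ C') : Prop where
  homogeneous : ∀ n x, P' n (d x) = d (P n x)
  -- Let `F^q` be the elements whose components of partial degree below `q` vanish. On `F^q` the
  -- component of degree `q` of `d x` depends only on that of `x`, through `D`.
  lead : ∀ q x, (∀ r < q, ρ r x = 0) → ρ' q (d x) = D (ρ q x)
  diag : ∀ q x, ρ' q (D x) = D (ρ q x)

variable {C₀ C₁ C₂ : Type*} [AddCommGroup C₀] [AddCommGroup C₁] [AddCommGroup C₂]
  {ρ₀ P₀ : ℕ → C₀ →+ C₀} {ρ₁ P₁ : ℕ → C₁ →+ C₁} {ρ₂ P₂ : ℕ → C₂ →+ C₂}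
  {d₂ D₂ : C₂ →+ C₁} {d₁ D₁ : C₁ →+ C₀}

/-- Successive approximation in a fixed total degree `n`: the leading term of a cycle in `F^q` is
lifted through `D₂`, and the remaining error lies in `F^(q+1)`. The number `m` bounds the remaining
steps, because `F^(n+1)` is zero in total degree `n`. -/
theorem filtered_exact_homogeneous (h₁ : IsBigraded ρ₁ P₁) (h₂ : IsBigraded ρ₂ P₂)
    (hd₁ : IsLeadingPart ρ₁ P₁ ρ₀ P₀ d₁ D₁) (hd₂ : IsLeadingPart ρ₂ P₂ ρ₁ P₁ d₂ D₂)
    (hdd : ∀ x, d₁ (d₂ x) = 0) (hD : ∀ x, D₁ x = 0 → ∃ y, D₂ y = x) (m : ℕ) :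
    ∀ n q x, n < q + m → P₁ n x = x → (∀ r < q, ρ₁ r x = 0) → d₁ x = 0 →
      ∃ y, (∀ r < q, ρ₂ r y = 0) ∧ d₂ y = x := by
  induction m with
  | zero =>
    intro n q x hnq hx hF _
    refine ⟨0, by simp, ?_⟩
    rw [map_zero, h₁.bound n x hx fun r hr => hF r (by omega)]
  | succ m ih =>
    intro n q x hnq hx hF hdx
    obtain ⟨y', hy'⟩ := hD (ρ₁ q x) (by rw [← hd₁.lead q x hF, hdx, map_zero])
    -- The lift is replaced by its component of partial degree `q` and total degree `n`. Then the
    -- error keeps total degree `n`, and the correction stays in `F^q`.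
    have hy : ∀ r < q, ρ₂ r (P₂ n (ρ₂ q y')) = 0 := fun r hr => by
      rw [← h₂.comm, h₂.ne _ _ _ (by omega : q ≠ r), map_zero]
    obtain ⟨z, hz, hdz⟩ := ih n (q + 1) (x - d₂ (P₂ n (ρ₂ q y'))) (by omega)
      (by rw [map_sub, hx, hd₂.homogeneous, h₂.proj]) (fun r hr => by
        rw [map_sub]
        rcases Nat.lt_succ_iff_lt_or_eq.1 hr with hr | rfl
        -- Below degree `q` neither term contributes. In degree `q` itself the two leading terms
        -- agree by the choice of `y'`.
        · rw [hF r hr, hd₂.lead r _ fun l hl => hy l (hl.trans hr), hy r hr, map_zero, sub_zero]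
        · rw [← hd₂.homogeneous, ← h₁.comm, hd₂.lead r _ fun l hl => h₂.ne _ _ _ hl.ne', h₂.same,
            ← hd₂.diag, hy', h₁.same, h₁.comm, hx, sub_self])
      (by rw [map_sub, hdx, hdd, sub_zero])
    refine ⟨P₂ n (ρ₂ q y') + z, fun r hr => ?_, ?_⟩
    · rw [map_add, hy r hr, hz r (by omega), add_zero]
    · rw [map_add, hdz, add_sub_cancel]

/-- If the leading parts form an exact sequence, then so do the differentials, compatibly with
the filtrations by the partial degree. -/
theorem filtered_exact (h₁ : IsBigraded ρ₁ P₁) (h₂ : IsBigraded ρ₂ P₂)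
    (hd₁ : IsLeadingPart ρ₁ P₁ ρ₀ P₀ d₁ D₁) (hd₂ : IsLeadingPart ρ₂ P₂ ρ₁ P₁ d₂ D₂)
    (hdd : ∀ x, d₁ (d₂ x) = 0) (hD : ∀ x, D₁ x = 0 → ∃ y, D₂ y = x) (q : ℕ) (x : C₁)
    (hF : ∀ r < q, ρ₁ r x = 0) (hx : d₁ x = 0) : ∃ y, (∀ r < q, ρ₂ r y = 0) ∧ d₂ y = x := by
  have key : ∀ n, ∃ y, (∀ r < q, ρ₂ r y = 0) ∧ d₂ y = P₁ n x := fun n =>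
    filtered_exact_homogeneous h₁ h₂ hd₁ hd₂ hdd hD (n + 1) n q (P₁ n x) (by omega) (h₁.proj n x)
      (fun r hr => by rw [← h₁.comm, hF r hr, map_zero]) (by rw [← hd₁.homogeneous, hx, map_zero])
  choose y hy hdy using key
  obtain ⟨N, hN⟩ := h₁.sum x
  refine ⟨∑ n ∈ Finset.range N, y n, fun r hr => ?_, ?_⟩
  · rw [map_sum]; exact Finset.sum_eq_zero fun n _ => hy n r hr
  · rw [map_sum, Finset.sum_congr rfl fun n _ => hdy n, ← hN]

/-- An element `z` of partial degree zero with `D₁ z = 0` need not satisfy `d₁ z = 0`, but `d₁ z`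
has no component of degree zero. The hypothesis `h₀` writes it as `d₁ y` with `y ∈ F^1`; then `z - y
= d₂ u`, and the component of degree zero of this equation is `z = D₂ (ρ₂ 0 u)`. -/
theorem leading_exact (hd₁ : IsLeadingPart ρ₁ P₁ ρ₀ P₀ d₁ D₁)
    (hd₂ : IsLeadingPart ρ₂ P₂ ρ₁ P₁ d₂ D₂)
    (h₀ : ∀ x, ρ₀ 0 (d₁ x) = 0 → ∃ y, ρ₁ 0 y = 0 ∧ d₁ y = d₁ x)
    (hd : ∀ x, d₁ x = 0 → ∃ y, d₂ y = x) (z : C₁) (hz : ρ₁ 0 z = z) (hDz : D₁ z = 0) :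
    ∃ y, D₂ y = z := by
  obtain ⟨y, hy, hdy⟩ := h₀ z (by rw [hd₁.lead 0 z (by simp), hz, hDz])
  obtain ⟨u, hu⟩ := hd (z - y) (by rw [map_sub, hdy, sub_self])
  refine ⟨ρ₂ 0 u, ?_⟩
  rw [← hd₂.lead 0 u (by simp), hu, map_sub, hz, hy, sub_zero]

end Filtered

/-! ### Total and partial degrees of operators on `A^e ⊗ T(V)` -/

section Operators

variable {k : Type u} [Field k] {V : Type v} [AddCommGroup V] [Module k V]

namespace Relations

variable {D : Relations k V}

/-- Endomorphisms of `A^e ⊗ T(V)` preserving the total degree. -/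
def Homogeneous (f : Module.End (Env k D.Alg) (Env k D.Alg ⊗[k] TensorAlgebra k V)) : Prop :=
  ∀ n, ∀ x ∈ D.totalGrading n, f x ∈ D.totalGrading n

namespace Homogeneous

variable {f g : Module.End (Env k D.Alg) (Env k D.Alg ⊗[k] TensorAlgebra k V)}

theorem one : Homogeneous (D := D) 1 := fun _ _ hx => hx

theorem mul (hf : Homogeneous f) (hg : Homogeneous g) : Homogeneous (f * g) :=
  fun n x hx => hf n _ (hg n x hx)

theorem pow (hf : Homogeneous f) (n : ℕ) : Homogeneous (f ^ n) := by
  induction n with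
  | zero => exact one
  | succ n ih => rw [pow_succ]; exact ih.mul hf

theorem sub (hf : Homogeneous f) (hg : Homogeneous g) : Homogeneous (f - g) :=
  fun n x hx => Submodule.sub_mem _ (hf n x hx) (hg n x hx)

theorem sum {ι : Type*} (t : Finset ι)
    {f : ι → Module.End (Env k D.Alg) (Env k D.Alg ⊗[k] TensorAlgebra k V)}
    (hf : ∀ i ∈ t, Homogeneous (f i)) : Homogeneous (∑ i ∈ t, f i) := fun n x hx => by
  rw [LinearMap.sum_apply]
  exact Submodule.sum_mem _ fun i hi => hf i hi n x hx

theorem of_tmul (h : ∀ p q, ∀ e ∈ D.envGrading p, ∀ w ∈ word k V q,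
    f (e ⊗ₜ w) ∈ D.totalGrading (p + q)) : Homogeneous f := by
  intro n x hx
  induction hx using Submodule.span_induction with
  | mem x hx =>
    obtain ⟨p, q, rfl, e, he, w, hw, rfl⟩ := hx
    exact h p q e he w hw
  | zero => rw [map_zero]; exact Submodule.zero_mem _
  | add x y _ _ hx hy => rw [map_add]; exact Submodule.add_mem _ hx hy
  | smul c x _ hx => rw [LinearMap.map_smul_of_tower]; exact Submodule.smul_mem _ c hx

theorem degreeProj (n : ℕ) : Homogeneous (D := D) (degreeProj n) := by
  refine of_tmul fun p q e he w hw => ?_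
  rw [degreeProj_apply (m := q) (Submodule.tmul_mem_baseChange_of_mem _ hw)]
  split_ifs
  · exact D.tmul_mem_totalGrading he hw rfl
  · exact Submodule.zero_mem _

theorem peelLeft (φ : V →ₗ[k] Env k D.Alg) (hφ : ∀ v, φ v ∈ D.envGrading 1) :
    Homogeneous (peelLeft φ) := by
  refine of_tmul fun p q e he w hw => ?_
  rcases q with _ | q
  · obtain ⟨c, rfl⟩ := word_zero_eq w hw
    rw [peelLeft_algebraMap]; exact Submodule.zero_mem _
  · refine word_succ_induction_left w hw (fun v y hy => ?_) (fun x y hx hy => ?_)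
    · rw [peelLeft_tmul]
      exact D.tmul_mem_totalGrading (D.envGrading_mul he (hφ v)) hy (by omega)
    · rw [TensorProduct.tmul_add, map_add]; exact Submodule.add_mem _ hx hy

theorem peelRight (φ : V →ₗ[k] Env k D.Alg) (hφ : ∀ v, φ v ∈ D.envGrading 1) :
    Homogeneous (peelRight φ) := by
  refine of_tmul fun p q e he w hw => ?_
  rcases q with _ | q
  · obtain ⟨c, rfl⟩ := word_zero_eq w hw
    rw [peelRight_algebraMap]; exact Submodule.zero_mem _
  · refine word_succ_induction_right w hw (fun v y hy => ?_) (fun x y hx hy => ?_)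
    · rw [peelRight_tmul]
      exact D.tmul_mem_totalGrading (D.envGrading_mul he (hφ v)) hy (by omega)
    · rw [TensorProduct.tmul_add, map_add]; exact Submodule.add_mem _ hx hy

theorem hat {odd : Module.End (Env k D.Alg) (Env k D.Alg ⊗[k] TensorAlgebra k V)}
    {even : ℕ → Module.End (Env k D.Alg) (Env k D.Alg ⊗[k] TensorAlgebra k V)}
    (ho : Homogeneous odd) (he : ∀ s, Homogeneous (even s)) (i : ℕ) :
    Homogeneous (D.hat odd even i) := by
  unfold Relations.hat
  split_ifs
  · exact ho
  · exact sum _ fun s _ => ho.mul (degreeProj _)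
  · exact sum _ fun s _ => (he s).mul (degreeProj _)

theorem totalProj (hf : Homogeneous f) (n : ℕ) (x : Env k D.Alg ⊗[k] TensorAlgebra k V) :
    D.totalProj n (f x) = f (D.totalProj n x) :=
  D.total_grading.proj_comm D.total_grading (f.restrictScalars k) hf n x

end Homogeneous

theorem totalProj_mem_K (i n : ℕ) (x : Env k D.Alg ⊗[k] TensorAlgebra k V)
    (hx : x ∈ D.K (Env k D.Alg) i) : D.totalProj n x ∈ D.K (Env k D.Alg) i := by
  refine baseChange_induction x hx (fun e w hw => ?_) (fun x y hx hy => ?_)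
  · refine J_homogeneous_induction w hw ?_ (fun m w hw hwJ => ?_) (fun x y hx hy => ?_)
    · simp
    · refine D.env_grading.induction e (fun p e he => ?_) (fun x y hx hy => ?_)
      · have h := D.tmul_mem_totalGrading he hw rfl
        by_cases hn : p + m = n
        · subst hn
          rw [D.total_grading.same _ _ h]
          exact Submodule.tmul_mem_baseChange_of_mem _ hwJ
        · rw [D.total_grading.ne _ _ hn _ h]; exact Submodule.zero_mem _
      · rw [TensorProduct.add_tmul, map_add]; exact Submodule.add_mem _ hx hy
    · rw [TensorProduct.tmul_add, map_add]; exact Submodule.add_mem _ hx hy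
  · rw [map_add]; exact Submodule.add_mem _ hx hy

variable (D) in
/-- A family of operators projecting the elements of `A^e` onto the components of a partial
degree: of the right or of the left factor. -/
structure IsPartialProj (σ : ℕ → Env k D.Alg →ₗ[k] Env k D.Alg) : Prop where
  same : ∀ q x, σ q (σ q x) = σ q x
  ne : ∀ q r x, q ≠ r → σ r (σ q x) = 0
  mem : ∀ n q, ∀ x ∈ D.envGrading n, σ q x ∈ D.envGrading n
  -- The partial degree is at most the total degree; this makes the filtration finite in each total
  -- degree.
  sum : ∀ n, ∀ x ∈ D.envGrading n, ∀ m, n ≤ m → x = ∑ q ∈ Finset.range (m + 1), σ q x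

namespace IsPartialProj

variable {σ : ℕ → Env k D.Alg →ₗ[k] Env k D.Alg}

theorem totalGrading_mem (h : D.IsPartialProj σ) (q n : ℕ)
    (x : Env k D.Alg ⊗[k] TensorAlgebra k V) (hx : x ∈ D.totalGrading n) :
    (σ q).rTensor _ x ∈ D.totalGrading n := by
  induction hx using Submodule.span_induction with
  | mem x hx =>
    obtain ⟨p, l, hpl, e, he, w, hw, rfl⟩ := hx
    rw [LinearMap.rTensor_tmul]
    exact D.tmul_mem_totalGrading (h.mem _ _ _ he) hw hpl
  | zero => rw [map_zero]; exact Submodule.zero_mem _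
  | add x y _ _ hx hy => rw [map_add]; exact Submodule.add_mem _ hx hy
  | smul c x _ hx => rw [map_smul]; exact Submodule.smul_mem _ c hx

theorem total_sum (h : D.IsPartialProj σ) (n : ℕ)
    (x : Env k D.Alg ⊗[k] TensorAlgebra k V) (hx : x ∈ D.totalGrading n) :
    x = ∑ q ∈ Finset.range (n + 1), (σ q).rTensor _ x := by
  induction hx using Submodule.span_induction with
  | mem x hx =>
    obtain ⟨p, l, hpl, e, he, w, hw, rfl⟩ := hx
    simp only [LinearMap.rTensor_tmul]
    rw [← TensorProduct.sum_tmul, ← h.sum p e he n (by omega)]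
  | zero => simp
  | add x y _ _ hx hy =>
    simp only [map_add, Finset.sum_add_distrib]
    rw [← hx, ← hy]
  | smul c x _ hx =>
    simp only [map_smul, ← Finset.smul_sum]
    rw [← hx]

/-- The restriction of `σ q ⊗ 1` to `A^e ⊗ J_i`. -/
def restrictK (σ : ℕ → Env k D.Alg →ₗ[k] Env k D.Alg) (i q : ℕ) :
    D.K (Env k D.Alg) i →+ D.K (Env k D.Alg) i :=
  (((σ q).rTensor (TensorAlgebra k V)).restrict (p := (D.K (Env k D.Alg) i).restrictScalars k)
    (q := (D.K (Env k D.Alg) i).restrictScalars k)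
    (fun x hx => rTensor_mem_K (σ q) i x hx)).toAddMonoidHom

variable (D) in
def totalK (i n : ℕ) : D.K (Env k D.Alg) i →+ D.K (Env k D.Alg) i :=
  ((D.totalProj n).restrict (p := (D.K (Env k D.Alg) i).restrictScalars k)
    (q := (D.K (Env k D.Alg) i).restrictScalars k)
    (fun x hx => totalProj_mem_K i n x hx)).toAddMonoidHom

@[simp] theorem coe_restrictK (i q : ℕ) (x : D.K (Env k D.Alg) i) :
    (restrictK σ i q x : Env k D.Alg ⊗[k] TensorAlgebra k V) = (σ q).rTensor _ x.1 := rfl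

theorem isBigraded (h : D.IsPartialProj σ) (i : ℕ) :
    IsBigraded (restrictK σ i) (totalK D i) where
  same q x := Subtype.ext <| by
    rw [coe_restrictK, coe_restrictK, ← LinearMap.rTensor_comp_apply]
    congr 2; ext x; simp [h.same]
  ne q r x hqr := Subtype.ext <| by
    rw [coe_restrictK, coe_restrictK, ← LinearMap.rTensor_comp_apply,
      show σ r ∘ₗ σ q = 0 from LinearMap.ext fun x => h.ne _ _ _ hqr]
    simp
  comm n q x := Subtype.ext <|
    D.total_grading.proj_comm D.total_grading _ (h.totalGrading_mem q) n x.1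
  proj n x := Subtype.ext <| D.total_grading.proj_proj n x.1
  bound n x hx hq := Subtype.ext <| by
    rw [h.total_sum n x.1 (D.total_grading.mem_iff.2 (congrArg Subtype.val hx))]
    refine Finset.sum_eq_zero fun q hq' => ?_
    exact congrArg Subtype.val (hq q (by simpa [Nat.lt_succ_iff] using hq'))
  sum x := by
    obtain ⟨N, hN⟩ := D.total_grading.exists_sum x.1
    refine ⟨N, Subtype.ext ?_⟩
    rw [AddSubmonoidClass.coe_finsetSum]
    exact hN N le_rfl

end IsPartialProj

/-- `g` is the part of `f` preserving the partial degree given by `σ`. -/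
def Leads (σ : ℕ → Env k D.Alg →ₗ[k] Env k D.Alg)
    (f g : Module.End (Env k D.Alg) (Env k D.Alg ⊗[k] TensorAlgebra k V)) : Prop :=
  ∀ q x, (∀ r < q, (σ r).rTensor _ x = 0) → (σ q).rTensor _ (f x) = g ((σ q).rTensor _ x)

namespace Leads

variable {σ : ℕ → Env k D.Alg →ₗ[k] Env k D.Alg}
  {f g f' g' : Module.End (Env k D.Alg) (Env k D.Alg ⊗[k] TensorAlgebra k V)}

theorem one : Leads σ (1 : Module.End (Env k D.Alg) (Env k D.Alg ⊗[k] TensorAlgebra k V)) 1 :=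
  fun _ _ _ => rfl

/-- Applying `h` to `f' x` requires that `f'` does not lower the filtration, which is itself a
consequence of `h'`. -/
theorem mul (h : Leads σ f g) (h' : Leads σ f' g') : Leads σ (f * f') (g * g') := by
  intro q x hx
  rw [Module.End.mul_apply, Module.End.mul_apply, h q, h' q x hx]
  intro r hr
  rw [h' r x fun l hl => hx l (hl.trans hr), hx r hr, map_zero]

theorem pow (h : Leads σ f g) (n : ℕ) : Leads σ (f ^ n) (g ^ n) := by
  induction n with
  | zero => exact one
  | succ n ih => rw [pow_succ, pow_succ]; exact ih.mul h

theorem sub (h : Leads σ f g) (h' : Leads σ f' g') : Leads σ (f - f') (g - g') := fun q x hx => by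
  rw [LinearMap.sub_apply, LinearMap.sub_apply, map_sub, h q x hx, h' q x hx]

theorem smul (h : Leads σ f g) (c : ℤ) : Leads σ (c • f) (c • g) := fun q x hx => by
  rw [LinearMap.smul_apply, LinearMap.smul_apply, map_zsmul, h q x hx]

theorem sum {ι : Type*} (t : Finset ι)
    {f g : ι → Module.End (Env k D.Alg) (Env k D.Alg ⊗[k] TensorAlgebra k V)}
    (h : ∀ i ∈ t, Leads σ (f i) (g i)) : Leads σ (∑ i ∈ t, f i) (∑ i ∈ t, g i) := fun q x hx => by
  rw [LinearMap.sum_apply, LinearMap.sum_apply, map_sum]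
  exact Finset.sum_congr rfl fun i hi => h i hi q x hx

theorem of_comm (h : ∀ q x, (σ q).rTensor _ (f x) = f ((σ q).rTensor _ x)) : Leads σ f f :=
  fun q x _ => h q x

/-- An operator that raises the partial degree by one has no part preserving it. -/
theorem of_raise (h : ∀ q x, (σ (q + 1)).rTensor _ (f x) = f ((σ q).rTensor _ x))
    (h0 : ∀ x, (σ 0).rTensor _ (f x) = 0) : Leads σ f 0 := by
  intro q x hx
  rcases q with _ | q
  · exact h0 x
  · rw [h, hx q (by omega), map_zero]; rfl

theorem hat {odd odd' : Module.End (Env k D.Alg) (Env k D.Alg ⊗[k] TensorAlgebra k V)}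
    {even even' : ℕ → Module.End (Env k D.Alg) (Env k D.Alg ⊗[k] TensorAlgebra k V)}
    (ho : Leads σ odd odd') (he : ∀ s ∈ D.S, Leads σ (even s) (even' s)) (i : ℕ) :
    Leads σ (D.hat odd even i) (D.hat odd' even' i) := by
  have hp : ∀ n, Leads (D := D) σ (degreeProj n) (degreeProj n) :=
    fun n => of_comm fun q x => degreeProj_rTensor _ _ _
  unfold Relations.hat
  split_ifs
  · exact ho
  · exact sum _ fun s _ => ho.mul (hp _)
  · exact sum _ fun s hs => (he s hs).mul (hp _)

end Leads

end Relations

end Operators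

/-! ### What is common to the left and the right comparison -/

namespace Relations

variable {k : Type u} [Field k] {V : Type v} [AddCommGroup V] [Module k V]

/-- `A^e` as the tensor product of an algebra `B` (which is `A` or `Aᵐᵒᵖ`) and the other factor,
together with the operators `μ` on `B ⊗ T(V)` and `α` on `A^e ⊗ T(V)` that remove a letter and
multiply it to `B`, and the operator `β` on `A^e ⊗ T(V)` that multiplies it to the other factor. -/
structure Side (D : Relations k V) (B : Type w) [Ring B] [Algebra k B] where
  -- The first argument of `ins` lies in the other factor, whose degree is the partial degree; `sl
  -- l` contracts that factor with the functional `l`.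
  ins : D.Alg →ₗ[k] B →ₗ[k] Env k D.Alg
  sl : (D.Alg →ₗ[k] k) → Env k D.Alg →ₗ[k] B
  sl_ins : ∀ l a b, sl l (ins a b) = l a • b
  induction : ∀ (P : Env k D.Alg → Prop), (∀ a b, P (ins a b)) →
    (∀ x y, P x → P y → P (x + y)) → ∀ e, P e
  σ : ℕ → Env k D.Alg →ₗ[k] Env k D.Alg
  σ_ins : ∀ q a b, σ q (ins a b) = ins (D.componentProj q a) b
  isPartialProj : D.IsPartialProj σ
  aug : B →ₗ[k] k
  aug_one : aug 1 = 1
  leadAug : Env k D.Alg →ₗ[k] D.Alg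
  leadAug_ins : ∀ a b, leadAug (ins a b) = aug b • a
  ins_one_smul : ∀ a, (ins a 1) • (1 : D.Alg) = a
  -- For `a` of degree `m`, a part of `b` of positive degree pushes the product above `m ≥ q`; only
  -- the scalar part of `b` is seen.
  smul_lead : ∀ m q a b, q ≤ m → a ∈ D.component m →
    D.componentProj q (ins a b • (1 : D.Alg)) = aug b • D.componentProj q a
  μ : Module.End B (B ⊗[k] TensorAlgebra k V)
  α : Module.End (Env k D.Alg) (Env k D.Alg ⊗[k] TensorAlgebra k V)
  β : Module.End (Env k D.Alg) (Env k D.Alg ⊗[k] TensorAlgebra k V)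
  ins_μ : ∀ a x, (ins a).rTensor _ (μ x) = α ((ins a).rTensor _ x)
  sl_α : ∀ l x, (sl l).rTensor _ (α x) = μ ((sl l).rTensor _ x)
  σ_α : ∀ q x, (σ q).rTensor _ (α x) = α ((σ q).rTensor _ x)
  σ_β : ∀ q x, (σ (q + 1)).rTensor _ (β x) = β ((σ q).rTensor _ x)
  σ_zero_β : ∀ x, (σ 0).rTensor _ (β x) = 0
  μ_word : ∀ x ∈ (word k V 1).baseChange B, μ x ∈ (word k V 0).baseChange B
  α_word : ∀ x ∈ (word k V 1).baseChange (Env k D.Alg),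
    α x ∈ (word k V 0).baseChange (Env k D.Alg)
  μ_lowers : ∀ s ∈ D.S, D.Lowers μ 1 s
  α_lowers : ∀ s ∈ D.S, D.Lowers α 1 s
  μ_pow : ∀ s ∈ D.S, ∀ m, s ≤ m → ∀ x ∈ (D.Jbar s m).baseChange B, (μ ^ s) x = 0
  aug_μ : ∀ x ∈ (word k V 1).baseChange B, aug.rTensor (TensorAlgebra k V) (μ x) = 0
  -- The sign is `1` on the left and `-1` on the right, where `δ'_L - δ'_R = -(δ'_R - δ'_L)`.
  sgn : ℤ
  sgn_sq : sgn * sgn = 1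
  odd_eq : D.deltaL - D.deltaR = sgn • (α - β)
  even_eq : ∀ s, ∑ j ∈ Finset.range s, D.deltaL ^ j * D.deltaR ^ (s - 1 - j) =
    ∑ j ∈ Finset.range s, α ^ j * β ^ (s - 1 - j)

/-! ### The bimodule complex is a complex -/

section

variable (D : Relations k V)

theorem deltaL_commute_deltaR : Commute D.deltaL D.deltaR := by
  refine peel_commute fun v w => ?_
  simp only [envLeft, envRight, LinearMap.coe_mk, AddHom.coe_mk, Env.tmul_mul_tmul, one_mul, mul_one]

theorem lift_envLeft (x : TensorAlgebra k V) :
    TensorAlgebra.lift k D.envLeft x = Env.tmul (D.proj x) 1 := by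
  have : TensorAlgebra.lift k D.envLeft =
      (Algebra.TensorProduct.includeLeft : D.Alg →ₐ[k] D.Alg ⊗[k] D.Algᵐᵒᵖ).comp D.proj := by
    ext v
    simp only [LinearMap.comp_apply, AlgHom.toLinearMap_apply, TensorAlgebra.lift_ι_apply]
    rfl
  rw [this]
  rfl

theorem lift_op_envRight (x : TensorAlgebra k V) :
    TensorAlgebra.lift k ((MulOpposite.opLinearEquiv k).toLinearMap ∘ₗ D.envRight) x =
      MulOpposite.op (Env.tmul 1 (D.proj x)) := by
  induction x using TensorAlgebra.induction with
  | algebraMap r =>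
    rw [AlgHom.commutes, AlgHom.commutes, MulOpposite.algebraMap_apply,
      Algebra.algebraMap_eq_smul_one, Algebra.algebraMap_eq_smul_one, ← Env.smul_tmul_right]
    rfl
  | ι v => rw [TensorAlgebra.lift_ι_apply]; rfl
  | mul a b ha hb =>
    rw [map_mul, ha, hb, ← MulOpposite.op_mul, Env.tmul_mul_tmul, map_mul, one_mul]
  | add a b ha hb => rw [map_add, ha, hb, map_add, Env.tmul_add, MulOpposite.op_add]

theorem mem_K_zero {B : Type w} [Ring B] [Algebra k B] (x : B ⊗[k] TensorAlgebra k V)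
    (hx : x ∈ D.K B 0) : ∃ b, x = b ⊗ₜ 1 := by
  refine baseChange_induction x hx (fun b w hw => ?_) (fun x y hx hy => ?_)
  · rw [J_of_lt_two (by omega)] at hw
    obtain ⟨c, rfl⟩ := word_zero_eq w hw
    exact ⟨c • b, by rw [Algebra.algebraMap_eq_smul_one, TensorProduct.smul_tmul]⟩
  · obtain ⟨b, rfl⟩ := hx
    obtain ⟨c, rfl⟩ := hy
    exact ⟨b + c, (TensorProduct.add_tmul _ _ _).symm⟩

theorem tmul_one_mem_K_zero {B : Type w} [Ring B] [Algebra k B] (b : B) :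
    b ⊗ₜ[k] (1 : TensorAlgebra k V) ∈ D.K B 0 :=
  Submodule.tmul_mem_baseChange_of_mem _ (by
    rw [J_of_lt_two (by omega), word, pow_zero]; exact Submodule.one_le.1 le_rfl)

theorem tmul_one_injective {B : Type w} [Ring B] [Algebra k B] {b c : B}
    (h : b ⊗ₜ[k] (1 : TensorAlgebra k V) = c ⊗ₜ 1) : b = c := by
  have := congrArg ((TensorProduct.rid k B).toLinearMap ∘ₗ
    (TensorAlgebra.algebraMapInv : TensorAlgebra k V →ₐ[k] k).toLinearMap.lTensor B) h
  simpa using this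

theorem deltaL_pow_Jbar {s m : ℕ} (hs : s ∈ D.S) (hm : s ≤ m) :
    ∀ x ∈ (D.Jbar s m).baseChange (Env k D.Alg), (D.deltaL ^ s) x = 0 :=
  peelLeft_pow_Jbar _ hs hm fun r hr => by
    rw [lift_envLeft, D.proj_eq_zero hs hr, Env.zero_tmul]

theorem deltaR_pow_Jbar {s m : ℕ} (hs : s ∈ D.S) (hm : s ≤ m) :
    ∀ x ∈ (D.Jbar s m).baseChange (Env k D.Alg), (D.deltaR ^ s) x = 0 :=
  peelRight_pow_Jbar _ hs hm fun r hr => by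
    rw [lift_op_envRight, D.proj_eq_zero hs hr, Env.tmul_zero, MulOpposite.op_zero]

theorem bimoduleAug_tmul_one (e : Env k D.Alg) :
    D.bimoduleAug ⟨e ⊗ₜ 1, D.tmul_one_mem_K_zero e⟩ = e • (1 : D.Alg) := by
  change extend D.proj.toLinearMap (e ⊗ₜ 1) = _
  rw [extend_tmul, AlgHom.toLinearMap_apply, map_one]

theorem bimoduleAug_surjective : Function.Surjective D.bimoduleAug := fun a =>
  ⟨_, (D.bimoduleAug_tmul_one (Env.tmul a 1)).trans (by rw [Env.tmul_smul, mul_one, mul_one])⟩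

variable [FiniteDimensional k V]

/-- Since the two operators commute, `(δ'_L - δ'_R) ∑ δ'_L^j δ'_R^(s-1-j)` telescopes to `δ'_L^s -
δ'_R^s`, and both powers vanish on `J̄^s_m` for `m ≥ s`. -/
theorem bimoduleDiff_comp (i : ℕ) : D.bimoduleDiff i ∘ₗ D.bimoduleDiff (i + 1) = 0 := by
  refine LinearMap.ext fun x => Subtype.ext ?_
  refine hat_hat (fun s hs => (D.deltaL_lowers hs).sub (D.deltaR_lowers hs))
    (fun s hs => Lowers.sum _ fun j hj => ?_) (fun s hs m hm x hx => ?_) i x.1 x.2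
  · have h := ((D.deltaL_lowers hs).pow j).mul ((D.deltaR_lowers hs).pow (s - 1 - j))
    rwa [show j + (s - 1 - j) = s - 1 by
      have := Finset.mem_range.1 hj; omega] at h
  · rw [← Module.End.mul_apply, ← Module.End.mul_apply, D.deltaL_commute_deltaR.mul_geom_sum₂,
      D.deltaL_commute_deltaR.geom_sum₂_mul]
    simp only [LinearMap.sub_apply, D.deltaL_pow_Jbar hs hm x hx, D.deltaR_pow_Jbar hs hm x hx,
      sub_self, and_self]

theorem bimoduleAug_comp : D.bimoduleAug ∘ₗ D.bimoduleDiff 0 = 0 := by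
  refine LinearMap.ext fun x => ?_
  -- By linearity it suffices to treat `1 ⊗ v ⊗ 1`, whose differential `v ⊗ 1 ⊗ 1 - 1 ⊗ 1 ⊗ v` has
  -- product `v - v`.
  refine eq_of_baseChange (f := extend D.proj.toLinearMap ∘ₗ (D.deltaL - D.deltaR)) (g := 0)
    (P := D.J 1) (fun w hw => ?_) x.1 x.2
  rw [J_of_lt_two (by omega), word, pow_one] at hw
  obtain ⟨v, rfl⟩ := hw
  have h1 := D.deltaL_tmul 1 1 v 1
  have h2 := D.deltaR_tmul 1 1 v 1
  rw [mul_one] at h1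
  rw [one_mul] at h2
  rw [LinearMap.comp_apply, LinearMap.sub_apply, Env.one_def, h1, h2, map_sub, extend_tmul,
    extend_tmul, AlgHom.toLinearMap_apply, map_one, Env.tmul_smul, Env.tmul_smul]
  simp

end

end Relations

/-! ### The leading parts form the one-sided complex tensored with `A` -/

namespace Relations

variable {k : Type u} [Field k] {V : Type v} [AddCommGroup V] [Module k V]

namespace Side

variable {D : Relations k V} {B : Type w} [Ring B] [Algebra k B] (S : D.Side B)

/-- The differential of the one-sided complex `B ⊗ J_i`. -/
def diffB : ∀ i, D.K B (i + 1) →ₗ[B] D.K B i :=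
  diff S.μ (fun s => S.μ ^ (s - 1))
    (hat_mem S.μ_word S.μ_lowers fun s hs => (S.μ_lowers s hs).pow (s - 1))

theorem lead_mem : ∀ i, ∀ x ∈ D.K (Env k D.Alg) (i + 1),
    D.hat (S.sgn • S.α) (fun s => S.α ^ (s - 1)) (i + 1) x ∈ D.K (Env k D.Alg) i :=
  hat_mem (fun x hx => Submodule.smul_of_tower_mem _ S.sgn (S.α_word x hx))
    (fun s hs m x hx => Submodule.smul_of_tower_mem _ S.sgn (S.α_lowers s hs m x hx))
    fun s hs => (S.α_lowers s hs).pow (s - 1)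

/-- The leading part of the bimodule differential. -/
def lead (i : ℕ) : D.K (Env k D.Alg) (i + 1) →+ D.K (Env k D.Alg) i :=
  ((D.hat (S.sgn • S.α) (fun s => S.α ^ (s - 1)) (i + 1)).restrict (S.lead_mem i)).toAddMonoidHom

@[simp] theorem coe_lead (i : ℕ) (x : D.K (Env k D.Alg) (i + 1)) :
    (S.lead i x : Env k D.Alg ⊗[k] TensorAlgebra k V) =
      D.hat (S.sgn • S.α) (fun s => S.α ^ (s - 1)) (i + 1) x.1 := rfl

def sign (i : ℕ) : ℤ := if Odd i then S.sgn else 1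

theorem sign_sq (i : ℕ) : S.sign i * S.sign i = 1 := by
  unfold sign; split_ifs
  · exact S.sgn_sq
  · rfl

theorem hat_smul (i : ℕ) : D.hat (S.sgn • S.α) (fun s => S.α ^ (s - 1)) i =
    S.sign i • D.hat S.α (fun s => S.α ^ (s - 1)) i := by
  unfold hat sign
  split_ifs with h1 h2 h2
  · rfl
  · exact absurd (h1 ▸ odd_one) h2
  · simp only [Finset.smul_sum, smul_mul_assoc]
  · rw [one_smul]

theorem pow_ins (a : D.Alg) (n : ℕ) (x : B ⊗[k] TensorAlgebra k V) :
    (S.ins a).rTensor _ ((S.μ ^ n) x) = (S.α ^ n) ((S.ins a).rTensor _ x) := by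
  induction n generalizing x with
  | zero => rfl
  | succ n ih => rw [pow_succ, pow_succ, Module.End.mul_apply, Module.End.mul_apply, ih, S.ins_μ]

theorem pow_sl (l : D.Alg →ₗ[k] k) (n : ℕ) (x : Env k D.Alg ⊗[k] TensorAlgebra k V) :
    (S.sl l).rTensor _ ((S.α ^ n) x) = (S.μ ^ n) ((S.sl l).rTensor _ x) := by
  induction n generalizing x with
  | zero => rfl
  | succ n ih => rw [pow_succ, pow_succ, Module.End.mul_apply, Module.End.mul_apply, ih, S.sl_α]

/-- `x ↦ a ⊗ x`. -/
def insK (a : D.Alg) (i : ℕ) (x : D.K B i) : D.K (Env k D.Alg) i :=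
  ⟨(S.ins a).rTensor _ x.1, rTensor_mem_K (S.ins a) i x.1 x.2⟩

def slK (l : D.Alg →ₗ[k] k) (i : ℕ) (x : D.K (Env k D.Alg) i) : D.K B i :=
  ⟨(S.sl l).rTensor _ x.1, rTensor_mem_K (S.sl l) i x.1 x.2⟩

/-- Up to sign, inserting an element of `A` and slicing by a functional (`slK_lead`) commute with
the differentials of the one-sided complex and of its tensor product with `A`. -/
theorem lead_insK (a : D.Alg) (i : ℕ) (x : D.K B (i + 1)) :
    S.lead i (S.insK a (i + 1) x) = S.sign (i + 1) • S.insK a i (S.diffB i x) := by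
  refine Subtype.ext ?_
  rw [coe_lead, hat_smul]
  exact congrArg (S.sign (i + 1) • ·)
    (hat_rTensor (S.ins a) (S.ins_μ a) (fun s _ => S.pow_ins a (s - 1)) (i + 1) x.1).symm

theorem slK_lead (l : D.Alg →ₗ[k] k) (i : ℕ) (x : D.K (Env k D.Alg) (i + 1)) :
    S.slK l i (S.lead i x) = S.sign (i + 1) • S.diffB i (S.slK l (i + 1) x) := by
  refine Subtype.ext ?_
  change (S.sl l).rTensor _ (S.lead i x).1 = _
  rw [coe_lead, hat_smul, LinearMap.smul_apply, map_zsmul]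
  exact congrArg (S.sign (i + 1) • ·)
    (hat_rTensor (S.sl l) (S.sl_α l) (fun s _ => S.pow_sl l (s - 1)) (i + 1) x.1)

/-- Expansion along a basis of the other factor: the slices by the coordinate functionals, inserted
at the basis vectors, sum to `x`. The basis may be infinite, and allowing every larger finite set
makes the claim additive in `x`. -/
theorem exists_resolution (x : Env k D.Alg ⊗[k] TensorAlgebra k V) :
    ∃ s : Finset (Module.Basis.ofVectorSpaceIndex k D.Alg), ∀ t, s ⊆ t → x = ∑ i ∈ t,
      (S.ins (Module.Basis.ofVectorSpace k D.Alg i)).rTensor _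
        ((S.sl ((Module.Basis.ofVectorSpace k D.Alg).coord i)).rTensor _ x) := by
  classical
  set b := Module.Basis.ofVectorSpace k D.Alg
  have hadd : ∀ {X : Type (max u v)} [AddCommGroup X] [Module k X]
      (f : Module.Basis.ofVectorSpaceIndex k D.Alg → X →ₗ[k] X) (x y : X),
      (∃ s : Finset _, ∀ t, s ⊆ t → x = ∑ i ∈ t, f i x) →
      (∃ s : Finset _, ∀ t, s ⊆ t → y = ∑ i ∈ t, f i y) →
      (∃ s : Finset _, ∀ t, s ⊆ t → x + y = ∑ i ∈ t, f i (x + y)) := by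
    rintro X _ _ f x y ⟨s, hs⟩ ⟨s', hs'⟩
    refine ⟨s ∪ s', fun t ht => ?_⟩
    simp only [map_add, Finset.sum_add_distrib]
    rw [← hs t (Finset.union_subset_left ht), ← hs' t (Finset.union_subset_right ht)]
  have key : ∀ e : Env k D.Alg, ∃ s : Finset (Module.Basis.ofVectorSpaceIndex k D.Alg),
      ∀ t, s ⊆ t → e = ∑ i ∈ t, (S.ins (b i) ∘ₗ S.sl (b.coord i)) e := by
    refine S.induction _ (fun a c => ⟨(b.repr a).support, fun t ht => ?_⟩)
      (fun x y => hadd _ x y)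
    simp only [LinearMap.comp_apply, S.sl_ins, map_smul]
    conv_lhs => rw [← b.linearCombination_repr a, Finsupp.linearCombination_apply,
      Finsupp.sum_of_support_subset _ ht _ (by simp)]
    rw [map_sum, LinearMap.sum_apply]
    simp
  induction x using TensorProduct.induction_on with
  | zero => exact ⟨∅, fun t _ => by simp⟩
  | add x y hx hy =>
    exact hadd (fun i => (S.ins (b i)).rTensor _ ∘ₗ (S.sl (b.coord i)).rTensor _) x y hx hy
  | tmul e w =>
    obtain ⟨s, hs⟩ := key e
    refine ⟨s, fun t ht => ?_⟩
    simp only [LinearMap.rTensor_tmul]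
    rw [← TensorProduct.sum_tmul]
    exact congrArg (· ⊗ₜ w) (hs t ht)

/-- Exactness of the sequence of leading parts follows from that of the one-sided complex. -/
theorem exists_lead_eq (i : ℕ) (x : D.K (Env k D.Alg) i)
    (h : ∀ l, ∃ y, S.diffB i y = S.slK l i x) : ∃ y, S.lead i y = x := by
  obtain ⟨s, hs⟩ := S.exists_resolution x.1
  choose y hy using h
  -- The preimage is built coordinate by coordinate; the sign cancels the one in `lead_insK`.
  refine ⟨∑ j ∈ s, S.sign (i + 1) • S.insK (Module.Basis.ofVectorSpace k D.Alg j) (i + 1)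
    (y ((Module.Basis.ofVectorSpace k D.Alg).coord j)), Subtype.ext ?_⟩
  rw [map_sum, hs s subset_rfl, AddSubmonoidClass.coe_finsetSum]
  refine Finset.sum_congr rfl fun j _ => ?_
  rw [map_zsmul, lead_insK, smul_smul, S.sign_sq, one_smul, hy]
  rfl

end Side

end Relations

/-! ### Exactness of the bimodule complex against that of the one-sided complex -/

namespace Relations

variable {k : Type u} [Field k] {V : Type v} [AddCommGroup V] [Module k V]

namespace Side

variable {D : Relations k V} {B : Type w} [Ring B] [Algebra k B] (S : D.Side B)

/-- The leading part of the augmentation. -/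
def leadAugK : D.K (Env k D.Alg) 0 →+ D.Alg :=
  (((TensorProduct.rid k D.Alg).toLinearMap ∘ₗ TensorProduct.map S.leadAug
    (TensorAlgebra.algebraMapInv : TensorAlgebra k V →ₐ[k] k).toLinearMap) ∘ₗ
    (D.K (Env k D.Alg) 0).subtype.restrictScalars k).toAddMonoidHom

theorem leadAugK_tmul_one (e : Env k D.Alg) :
    S.leadAugK ⟨e ⊗ₜ 1, D.tmul_one_mem_K_zero e⟩ = S.leadAug e := by
  change (TensorProduct.rid k D.Alg) (TensorProduct.map S.leadAug
    (TensorAlgebra.algebraMapInv : TensorAlgebra k V →ₐ[k] k).toLinearMap (e ⊗ₜ 1)) = _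
  simp

theorem leads_odd : Leads S.σ (S.sgn • (S.α - S.β)) (S.sgn • S.α) := by
  have := ((Leads.of_comm S.σ_α).sub (Leads.of_raise S.σ_β S.σ_zero_β)).smul S.sgn
  rwa [sub_zero] at this

/-- Every summand with `j < s - 1` contains a factor `β`, which raises the partial degree; only
`α^(s-1)` survives. -/
theorem leads_even {s : ℕ} (hs : s ∈ D.S) :
    Leads S.σ (∑ j ∈ Finset.range s, S.α ^ j * S.β ^ (s - 1 - j)) (S.α ^ (s - 1)) := by
  have := Leads.sum (D := D) (Finset.range s) fun j _ => ((Leads.of_comm S.σ_α).pow j).mul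
    ((Leads.of_raise S.σ_β S.σ_zero_β).pow (s - 1 - j))
  have h2 := D.two_le s hs
  rwa [Finset.sum_eq_single (a := s - 1) (f := fun j => S.α ^ j * 0 ^ (s - 1 - j)), Nat.sub_self,
    pow_zero, mul_one] at this
  · intro j hj hjs
    have := Finset.mem_range.1 hj
    rw [zero_pow (by omega), mul_zero]
  · intro h
    exact absurd (Finset.mem_range.2 (by omega)) h

@[elab_as_elim]
theorem K_zero_induction {P : D.K (Env k D.Alg) 0 → Prop} (x : D.K (Env k D.Alg) 0)
    (h : ∀ e, P ⟨e ⊗ₜ 1, D.tmul_one_mem_K_zero e⟩) : P x := by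
  obtain ⟨x, hx⟩ := x
  obtain ⟨e, rfl⟩ := D.mem_K_zero x hx
  exact h e

theorem restrictK_tmul_one (σ : ℕ → Env k D.Alg →ₗ[k] Env k D.Alg) (q : ℕ) (e : Env k D.Alg) :
    IsPartialProj.restrictK σ 0 q ⟨e ⊗ₜ 1, D.tmul_one_mem_K_zero e⟩ =
      ⟨σ q e ⊗ₜ 1, D.tmul_one_mem_K_zero _⟩ := rfl

theorem totalProj_tmul_one (n : ℕ) (e : Env k D.Alg) :
    D.totalProj n (e ⊗ₜ 1) = D.envProj n e ⊗ₜ 1 := by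
  have h1 : (1 : TensorAlgebra k V) ∈ word k V 0 := by
    rw [word, pow_zero]; exact Submodule.one_le.1 le_rfl
  refine D.env_grading.induction e (fun m e he => ?_) (fun x y hx hy => ?_)
  · have h := D.tmul_mem_totalGrading he h1 (add_zero m)
    by_cases hm : m = n
    · subst hm
      rw [D.env_grading.same _ _ he, D.total_grading.same _ _ h]
    · rw [D.env_grading.ne _ _ hm _ he, D.total_grading.ne _ _ hm _ h, TensorProduct.zero_tmul]
  · simp only [TensorProduct.add_tmul, map_add, hx, hy]

theorem _root_.MultiKoszul.Relations.env_smul_mem {m n : ℕ} {e : Env k D.Alg} (he : e ∈ D.envGrading m) {a : D.Alg}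
    (ha : a ∈ D.component n) : e • a ∈ D.component (m + n) := by
  induction he using Submodule.span_induction with
  | mem x hx =>
    obtain ⟨p, q, rfl, b, hb, c, hc, rfl⟩ := hx
    rw [Env.tmul_smul, show p + q + n = p + n + q by omega]
    exact D.mul_mem_component (D.mul_mem_component hb ha) hc
  | zero => rw [zero_smul]; exact Submodule.zero_mem _
  | add x y _ _ hx hy => rw [add_smul]; exact Submodule.add_mem _ hx hy
  | smul c x _ hx => rw [smul_assoc]; exact Submodule.smul_mem _ c hx

/-- Split `e` by partial degree `m`. The pieces with `m < q` vanish by assumption, and for `m ≥ q`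
the degree `q` component of the product is given by `smul_lead`. -/
theorem componentProj_smul_one (q : ℕ) (e : Env k D.Alg) (he : ∀ r < q, S.σ r e = 0) :
    D.componentProj q (e • (1 : D.Alg)) = S.leadAug (S.σ q e) := by
  have key : ∀ m, q ≤ m → ∀ e : Env k D.Alg, D.componentProj q (S.σ m e • (1 : D.Alg)) =
      S.leadAug (S.σ q (S.σ m e)) := by
    intro m hm
    refine S.induction _ (fun a b => ?_) (fun x y hx hy => ?_)
    · rw [S.σ_ins, S.smul_lead m q _ _ hm (D.component_grading.proj_mem m a), S.σ_ins,
        S.leadAug_ins]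
    · simp only [map_add, add_smul, hx, hy]
  have hsum : ∀ e, ∃ N, ∀ M, N ≤ M → e = ∑ m ∈ Finset.range M, S.σ m e := by
    intro e
    refine D.env_grading.induction e (fun n e he => ⟨n + 1, fun M hM => ?_⟩) ?_
    · obtain ⟨M, rfl⟩ : ∃ m, M = m + 1 := ⟨M - 1, by omega⟩
      exact S.isPartialProj.sum n e he M (by omega)
    · rintro x y ⟨N, hN⟩ ⟨N', hN'⟩
      refine ⟨max N N', fun M hM => ?_⟩
      simp only [map_add, Finset.sum_add_distrib]
      rw [← hN M (by omega), ← hN' M (by omega)]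
  obtain ⟨N, hN⟩ := hsum e
  conv_lhs => rw [hN N le_rfl]
  conv_rhs => rw [hN N le_rfl]
  simp only [Finset.sum_smul, map_sum]
  refine Finset.sum_congr rfl fun m _ => ?_
  rcases lt_or_ge m q with h | h
  · rw [he m h]; simp
  · exact key m h e

theorem diffB_comp (i : ℕ) (x : D.K B (i + 2)) : S.diffB i (S.diffB (i + 1) x) = 0 := by
  refine Subtype.ext (hat_hat S.μ_lowers (fun s hs => (S.μ_lowers s hs).pow (s - 1))
    (fun s hs m hm x hx => ?_) i x.1 x.2)
  have h2 := D.two_le s hs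
  rw [← Module.End.mul_apply, ← Module.End.mul_apply, ← pow_succ, ← pow_succ',
    show s - 1 + 1 = s by omega]
  exact ⟨S.μ_pow s hs m hm x hx, S.μ_pow s hs m hm x hx⟩

theorem aug_diffB {ε : D.K B 0 →+ k} (hε : ∀ b, ε ⟨b ⊗ₜ 1, D.tmul_one_mem_K_zero b⟩ = S.aug b)
    (x : D.K B 1) : ε (S.diffB 0 x) = 0 := by
  have hx : (S.diffB 0 x).1 = S.μ x.1 := by
    change D.hat S.μ _ 1 x.1 = _
    rw [hat_one]
  have h := S.aug_μ x.1 ((congrArg (Submodule.baseChange B) (J_of_lt_two (by omega))).le x.2)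
  rw [← hx] at h
  obtain ⟨b, hb⟩ := D.mem_K_zero _ (S.diffB 0 x).2
  rw [show S.diffB 0 x = ⟨b ⊗ₜ 1, D.tmul_one_mem_K_zero b⟩ from Subtype.ext hb, hε]
  rw [hb, LinearMap.rTensor_tmul] at h
  exact tmul_one_injective (V := V) (h.trans (TensorProduct.zero_tmul _ _).symm)

theorem slK_tmul_one (l : D.Alg →ₗ[k] k) (e : Env k D.Alg) :
    S.slK l 0 ⟨e ⊗ₜ 1, D.tmul_one_mem_K_zero e⟩ = ⟨S.sl l e ⊗ₜ 1, D.tmul_one_mem_K_zero _⟩ := rfl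

theorem insK_tmul_one (a : D.Alg) (b : B) :
    S.insK a 0 ⟨b ⊗ₜ 1, D.tmul_one_mem_K_zero b⟩ = ⟨S.ins a b ⊗ₜ 1, D.tmul_one_mem_K_zero _⟩ := rfl

theorem apply_leadAug (l : D.Alg →ₗ[k] k) (e : Env k D.Alg) : l (S.leadAug e) = S.aug (S.sl l e) := by
  refine S.induction (fun e => l (S.leadAug e) = S.aug (S.sl l e)) (fun a b => ?_)
    (fun x y hx hy => ?_) e
  · rw [S.leadAug_ins, S.sl_ins, map_smul, map_smul, smul_eq_mul, smul_eq_mul, mul_comm]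
  · simp only [map_add, hx, hy]

theorem slK_insK (l : D.Alg →ₗ[k] k) (a : D.Alg) (i : ℕ) (x : D.K B i) :
    S.slK l i (S.insK a i x) = l a • x := by
  refine Subtype.ext ?_
  change (S.sl l).rTensor _ ((S.ins a).rTensor _ x.1) = l a • x.1
  rw [← LinearMap.rTensor_comp_apply,
    show S.sl l ∘ₗ S.ins a = l a • LinearMap.id from LinearMap.ext fun b => S.sl_ins l a b,
    LinearMap.rTensor_smul, LinearMap.smul_apply, LinearMap.rTensor_id_apply]

theorem aug_surjective {ε : D.K B 0 →+ k} (hε : ∀ b, ε ⟨b ⊗ₜ 1, D.tmul_one_mem_K_zero b⟩ = S.aug b)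
    : Function.Surjective ε := fun c =>
  ⟨⟨(c • (1 : B)) ⊗ₜ 1, D.tmul_one_mem_K_zero _⟩, by rw [hε, map_smul, S.aug_one, smul_eq_mul, mul_one]⟩

/-- Slices of a cycle are cycles of the one-sided complex, hence boundaries, and the primitives are
reassembled by `exists_lead_eq`. -/
theorem lead_exact_succ {i : ℕ} (h : ∀ x, S.diffB i x = 0 → ∃ y, S.diffB (i + 1) y = x)
    (x : D.K (Env k D.Alg) (i + 1)) (hx : S.lead i x = 0) : ∃ y, S.lead (i + 1) y = x := by
  refine S.exists_lead_eq (i + 1) x fun l => h _ ?_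
  have := S.slK_lead l i x
  rw [hx, show S.slK l i 0 = 0 from Subtype.ext (map_zero _)] at this
  rw [← one_smul ℤ (S.diffB i _), ← S.sign_sq (i + 1), mul_smul, ← this, smul_zero]

theorem restrictK_zero_insK_one (i : ℕ) (x : D.K B i) :
    IsPartialProj.restrictK S.σ i 0 (S.insK 1 i x) = S.insK 1 i x := by
  refine Subtype.ext ?_
  change (S.σ 0).rTensor _ ((S.ins 1).rTensor _ x.1) = (S.ins 1).rTensor _ x.1
  rw [← LinearMap.rTensor_comp_apply]
  congr 2
  ext b
  rw [LinearMap.comp_apply, S.σ_ins, D.component_grading.same _ _ D.one_mem_component]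

/-- Slicing by the augmentation of `A` retracts `x ↦ 1 ⊗ x` and commutes with the differentials up
to sign, so a primitive of `1 ⊗ x` yields one of `x`. -/
theorem exists_diffB_eq (i : ℕ) (x : D.K B i) (h : ∃ y, S.lead i y = S.insK 1 i x) :
    ∃ y, S.diffB i y = x := by
  obtain ⟨y, hy⟩ := h
  refine ⟨S.sign (i + 1) • S.slK D.aug.toLinearMap (i + 1) y, ?_⟩
  rw [map_zsmul, ← S.slK_lead, hy, slK_insK, AlgHom.toLinearMap_apply, map_one, one_smul]

/-- Exactness of the leading parts at `A^e ⊗ J_0`. -/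
theorem lead_exact_zero {ε : D.K B 0 →+ k} (hε : ∀ b, ε ⟨b ⊗ₜ 1, D.tmul_one_mem_K_zero b⟩ = S.aug b)
    (h : ∀ x, ε x = 0 → ∃ y, S.diffB 0 y = x) (x : D.K (Env k D.Alg) 0)
    (hx : S.leadAugK x = 0) : ∃ y, S.lead 0 y = x := by
  revert hx
  refine K_zero_induction x fun e he => S.exists_lead_eq 0 _ fun l => h _ ?_
  rw [leadAugK_tmul_one] at he
  rw [slK_tmul_one, hε, ← apply_leadAug, he, map_zero]

/-- On the target `A` the partial and the total degree are both its own degree. -/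
theorem isLeadingPart_aug : IsLeadingPart
    (IsPartialProj.restrictK S.σ 0) (IsPartialProj.totalK D 0)
    (fun n => (D.componentProj n).toAddMonoidHom) (fun n => (D.componentProj n).toAddMonoidHom)
    D.bimoduleAug.toAddMonoidHom S.leadAugK where
  homogeneous n x := by
    refine K_zero_induction x fun e => ?_
    have h : IsPartialProj.totalK D 0 n ⟨e ⊗ₜ 1, D.tmul_one_mem_K_zero e⟩ =
        ⟨D.envProj n e ⊗ₜ 1, D.tmul_one_mem_K_zero _⟩ := Subtype.ext (totalProj_tmul_one n e)
    rw [h]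
    change D.componentProj n (D.bimoduleAug ⟨e ⊗ₜ 1, D.tmul_one_mem_K_zero e⟩) =
      D.bimoduleAug ⟨D.envProj n e ⊗ₜ 1, D.tmul_one_mem_K_zero _⟩
    rw [bimoduleAug_tmul_one, bimoduleAug_tmul_one]
    exact D.env_grading.proj_comm D.component_grading
      ((LinearMap.toSpanSingleton (Env k D.Alg) D.Alg 1).restrictScalars k)
      (fun n e he => by simpa using env_smul_mem he D.one_mem_component) n e
  lead q x hx := by
    revert hx
    refine K_zero_induction x fun e he => ?_
    rw [restrictK_tmul_one, leadAugK_tmul_one]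
    change D.componentProj q (D.bimoduleAug ⟨e ⊗ₜ 1, D.tmul_one_mem_K_zero e⟩) = _
    rw [bimoduleAug_tmul_one]
    exact S.componentProj_smul_one q e fun r hr =>
      tmul_one_injective ((congrArg Subtype.val (he r hr)).trans (TensorProduct.zero_tmul _ _).symm)
  diag q x := by
    refine K_zero_induction x fun e => ?_
    rw [restrictK_tmul_one, leadAugK_tmul_one, leadAugK_tmul_one]
    refine S.induction (fun e => D.componentProj q (S.leadAug e) = S.leadAug (S.σ q e))
      (fun a b => ?_) (fun x y hx hy => ?_) e
    · rw [S.leadAug_ins, S.σ_ins, S.leadAug_ins, map_smul]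
    · simp only [map_add, hx, hy]


variable [FiniteDimensional k V]

theorem isLeadingPart (i : ℕ) : IsLeadingPart
    (IsPartialProj.restrictK S.σ (i + 1)) (IsPartialProj.totalK D (i + 1))
    (IsPartialProj.restrictK S.σ i) (IsPartialProj.totalK D i)
    (D.bimoduleDiff i).toAddMonoidHom (S.lead i) where
  homogeneous n x := by
    refine Subtype.ext (Homogeneous.totalProj ?_ n x.1)
    have hL : Homogeneous D.deltaL := Homogeneous.peelLeft _ fun v =>
      D.tmul_mem_envGrading (D.gen_mem_component v) D.one_mem_component rfl
    have hR : Homogeneous D.deltaR := Homogeneous.peelRight _ fun v =>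
      D.tmul_mem_envGrading D.one_mem_component (D.gen_mem_component v) rfl
    exact Homogeneous.hat (hL.sub hR)
      (fun s => Homogeneous.sum _ fun j _ => (hL.pow j).mul (hR.pow _)) _
  lead q x hx := by
    refine Subtype.ext ?_
    -- The bimodule differential is first expressed through `α` and `β`, where leading parts are
    -- known, and then turned back by `odd_eq` and `even_eq`.
    have h := Leads.hat S.leads_odd (fun s hs => S.leads_even hs) (i + 1) q x.1
      fun r hr => congrArg Subtype.val (hx r hr)
    rw [← S.odd_eq] at h
    simp only [← S.even_eq] at h
    exact h
  diag q x := Subtype.ext (hat_rTensor (S.σ q) (fun x => by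
      rw [LinearMap.smul_apply, LinearMap.smul_apply, map_zsmul, S.σ_α]) (fun s _ => by
        induction s - 1 with
        | zero => intro x; rfl
        | succ n ih =>
          intro x
          rw [pow_succ, Module.End.mul_apply, Module.End.mul_apply, ih, S.σ_α]) (i + 1) x.1)

theorem filtered_exact_zero {ε : D.K B 0 →+ k} (hε : ∀ b, ε ⟨b ⊗ₜ 1, D.tmul_one_mem_K_zero b⟩ = S.aug b)
    (h : ∀ x, ε x = 0 → ∃ y, S.diffB 0 y = x) (q : ℕ)
    (x : D.K (Env k D.Alg) 0) (hq : ∀ r < q, IsPartialProj.restrictK S.σ 0 r x = 0)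
    (hx : D.bimoduleAug x = 0) :
    ∃ y, (∀ r < q, IsPartialProj.restrictK S.σ 1 r y = 0) ∧ D.bimoduleDiff 0 y = x :=
  filtered_exact (S.isPartialProj.isBigraded 0) (S.isPartialProj.isBigraded 1)
    S.isLeadingPart_aug (S.isLeadingPart 0) (fun x => LinearMap.congr_fun D.bimoduleAug_comp x)
    (S.lead_exact_zero hε h) q x hq hx

theorem filtered_exact_succ {i : ℕ} (h : ∀ x, S.diffB i x = 0 → ∃ y, S.diffB (i + 1) y = x) (q : ℕ)
    (x : D.K (Env k D.Alg) (i + 1)) (hq : ∀ r < q, IsPartialProj.restrictK S.σ (i + 1) r x = 0)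
    (hx : D.bimoduleDiff i x = 0) :
    ∃ y, (∀ r < q, IsPartialProj.restrictK S.σ (i + 2) r y = 0) ∧ D.bimoduleDiff (i + 1) y = x :=
  filtered_exact (S.isPartialProj.isBigraded (i + 1)) (S.isPartialProj.isBigraded (i + 2))
    (S.isLeadingPart i) (S.isLeadingPart (i + 1))
    (fun x => LinearMap.congr_fun (D.bimoduleDiff_comp i) x) (S.lead_exact_succ h) q x hq hx

theorem diffB_exact_zero {ε : D.K B 0 →+ k} (hε : ∀ b, ε ⟨b ⊗ₜ 1, D.tmul_one_mem_K_zero b⟩ = S.aug b)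
    (h : ∀ x, D.bimoduleAug x = 0 → ∃ y, D.bimoduleDiff 0 y = x)
    (x : D.K B 0) (hx : ε x = 0) : ∃ y, S.diffB 0 y = x := by
  refine S.exists_diffB_eq 0 x (leading_exact S.isLeadingPart_aug (S.isLeadingPart 0) ?_ h _
    (S.restrictK_zero_insK_one 0 x) ?_)
  · intro y hy
    -- The augmentation is split by placing its value in the other factor. This keeps the product
    -- and has no component of partial degree zero, because by assumption the value has none in
    -- degree zero.
    refine ⟨⟨S.ins (D.bimoduleAug y) 1 ⊗ₜ 1, D.tmul_one_mem_K_zero _⟩, ?_, ?_⟩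
    · rw [restrictK_tmul_one]
      refine Subtype.ext ?_
      change S.σ 0 _ ⊗ₜ[k] (1 : TensorAlgebra k V) = 0
      rw [S.σ_ins]
      rw [show D.componentProj 0 (D.bimoduleAug y) = 0 from hy, map_zero, LinearMap.zero_apply,
        TensorProduct.zero_tmul]
    · exact (D.bimoduleAug_tmul_one _).trans (S.ins_one_smul _)
  · obtain ⟨x, hx'⟩ := x
    obtain ⟨b, rfl⟩ := D.mem_K_zero x hx'
    rw [insK_tmul_one, leadAugK_tmul_one, S.leadAug_ins, ← hε, hx, zero_smul]

theorem diffB_exact_succ {i : ℕ}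
    (h₀ : ∀ x, IsPartialProj.restrictK S.σ i 0 (D.bimoduleDiff i x) = 0 →
      ∃ y, IsPartialProj.restrictK S.σ (i + 1) 0 y = 0 ∧ D.bimoduleDiff i y = D.bimoduleDiff i x)
    (h : ∀ x, D.bimoduleDiff i x = 0 → ∃ y, D.bimoduleDiff (i + 1) y = x)
    (x : D.K B (i + 1)) (hx : S.diffB i x = 0) : ∃ y, S.diffB (i + 1) y = x := by
  refine S.exists_diffB_eq (i + 1) x (leading_exact (S.isLeadingPart i) (S.isLeadingPart (i + 1))
    h₀ h _ (S.restrictK_zero_insK_one _ x) ?_)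
  rw [lead_insK, hx, show S.insK 1 i 0 = 0 from Subtype.ext (map_zero _), smul_zero]

/-- The correction needed at place `i + 1` is filtered exactness of the bimodule complex at place
`i`. That follows from exactness of the one-sided complex at `i`, whence the induction. -/
theorem diffB_exact {ε : D.K B 0 →+ k} (hε : ∀ b, ε ⟨b ⊗ₜ 1, D.tmul_one_mem_K_zero b⟩ = S.aug b)
    (h0 : ∀ x, D.bimoduleAug x = 0 → ∃ y, D.bimoduleDiff 0 y = x)
    (h : ∀ i x, D.bimoduleDiff i x = 0 → ∃ y, D.bimoduleDiff (i + 1) y = x) (i : ℕ)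
    (x : D.K B (i + 1)) (hx : S.diffB i x = 0) : ∃ y, S.diffB (i + 1) y = x := by
  induction i with
  | zero =>
    refine S.diffB_exact_succ (fun y hy => ?_) (h 0) x hx
    -- Filtered exactness with `q = 1`: a boundary without component of partial degree zero has a
    -- primitive without one.
    obtain ⟨z, hz, hz'⟩ := S.filtered_exact_zero hε (S.diffB_exact_zero hε h0) 1
      (D.bimoduleDiff 0 y) (fun r hr => by rwa [Nat.lt_one_iff.1 hr])
      (LinearMap.congr_fun D.bimoduleAug_comp y)
    exact ⟨z, hz 0 one_pos, hz'⟩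
  | succ i ih =>
    refine S.diffB_exact_succ (fun y hy => ?_) (h (i + 1)) x hx
    obtain ⟨z, hz, hz'⟩ := S.filtered_exact_succ ih 1
      (D.bimoduleDiff (i + 1) y) (fun r hr => by rwa [Nat.lt_one_iff.1 hr])
      (LinearMap.congr_fun (D.bimoduleDiff_comp i) y)
    exact ⟨z, hz 0 one_pos, hz'⟩

/-- The bimodule complex is exact if and only if the one-sided complex is. -/
theorem isExactAugmented_iff {ε : D.K B 0 →+ k} (hε : ∀ b, ε ⟨b ⊗ₜ 1, D.tmul_one_mem_K_zero b⟩ = S.aug b)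
    :
    IsExactAugmented (C := fun i => D.K (Env k D.Alg) i)
        (fun i => (D.bimoduleDiff i).toAddMonoidHom) D.bimoduleAug.toAddMonoidHom ↔
      IsExactAugmented (C := fun i => D.K B i) (fun i => (S.diffB i).toAddMonoidHom) ε := by
  constructor
  · rintro ⟨-, h0, h⟩
    have h0' : ∀ x, D.bimoduleAug x = 0 → ∃ y, D.bimoduleDiff 0 y = x := fun x => (h0 x).1
    have h' : ∀ i x, D.bimoduleDiff i x = 0 → ∃ y, D.bimoduleDiff (i + 1) y = x :=
      fun i x => (h i x).1
    refine ⟨S.aug_surjective hε, fun x => ⟨S.diffB_exact_zero hε h0' x, ?_⟩,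
      fun i x => ⟨S.diffB_exact hε h0' h' i x, ?_⟩⟩
    · rintro ⟨y, rfl⟩; exact S.aug_diffB hε y
    · rintro ⟨y, rfl⟩; exact S.diffB_comp i y
  · rintro ⟨-, h0, h⟩
    refine ⟨D.bimoduleAug_surjective, fun x => ⟨fun hx => ?_, ?_⟩, fun i x => ⟨fun hx => ?_, ?_⟩⟩
    · obtain ⟨y, -, hy⟩ := S.filtered_exact_zero hε (fun x => (h0 x).1) 0 x
        (fun r hr => absurd hr (Nat.not_lt_zero r)) hx
      exact ⟨y, hy⟩
    · rintro ⟨y, rfl⟩; exact LinearMap.congr_fun D.bimoduleAug_comp y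
    · obtain ⟨y, -, hy⟩ := S.filtered_exact_succ (fun x => (h i x).1) 0 x
        (fun r hr => absurd hr (Nat.not_lt_zero r)) hx
      exact ⟨y, hy⟩
    · rintro ⟨y, rfl⟩; exact LinearMap.congr_fun (D.bimoduleDiff_comp i) y

end Side

end Relations

/-! ### The left and the right instance of the comparison -/

namespace Relations

variable {k : Type u} [Field k] {V : Type v} [AddCommGroup V] [Module k V] (D : Relations k V)

theorem componentProj_mul_right {m q : ℕ} {a : D.Alg} (b : D.Alg) (hq : q ≤ m)
    (ha : a ∈ D.component m) :
    D.componentProj q (a * b) = D.aug b • D.componentProj q a := by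
  refine D.component_grading.induction b (fun n b hb => ?_) (fun x y hx hy => ?_)
  · by_cases hn : n = 0
    · subst hn
      obtain ⟨c, rfl⟩ := D.component_zero_eq b hb
      rw [← Algebra.commutes, ← Algebra.smul_def, map_smul, AlgHom.commutes]
      rfl
    · rw [D.component_grading.ne _ _ (by omega) _ (D.mul_mem_component ha hb),
        D.aug_component hn b hb, zero_smul]
  · simp only [mul_add, map_add, add_smul, hx, hy]

theorem componentProj_mul_left {m q : ℕ} {a : D.Alg} (b : D.Alg) (hq : q ≤ m)
    (ha : a ∈ D.component m) :
    D.componentProj q (b * a) = D.aug b • D.componentProj q a := by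
  refine D.component_grading.induction b (fun n b hb => ?_) (fun x y hx hy => ?_)
  · by_cases hn : n = 0
    · subst hn
      obtain ⟨c, rfl⟩ := D.component_zero_eq b hb
      rw [← Algebra.smul_def, map_smul, AlgHom.commutes]
      rfl
    · rw [D.component_grading.ne _ _ (by omega) _ (D.mul_mem_component hb ha),
        D.aug_component hn b hb, zero_smul]
  · simp only [add_mul, map_add, add_smul, hx, hy]

/-- The disjunction treats both sides at once: one factor is left alone and the other is projected
to its components. -/
theorem isPartialProj_of_map {f g : ℕ → D.Alg →ₗ[k] D.Alg}
    (hf : (∀ n, f n = LinearMap.id) ∧ g = D.componentProj ∨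
      (∀ n, g n = LinearMap.id) ∧ f = D.componentProj) :
    D.IsPartialProj fun q => Env.map (f q) (g q) where
  same q x := by
    induction x using Env.induction with
    | zero => simp
    | tmul a b =>
      rcases hf with ⟨hf, rfl⟩ | ⟨hf, rfl⟩ <;> simp [hf, D.component_grading.proj_proj]
    | add x y hx hy => simp only [map_add, hx, hy]
  ne q r x h := by
    induction x using Env.induction with
    | zero => simp
    | tmul a b =>
      rcases hf with ⟨hf, rfl⟩ | ⟨hf, rfl⟩ <;> simp [hf, D.component_grading.proj_proj_ne h]
    | add x y hx hy => simp only [map_add, hx, hy, add_zero]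
  mem n q x hx := by
    induction hx using Submodule.span_induction with
    | mem x hx =>
      obtain ⟨i, j, rfl, a, ha, b, hb, rfl⟩ := hx
      have key : ∀ m, ∀ a ∈ D.component m, D.componentProj q a ∈ D.component m := by
        intro m a ha
        by_cases h : m = q
        · rwa [← h, D.component_grading.same _ _ ha]
        · rw [D.component_grading.ne _ _ h _ ha]; exact Submodule.zero_mem _
      rw [Env.map_tmul]
      refine D.tmul_mem_envGrading (p := i) (q := j) ?_ ?_ rfl
      · rcases hf with ⟨hf, rfl⟩ | ⟨hf, rfl⟩
        · rwa [hf]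
        · exact key i a ha
      · rcases hf with ⟨hf, rfl⟩ | ⟨hf, rfl⟩
        · exact key j b hb
        · rwa [hf]
    | zero => rw [map_zero]; exact Submodule.zero_mem _
    | add x y _ _ hx hy => rw [map_add]; exact Submodule.add_mem _ hx hy
    | smul c x _ hx => rw [map_smul]; exact Submodule.smul_mem _ c hx
  sum n x hx m hm := by
    induction hx using Submodule.span_induction with
    | mem x hx =>
      obtain ⟨i, j, rfl, a, ha, b, hb, rfl⟩ := hx
      have key : ∀ l ≤ m, ∀ a ∈ D.component l,
          a = ∑ q ∈ Finset.range (m + 1), D.componentProj q a := by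
        intro l hl a ha
        rw [Finset.sum_eq_single l, D.component_grading.same _ _ ha]
        · exact fun q _ h => D.component_grading.ne _ _ h.symm _ ha
        · intro h; exact absurd (Finset.mem_range.2 (by omega)) h
      simp only [Env.map_tmul]
      rcases hf with ⟨hf, rfl⟩ | ⟨hf, rfl⟩
      · simp only [hf, LinearMap.id_apply, ← Env.mk_apply, ← map_sum]
        rw [← key j (by omega) b hb]
      · simp only [hf, LinearMap.id_apply, ← Env.mk_apply, ← map_sum, ← LinearMap.sum_apply]
        rw [LinearMap.sum_apply, ← key i (by omega) a ha]
    | zero => simp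
    | add x y _ _ hx hy => simp only [map_add, Finset.sum_add_distrib]; rw [← hx, ← hy]
    | smul c x _ hx => simp only [map_smul, ← Finset.smul_sum]; rw [← hx]

/-- After a letter is removed, the coefficient lies in `B · φ(V)`, which `f` kills. -/
theorem aug_rTensor_mem {B : Type w} [Ring B] [Algebra k B] {f : B →ₗ[k] k} {φ : V →ₗ[k] B}
    (h : ∀ b v, f (b * φ v) = 0) (x : B ⊗[k] TensorAlgebra k V) :
    f.rTensor (TensorAlgebra k V) (peelLeft φ x) = 0 ∧
      f.rTensor (TensorAlgebra k V) (peelRight φ x) = 0 := by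
  constructor
  · refine (peelLeft_rTensor (g := 0) (φ' := 0) (fun b v => ?_) x).trans ?_
    · rw [h]; simp
    · simp
  · refine (peelRight_rTensor (g := 0) (φ' := 0) (fun b v => ?_) x).trans ?_
    · rw [h]; simp
    · simp

theorem lift_opGen (x : TensorAlgebra k V) :
    TensorAlgebra.lift k ((MulOpposite.opLinearEquiv k).toLinearMap ∘ₗ D.opGen) x =
      MulOpposite.op (MulOpposite.op (D.proj x)) := by
  induction x using TensorAlgebra.induction with
  | algebraMap r => rw [AlgHom.commutes, AlgHom.commutes]; rfl
  | ι v => rw [TensorAlgebra.lift_ι_apply]; rfl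
  | mul a b ha hb => rw [map_mul, ha, hb, ← MulOpposite.op_mul, ← MulOpposite.op_mul, map_mul]
  | add a b ha hb => rw [map_add, ha, hb, map_add]; rfl

/-- By flatness over the field, the submodule `B ⊗ J_i` of `B ⊗ T(V)` is isomorphic to the abstract
base change of `J_i`, which is projective. -/
theorem projective_K (B : Type w) [Ring B] [Algebra k B] (i : ℕ) :
    Module.Projective B (D.K B i) := by
  have hinj : Function.Injective ((D.J i).subtype.baseChange B) :=
    Module.Flat.lTensor_preserves_injective_linearMap (M := B) (D.J i).subtype
      (D.J i).subtype_injective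
  have hr : LinearMap.range ((D.J i).subtype.baseChange B) = D.K B i := rfl
  exact Module.Projective.of_equiv
    ((LinearEquiv.ofInjective _ hinj).trans (LinearEquiv.ofEq _ _ hr))

variable [FiniteDimensional k V]

/-- `A^e = A ⊗ Aᵐᵒᵖ` as a free module over the left factor. -/
def leftSide : D.Side D.Alg where
  ins := Env.mk.flip
  sl l := Env.lift ((LinearMap.lsmul k D.Alg).flip.compl₂ l)
  sl_ins l a b := by
    rw [LinearMap.flip_apply, Env.mk_apply, Env.lift_tmul]; rfl
  induction P h hadd e := by
    have h0 : P 0 := by simpa using h 0 0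
    induction e using Env.induction with
    | zero => exact h0
    | tmul a b => exact h b a
    | add x y hx hy => exact hadd x y hx hy
  σ q := Env.map LinearMap.id (D.componentProj q)
  σ_ins q a b := by simp
  isPartialProj := D.isPartialProj_of_map (.inl ⟨fun _ => rfl, rfl⟩)
  aug := D.aug.toLinearMap
  aug_one := map_one D.aug
  leadAug := Env.lift ((LinearMap.lsmul k D.Alg) ∘ₗ D.aug.toLinearMap)
  leadAug_ins a b := by
    rw [LinearMap.flip_apply, Env.mk_apply, Env.lift_tmul]; rfl
  ins_one_smul a := by
    rw [LinearMap.flip_apply, Env.mk_apply, Env.tmul_smul, mul_one, one_mul]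
  smul_lead m q a b hq ha := by
    rw [LinearMap.flip_apply, Env.mk_apply, Env.tmul_smul, mul_one]
    exact D.componentProj_mul_left b hq ha
  μ := peelLeft D.gen
  α := D.deltaL
  β := D.deltaR
  ins_μ a x := by
    refine peelLeft_rTensor (fun b v => ?_) x
    simp only [LinearMap.flip_apply, Env.mk_apply, envLeft, LinearMap.coe_mk, AddHom.coe_mk,
      Env.tmul_mul_tmul, one_mul]
  sl_α l x := by
    refine peelLeft_rTensor (fun e v => ?_) x
    induction e using Env.induction with
    | zero => simp
    | tmul a b =>
      simp only [envLeft, LinearMap.coe_mk, AddHom.coe_mk, Env.tmul_mul_tmul, one_mul,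
        Env.lift_tmul, LinearMap.compl₂_apply, LinearMap.flip_apply, LinearMap.lsmul_apply,
        smul_mul_assoc]
    | add x y hx hy => simp only [add_mul, map_add, hx, hy]
  σ_α q x := by
    refine peelLeft_rTensor (fun e v => ?_) x
    induction e using Env.induction with
    | zero => simp
    | tmul a b =>
      simp only [envLeft, LinearMap.coe_mk, AddHom.coe_mk, Env.tmul_mul_tmul, one_mul,
        Env.map_tmul, LinearMap.id_apply]
    | add x y hx hy => simp only [add_mul, map_add, hx, hy]
  σ_β q x := by
    refine peelRight_rTensor (fun e v => ?_) x
    induction e using Env.induction with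
    | zero => simp
    | tmul a b =>
      simp only [envRight, LinearMap.coe_mk, AddHom.coe_mk, Env.tmul_mul_tmul, mul_one,
        Env.map_tmul, LinearMap.id_apply, componentProj_gen_mul]
    | add x y hx hy => simp only [add_mul, map_add, hx, hy]
  σ_zero_β x := by
    refine (peelRight_rTensor (g := 0) (φ' := 0) (fun e v => ?_) x).trans (by simp)
    induction e using Env.induction with
    | zero => simp
    | tmul a b =>
      simp only [envRight, LinearMap.coe_mk, AddHom.coe_mk, Env.tmul_mul_tmul, mul_one,
        Env.map_tmul, LinearMap.id_apply, componentProj_zero_gen_mul, Env.tmul_zero]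
      simp
    | add x y hx hy => simp only [add_mul, map_add, hx, hy]
  μ_word := peelLeft_word D.gen 0
  α_word := peelLeft_word D.envLeft 0
  μ_lowers _ hs := peelLeft_lowers D.gen hs
  α_lowers _ hs := D.deltaL_lowers hs
  μ_pow s hs m hm := peelLeft_pow_Jbar D.gen hs hm fun r hr => by
    rw [lift_gen, D.proj_eq_zero hs hr]
  aug_μ x _ := (aug_rTensor_mem (fun b v => by
    rw [AlgHom.toLinearMap_apply, map_mul, aug_gen, mul_zero]) x).1
  sgn := 1
  sgn_sq := rfl
  odd_eq := (one_smul _ _).symm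
  even_eq _ := rfl

/-- `A^e = A ⊗ Aᵐᵒᵖ` as a free module over the right factor. -/
def rightSide : D.Side D.Algᵐᵒᵖ where
  ins := Env.mk.compl₂ (MulOpposite.opLinearEquiv k).symm.toLinearMap
  sl l := Env.lift ((LinearMap.lsmul k D.Algᵐᵒᵖ ∘ₗ l).compl₂
    (MulOpposite.opLinearEquiv k).toLinearMap)
  sl_ins l a b := by
    rw [LinearMap.compl₂_apply, Env.mk_apply, Env.lift_tmul]; rfl
  induction P h hadd e := by
    have h0 : P 0 := by simpa using h 0 0
    induction e using Env.induction with
    | zero => exact h0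
    | tmul a b => exact h a (MulOpposite.op b)
    | add x y hx hy => exact hadd x y hx hy
  σ q := Env.map (D.componentProj q) LinearMap.id
  σ_ins q a b := by simp
  isPartialProj := D.isPartialProj_of_map (.inr ⟨fun _ => rfl, rfl⟩)
  aug := D.aug.toLinearMap ∘ₗ (MulOpposite.opLinearEquiv k).symm.toLinearMap
  aug_one := map_one D.aug
  leadAug := Env.lift ((LinearMap.lsmul k D.Alg).flip.compl₂ D.aug.toLinearMap)
  leadAug_ins a b := by
    rw [LinearMap.compl₂_apply, Env.mk_apply, Env.lift_tmul]; rfl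
  ins_one_smul a := by
    rw [LinearMap.compl₂_apply, Env.mk_apply, Env.tmul_smul, mul_one]
    exact mul_one a
  smul_lead m q a b hq ha := by
    rw [LinearMap.compl₂_apply, Env.mk_apply, Env.tmul_smul, mul_one]
    exact D.componentProj_mul_right b.unop hq ha
  μ := peelRight D.opGen
  α := D.deltaR
  β := D.deltaL
  ins_μ a x := by
    refine peelRight_rTensor (fun b v => ?_) x
    simp only [LinearMap.compl₂_apply, Env.mk_apply, envRight, LinearMap.coe_mk, AddHom.coe_mk,
      Env.tmul_mul_tmul, mul_one]
    rfl
  sl_α l x := by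
    refine peelRight_rTensor (fun e v => ?_) x
    induction e using Env.induction with
    | zero => simp
    | tmul a b =>
      simp only [envRight, LinearMap.coe_mk, AddHom.coe_mk, Env.tmul_mul_tmul, mul_one,
        Env.lift_tmul, LinearMap.compl₂_apply, LinearMap.comp_apply, LinearMap.lsmul_apply,
        smul_mul_assoc]
      rfl
    | add x y hx hy => simp only [add_mul, map_add, hx, hy]
  σ_α q x := by
    refine peelRight_rTensor (fun e v => ?_) x
    induction e using Env.induction with
    | zero => simp
    | tmul a b =>
      simp only [envRight, LinearMap.coe_mk, AddHom.coe_mk, Env.tmul_mul_tmul, mul_one,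
        Env.map_tmul, LinearMap.id_apply]
    | add x y hx hy => simp only [add_mul, map_add, hx, hy]
  σ_β q x := by
    refine peelLeft_rTensor (fun e v => ?_) x
    induction e using Env.induction with
    | zero => simp
    | tmul a b =>
      simp only [envLeft, LinearMap.coe_mk, AddHom.coe_mk, Env.tmul_mul_tmul, one_mul,
        Env.map_tmul, LinearMap.id_apply, componentProj_mul_gen]
    | add x y hx hy => simp only [add_mul, map_add, hx, hy]
  σ_zero_β x := by
    refine (peelLeft_rTensor (g := 0) (φ' := 0) (fun e v => ?_) x).trans (by simp)
    induction e using Env.induction with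
    | zero => simp
    | tmul a b =>
      simp only [envLeft, LinearMap.coe_mk, AddHom.coe_mk, Env.tmul_mul_tmul, one_mul,
        Env.map_tmul, LinearMap.id_apply, componentProj_zero_mul_gen, Env.zero_tmul]
      simp
    | add x y hx hy => simp only [add_mul, map_add, hx, hy]
  μ_word := peelRight_word D.opGen 0
  α_word := peelRight_word D.envRight 0
  μ_lowers _ hs := peelRight_lowers D.opGen hs
  α_lowers _ hs := D.deltaR_lowers hs
  μ_pow s hs m hm := peelRight_pow_Jbar D.opGen hs hm fun r hr => by
    rw [lift_opGen, D.proj_eq_zero hs hr]; rfl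
  aug_μ x _ := (aug_rTensor_mem (fun b v => by
    change D.aug (D.gen v * b.unop) = 0
    rw [map_mul, aug_gen, zero_mul]) x).2
  sgn := -1
  sgn_sq := rfl
  odd_eq := by rw [neg_one_smul, neg_sub]
  even_eq s := by
    -- Exchanging the two operators reverses the summation, and commutativity restores the order of
    -- the factors.
    rw [← Finset.sum_range_reflect]
    refine Finset.sum_congr rfl fun j hj => ?_
    have := Finset.mem_range.1 hj
    rw [show s - 1 - (s - 1 - j) = j by omega]
    exact (D.deltaL_commute_deltaR.pow_pow _ _).eq

theorem isExactAugmented_iff_left :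
    IsExactAugmented (C := fun i => D.K (Env k D.Alg) i)
        (fun i => (D.bimoduleDiff i).toAddMonoidHom) D.bimoduleAug.toAddMonoidHom ↔
      D.IsLeftMultiKoszul := by
  refine (D.leftSide.isExactAugmented_iff (ε := D.leftAug.toAddMonoidHom) fun b => ?_).trans
    ⟨fun h => ⟨D.projective_K D.Alg, h⟩, fun h => h.exact⟩
  change LinearMap.mul' k k (TensorProduct.map _ _ (b ⊗ₜ 1)) = _
  rw [TensorProduct.map_tmul, LinearMap.mul'_apply, AlgHom.toLinearMap_apply,
    AlgHom.toLinearMap_apply, map_one, mul_one]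
  rfl

theorem isExactAugmented_iff_right :
    IsExactAugmented (C := fun i => D.K (Env k D.Alg) i)
        (fun i => (D.bimoduleDiff i).toAddMonoidHom) D.bimoduleAug.toAddMonoidHom ↔
      D.IsRightMultiKoszul := by
  refine (D.rightSide.isExactAugmented_iff (ε := D.rightAug.toAddMonoidHom) fun b => ?_).trans
    ⟨fun h => ⟨D.projective_K D.Algᵐᵒᵖ, h⟩, fun h => h.exact⟩
  change LinearMap.mul' k k (TensorProduct.map _ _ (b ⊗ₜ 1)) = _
  rw [TensorProduct.map_tmul, LinearMap.mul'_apply, AlgHom.toLinearMap_apply, map_one, mul_one]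
  rfl

end Relations

namespace Relations

variable {k : Type u} [Field k] {V : Type v} [AddCommGroup V] [Module k V] (D : Relations k V)

/-! ## Minimality -/

theorem algGrading_nat (n : ℕ) : D.algGrading n = D.component n := by
  refine le_antisymm (iSup₂_le fun p hp => ?_) ?_
  · rw [Nat.cast_inj.1 hp]
  · exact le_iSup₂_of_le n rfl le_rfl

theorem algGrading_neg {n : ℤ} (hn : n < 0) : D.algGrading n = ⊥ :=
  le_bot_iff.1 (iSup₂_le fun p hp => by omega)

theorem isGradedModule_alg : IsGradedModule D.envGrading D.algGrading where
  isInternal := D.component_grading.isInternal_int _ D.algGrading_nat fun _ => D.algGrading_neg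
  smul_mem p n e he a ha := by
    rcases lt_or_ge n 0 with hn | hn
    · rw [D.algGrading_neg hn, Submodule.mem_bot] at ha
      rw [ha, smul_zero]; exact Submodule.zero_mem _
    · lift n to ℕ using hn
      rw [algGrading_nat] at ha
      rw [← Nat.cast_add, algGrading_nat]
      exact env_smul_mem he ha

theorem mem_bimoduleGrading_nat {i n : ℕ} {x : D.K (Env k D.Alg) i} :
    x ∈ D.bimoduleGrading i n ↔ x.1 ∈ D.totalGrading n := by
  simp only [bimoduleGrading, totalGrading, tensorGrading, ← Nat.cast_add, Nat.cast_inj]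
  rfl

theorem bimoduleGrading_neg {i : ℕ} {n : ℤ} (hn : n < 0) : D.bimoduleGrading i n = ⊥ := by
  rw [bimoduleGrading, show {x : Env k D.Alg ⊗[k] TensorAlgebra k V | ∃ p q : ℕ, (p : ℤ) + q = n ∧
    ∃ e ∈ D.envGrading p, ∃ w ∈ word k V q, x = e ⊗ₜ[k] w} = ∅ from ?_, Submodule.span_empty]
  · exact le_bot_iff.1 fun x hx => (Submodule.mem_bot k).2 (Subtype.ext hx)
  · refine Set.eq_empty_of_forall_notMem ?_
    rintro x ⟨p, q, h, -⟩
    omega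

theorem K_grading (i : ℕ) : Grading (fun n : ℕ => D.bimoduleGrading i n)
    (fun n => (D.totalProj n).restrict (p := (D.K (Env k D.Alg) i).restrictScalars k)
      (q := (D.K (Env k D.Alg) i).restrictScalars k) (totalProj_mem_K i n)) := by
  have h := D.total_grading.restrict ((D.K (Env k D.Alg) i).restrictScalars k) (totalProj_mem_K i)
  refine ⟨fun n x hx => h.same n x (D.mem_bimoduleGrading_nat.1 hx),
    fun m n hmn x hx => h.ne m n hmn x (D.mem_bimoduleGrading_nat.1 hx), ?_⟩
  have heq : (fun n : ℕ => D.bimoduleGrading i n) = fun n => (D.totalGrading n).comap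
      ((D.K (Env k D.Alg) i).restrictScalars k).subtype :=
    funext fun n => Submodule.ext fun x => D.mem_bimoduleGrading_nat
  rw [heq]
  exact h.top

theorem isGradedModule_K (i : ℕ) : IsGradedModule D.envGrading (D.bimoduleGrading i) where
  isInternal := (D.K_grading i).isInternal_int _ (fun _ => rfl) fun _ => D.bimoduleGrading_neg
  smul_mem p n e he x hx := by
    rcases lt_or_ge n 0 with hn | hn
    · rw [D.bimoduleGrading_neg hn, Submodule.mem_bot] at hx
      rw [hx, smul_zero]; exact Submodule.zero_mem _
    · lift n to ℕ using hn
      rw [← Nat.cast_add]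
      exact D.mem_bimoduleGrading_nat.2
        (D.smul_mem_totalGrading he (D.mem_bimoduleGrading_nat.1 hx))

/-- The augmentation of `A^e`. -/
def envAug : Env k D.Alg →ₗ[k] k := Env.lift ((LinearMap.mul k k).compl₁₂ D.aug.toLinearMap
  D.aug.toLinearMap)

theorem envAug_tmul (a b : D.Alg) : D.envAug (Env.tmul a b) = D.aug a * D.aug b := by
  rw [envAug, Env.lift_tmul]; rfl

theorem envAug_of_pos {n : ℕ} (hn : n ≠ 0) {e : Env k D.Alg} (he : e ∈ D.envGrading n) :
    D.envAug e = 0 := by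
  induction he using Submodule.span_induction with
  | mem x hx =>
    obtain ⟨p, q, rfl, a, ha, b, hb, rfl⟩ := hx
    rw [envAug_tmul]
    by_cases hp : p = 0
    · rw [D.aug_component (by omega) b hb, mul_zero]
    · rw [D.aug_component hp a ha, zero_mul]
  | zero => exact map_zero _
  | add x y _ _ hx hy => rw [map_add, hx, hy, add_zero]
  | smul c x _ hx => rw [map_smul, hx, smul_zero]

theorem env_scalar_of_zero {e : Env k D.Alg} (he : e ∈ D.envGrading 0) :
    ∃ c : k, e = c • (1 : Env k D.Alg) := by
  induction he using Submodule.span_induction with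
  | mem x hx =>
    obtain ⟨p, q, hpq, a, ha, b, hb, rfl⟩ := hx
    obtain ⟨rfl, rfl⟩ : p = 0 ∧ q = 0 := by omega
    obtain ⟨c, rfl⟩ := D.component_zero_eq a ha
    obtain ⟨c', rfl⟩ := D.component_zero_eq b hb
    refine ⟨c * c', ?_⟩
    rw [Algebra.algebraMap_eq_smul_one, Algebra.algebraMap_eq_smul_one, ← Env.smul_tmul,
      ← Env.smul_tmul_right, smul_smul]
    rfl
  | zero => exact ⟨0, (zero_smul _ _).symm⟩
  | add x y _ _ hx hy =>
    obtain ⟨c, rfl⟩ := hx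
    obtain ⟨c', rfl⟩ := hy
    exact ⟨c + c', (add_smul _ _ _).symm⟩
  | smul c x _ hx =>
    obtain ⟨c', rfl⟩ := hx
    exact ⟨c * c', smul_smul _ _ _⟩

theorem envAug_rTensor_smul {n : ℕ} (hn : n ≠ 0) {e : Env k D.Alg} (he : e ∈ D.envGrading n)
    (x : Env k D.Alg ⊗[k] TensorAlgebra k V) : D.envAug.rTensor (TensorAlgebra k V) (e • x) = 0 := by
  induction x using TensorProduct.induction_on with
  | zero => simp
  | add x y hx hy => rw [smul_add, map_add, hx, hy, add_zero]
  | tmul e' w =>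
    rw [TensorProduct.smul_tmul', LinearMap.rTensor_tmul, smul_eq_mul]
    have : D.envAug (e * e') = 0 := by
      refine D.env_grading.induction e' (fun m e' he' => ?_) (fun x y hx hy => ?_)
      · exact D.envAug_of_pos (by omega) (D.envGrading_mul he he')
      · rw [mul_add, map_add, hx, hy, add_zero]
    rw [this, TensorProduct.zero_tmul]

/-- The graded radical `A^e_{>0} (A^e ⊗ J_i)`. -/
def radical (i : ℕ) : Submodule k (D.K (Env k D.Alg) i) :=
  Submodule.span k {y | ∃ p ≠ 0, ∃ e ∈ D.envGrading p, ∃ x : D.K (Env k D.Alg) i, y = e • x}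

/-- Since `A^e` has only scalars in degree zero, `A^e ⊗ J_i` is the sum of `1 ⊗ J_i` and the
radical. The augmentation kills the radical and is injective on `1 ⊗ J_i`. -/
theorem mem_radical {i : ℕ} (x : D.K (Env k D.Alg) i)
    (hx : D.envAug.rTensor (TensorAlgebra k V) x.1 = 0) : x ∈ D.radical i := by
  have key : ∀ x : D.K (Env k D.Alg) i, ∃ w, ∃ hw : w ∈ D.J i,
      x - ⟨1 ⊗ₜ w, Submodule.tmul_mem_baseChange_of_mem _ hw⟩ ∈ D.radical i := by
    rintro ⟨x, hx⟩
    have : ∃ w, ∃ hw : w ∈ D.J i, ∃ y ∈ D.radical i, x = 1 ⊗ₜ w + y.1 := by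
      refine baseChange_induction x hx (fun e w hw => ?_) ?_
      · refine D.env_grading.induction e (fun n e he => ?_) ?_
        · by_cases hn : n = 0
          · subst hn
            obtain ⟨c, rfl⟩ := D.env_scalar_of_zero he
            refine ⟨c • w, Submodule.smul_mem _ c hw, 0, Submodule.zero_mem _, ?_⟩
            rw [TensorProduct.smul_tmul]
            simp
          · refine ⟨0, Submodule.zero_mem _, e • ⟨1 ⊗ₜ w, Submodule.tmul_mem_baseChange_of_mem _ hw⟩,
              Submodule.subset_span ⟨n, hn, e, he, _, rfl⟩, ?_⟩
            rw [TensorProduct.tmul_zero, zero_add, Submodule.coe_smul, TensorProduct.smul_tmul',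
              smul_eq_mul, mul_one]
        · rintro x y ⟨w, hw, y, hy, h⟩ ⟨w', hw', y', hy', h'⟩
          refine ⟨w + w', Submodule.add_mem _ hw hw', y + y', Submodule.add_mem _ hy hy', ?_⟩
          rw [TensorProduct.add_tmul, h, h', TensorProduct.tmul_add, Submodule.coe_add]
          abel
      · rintro x y ⟨w, hw, y, hy, h⟩ ⟨w', hw', y', hy', h'⟩
        refine ⟨w + w', Submodule.add_mem _ hw hw', y + y', Submodule.add_mem _ hy hy', ?_⟩
        rw [h, h', TensorProduct.tmul_add, Submodule.coe_add]
        abel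
    obtain ⟨w, hw, y, hy, h⟩ := this
    refine ⟨w, hw, ?_⟩
    convert hy
    refine Subtype.ext ?_
    exact sub_eq_of_eq_add' h
  have hrad : ∀ y ∈ D.radical i, D.envAug.rTensor (TensorAlgebra k V) y.1 = 0 := by
    intro y hy
    induction hy using Submodule.span_induction with
    | mem y hy =>
      obtain ⟨p, hp, e, he, x, rfl⟩ := hy
      exact D.envAug_rTensor_smul hp he x.1
    | zero => exact map_zero _
    | add x y _ _ hx hy => rw [Submodule.coe_add, map_add, hx, hy, add_zero]
    | smul c x _ hx => rw [Submodule.coe_smul_of_tower, map_smul, hx, smul_zero]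
  obtain ⟨w, hw, h⟩ := key x
  have h1 := hrad _ h
  rw [Submodule.coe_sub, map_sub, hx, zero_sub, neg_eq_zero, LinearMap.rTensor_tmul, Env.one_def,
    envAug_tmul, map_one, mul_one] at h1
  have h2 : w = 0 := by simpa using congrArg (TensorProduct.lid k (TensorAlgebra k V)) h1
  subst h2
  convert h
  refine Subtype.ext ?_
  exact (sub_zero _).symm.trans (congrArg (x.1 - ·) (TensorProduct.tmul_zero _ _).symm)

theorem totalProj_smul {p : ℕ} {e : Env k D.Alg} (he : e ∈ D.envGrading p) (n : ℕ)
    (x : Env k D.Alg ⊗[k] TensorAlgebra k V) :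
    D.totalProj n (e • x) = if p ≤ n then e • D.totalProj (n - p) x else 0 := by
  refine D.total_grading.induction x (fun m x hx => ?_) (fun x y hx hy => ?_)
  · have h := D.smul_mem_totalGrading he hx
    split_ifs with hpn
    · by_cases hm : p + m = n
      · subst hm
        rw [D.total_grading.same _ _ h, show p + m - p = m by omega, D.total_grading.same _ _ hx]
      · rw [D.total_grading.ne _ _ hm _ h, D.total_grading.ne m _ (by omega) _ hx, smul_zero]
    · rw [D.total_grading.ne _ _ (by omega) _ h]
  · rw [smul_add, map_add, hx, hy, map_add]
    split_ifs <;> simp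

/-- The graded Nakayama lemma. -/
theorem isEssentialOnto {i : ℕ} {N : Type (max u v)} [AddCommGroup N] [Module (Env k D.Alg) N]
    (f : D.K (Env k D.Alg) i →ₗ[Env k D.Alg] N) (P : Submodule (Env k D.Alg) N)
    (hP : LinearMap.range f = P) (hf : ∀ x, f x = 0 → x ∈ D.radical i) :
    IsEssentialOnto D.envGrading (D.bimoduleGrading i) f P := by
  refine ⟨hP, fun X _ _ _ _ 𝒳 h𝒳 g hg hgP => ?_⟩
  -- As `g` is homogeneous, its range contains the homogeneous components of each of its elements.
  have hcomp : ∀ (n : ℕ) x, ∃ x', g x' = IsPartialProj.totalK D i n (g x) := by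
    intro n x
    have hx : x ∈ ⨆ j, 𝒳 j := h𝒳.isInternal.submodule_iSup_eq_top ▸ Submodule.mem_top
    induction hx using Submodule.iSup_induction' with
    | mem j x hx =>
      have hgx := hg j x hx
      rcases lt_or_ge j 0 with hj | hj
      · rw [D.bimoduleGrading_neg hj, Submodule.mem_bot] at hgx
        exact ⟨0, by rw [map_zero, hgx, map_zero]⟩
      · lift j to ℕ using hj
        by_cases hjn : j = n
        · subst hjn
          exact ⟨x, ((D.K_grading i).same _ _ hgx).symm⟩
        · exact ⟨0, (map_zero g).trans ((D.K_grading i).ne _ _ hjn _ hgx).symm⟩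
    | zero => exact ⟨0, by simp⟩
    | add x y _ _ hx hy =>
      obtain ⟨x', hx'⟩ := hx
      obtain ⟨y', hy'⟩ := hy
      exact ⟨x' + y', by rw [map_add, map_add, map_add, hx', hy']⟩
  -- Strong induction on the degree, possible because the grading vanishes in negative degrees.
  have key : ∀ n : ℕ, ∀ m ∈ D.bimoduleGrading i n, m ∈ LinearMap.range g := by
    intro n
    induction n using Nat.strong_induction_on with
    | _ n ih =>
      intro m hm
      have hfm : f m ∈ LinearMap.range (f ∘ₗ g) := by
        rw [hgP, ← hP]; exact LinearMap.mem_range_self f m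
      obtain ⟨x, hx⟩ := hfm
      have hrad := hf (m - g x) (by rw [map_sub, ← hx]; exact sub_self _)
      -- In degree `n` the radical is spanned by products of a positive-degree element with an
      -- element of smaller degree, already known to be in the range.
      have hN : ∀ y ∈ D.radical i, IsPartialProj.totalK D i n y ∈ LinearMap.range g := by
        intro y hy
        induction hy using Submodule.span_induction with
        | mem y hy =>
          obtain ⟨p, hp, e, he, x, rfl⟩ := hy
          by_cases hpn : p ≤ n
          · have h1 : IsPartialProj.totalK D i n (e • x) =
                e • IsPartialProj.totalK D i (n - p) x :=
              Subtype.ext ((D.totalProj_smul he n x.1).trans (if_pos hpn))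
            rw [h1]
            exact Submodule.smul_mem _ e
              (ih (n - p) (by omega) _ ((D.K_grading i).proj_mem (n - p) x))
          · have h1 : IsPartialProj.totalK D i n (e • x) = 0 :=
              Subtype.ext ((D.totalProj_smul he n x.1).trans (if_neg hpn))
            rw [h1]
            exact Submodule.zero_mem _
        | zero => rw [map_zero]; exact Submodule.zero_mem _
        | add x y _ _ hx hy => rw [map_add]; exact Submodule.add_mem _ hx hy
        | smul c x _ hx =>
          have h1 : IsPartialProj.totalK D i n (c • x) = c • IsPartialProj.totalK D i n x :=
            Subtype.ext (map_smul (D.totalProj n) c x.1)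
          rw [h1]
          exact Submodule.smul_of_tower_mem _ c hx
      -- Taking degree `n` of `m - g x` leaves `m` minus the degree `n` component of `g x`, and that
      -- component is in the range too.
      have h := hN _ hrad
      obtain ⟨x', hx'⟩ := hcomp n x
      rw [map_sub, ← hx', show IsPartialProj.totalK D i n m = m from (D.K_grading i).same n m hm] at h
      have := Submodule.add_mem _ h (LinearMap.mem_range_self g x')
      rwa [sub_add_cancel] at this
  intro m
  refine (D.K_grading i).induction (P := fun m => m ∈ LinearMap.range g) m key
    fun x y hx hy => Submodule.add_mem _ hx hy

theorem envAug_peel (x : Env k D.Alg ⊗[k] TensorAlgebra k V) :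
    D.envAug.rTensor (TensorAlgebra k V) (D.deltaL x) = 0 ∧
      D.envAug.rTensor (TensorAlgebra k V) (D.deltaR x) = 0 := by
  refine ⟨(aug_rTensor_mem (fun e v => ?_) x).1, (aug_rTensor_mem (fun e v => ?_) x).2⟩
  · induction e using Env.induction with
    | zero => simp
    | tmul a b => simp [envLeft, Env.tmul_mul_tmul, envAug_tmul, aug_gen]
    | add x y hx hy => rw [add_mul, map_add, hx, hy, add_zero]
  · induction e using Env.induction with
    | zero => simp
    | tmul a b => simp [envRight, Env.tmul_mul_tmul, envAug_tmul, aug_gen]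
    | add x y hx hy => rw [add_mul, map_add, hx, hy, add_zero]

variable [FiniteDimensional k V]

/-- Every summand of the differential removes a letter, which multiplies the coefficient by a
generator and so is killed by the augmentation. -/
theorem bimoduleDiff_mem_radical (i : ℕ) (x : D.K (Env k D.Alg) (i + 1)) :
    D.bimoduleDiff i x ∈ D.radical i := by
  refine D.mem_radical _ ?_
  refine (hat_rTensor (D := D) D.envAug (odd' := 0) (even' := 0) (fun x => ?_) (fun s hs x => ?_)
    (i + 1) x.1).trans ?_
  · rw [LinearMap.sub_apply, map_sub, (D.envAug_peel x).1, (D.envAug_peel x).2, sub_self]; rfl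
  · rw [LinearMap.sum_apply, map_sum]
    refine Finset.sum_eq_zero fun j hj => ?_
    have h2 := D.two_le s hs
    -- For `j = 0` the letter is removed by `δ'_R`, whose exponent `s - 1` is positive because `s ≥
    -- 2`; otherwise `δ'_L` acts last.
    by_cases hj0 : j = 0
    · subst hj0
      rw [pow_zero, one_mul, show s - 1 - 0 = s - 2 + 1 by omega, pow_succ', Module.End.mul_apply,
        (D.envAug_peel _).2]
    · obtain ⟨j, rfl⟩ := Nat.exists_eq_succ_of_ne_zero hj0
      rw [pow_succ', mul_assoc, Module.End.mul_apply, (D.envAug_peel _).1]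
  · unfold hat
    split_ifs <;> simp

theorem isMinimalGradedProjectiveResolution
    (h : IsExactAugmented (C := fun i => D.K (Env k D.Alg) i)
        (fun i => (D.bimoduleDiff i).toAddMonoidHom) D.bimoduleAug.toAddMonoidHom) :
    IsMinimalGradedProjectiveResolution D.envGrading (C := fun i => D.K (Env k D.Alg) i)
      D.bimoduleGrading D.algGrading D.bimoduleDiff D.bimoduleAug where
  graded_target := D.isGradedModule_alg
  graded := D.isGradedModule_K
  left_bounded i := ⟨0, fun n => D.bimoduleGrading_neg⟩
  projective := D.projective_K _
  ε_homogeneous n x hx := by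
    rcases lt_or_ge n 0 with hn | hn
    · rw [D.bimoduleGrading_neg hn, Submodule.mem_bot] at hx
      rw [hx, map_zero]; exact Submodule.zero_mem _
    · lift n to ℕ using hn
      rw [algGrading_nat, D.component_grading.mem_iff]
      have h1 := D.leftSide.isLeadingPart_aug.homogeneous n x
      rwa [show IsPartialProj.totalK D 0 n x = x from (D.K_grading 0).same n x hx] at h1
  d_homogeneous i n x hx := by
    rcases lt_or_ge n 0 with hn | hn
    · rw [D.bimoduleGrading_neg hn, Submodule.mem_bot] at hx
      rw [hx, map_zero]; exact Submodule.zero_mem _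
    · lift n to ℕ using hn
      have h1 := (D.leftSide.isLeadingPart i).homogeneous n x
      rw [show IsPartialProj.totalK D (i + 1) n x = x from (D.K_grading _).same n x hx] at h1
      exact (D.K_grading i).mem_iff.2 h1
  exact := h
  -- Exactness identifies this kernel with the image of the next differential, hence places it in
  -- the radical; the same holds for the other two surjections.
  essential_ε := D.isEssentialOnto _ _ (LinearMap.range_eq_top.2 D.bimoduleAug_surjective) fun x hx => by
    obtain ⟨y, rfl⟩ := (h.exact_zero x).1 hx
    exact D.bimoduleDiff_mem_radical 0 y
  essential_zero := D.isEssentialOnto _ _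
    (Submodule.ext fun x => (h.exact_zero x).symm) fun x hx => by
      obtain ⟨y, rfl⟩ := (h.exact_succ 0 x).1 hx
      exact D.bimoduleDiff_mem_radical 1 y
  essential_succ i := D.isEssentialOnto _ _
    (Submodule.ext fun x => (h.exact_succ i x).symm) fun x hx => by
      obtain ⟨y, rfl⟩ := (h.exact_succ (i + 1) x).1 hx
      exact D.bimoduleDiff_mem_radical (i + 2) y

end Relations

/-! ## Comparison of projective resolutions -/

section Comparison

variable {R : Type*} [Ring R]

theorem exists_lift {P Q₀ Q₁ Q₂ : Type*} [AddCommGroup P] [AddCommGroup Q₀] [AddCommGroup Q₁]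
    [AddCommGroup Q₂] [Module R P] [Module R Q₀] [Module R Q₁] [Module R Q₂] [Module.Projective R P]
    (d₂ : Q₂ →ₗ[R] Q₁) (d₁ : Q₁ →ₗ[R] Q₀) (hd : ∀ x, d₁ x = 0 → ∃ y, d₂ y = x)
    (g : P →ₗ[R] Q₁) (hg : ∀ x, d₁ (g x) = 0) : ∃ f : P →ₗ[R] Q₂, d₂ ∘ₗ f = g := by
  obtain ⟨f, hf⟩ := Module.projective_lifting_property d₂.rangeRestrict
    (g.codRestrict (LinearMap.range d₂) fun x => hd _ (hg x)) d₂.surjective_rangeRestrict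
  refine ⟨f, LinearMap.ext fun x => ?_⟩
  exact congrArg Subtype.val (LinearMap.congr_fun hf x)

variable {P Q : ℕ → Type*} [∀ n, AddCommGroup (P n)] [∀ n, AddCommGroup (Q n)]
  [∀ n, Module R (P n)] [∀ n, Module R (Q n)] {M : Type*} [AddCommGroup M] [Module R M]
  {dP : ∀ n, P (n + 1) →ₗ[R] P n} {dQ : ∀ n, Q (n + 1) →ₗ[R] Q n}
  {εP : P 0 →ₗ[R] M} {εQ : Q 0 →ₗ[R] M}

theorem exists_chain_map [∀ n, Module.Projective R (P n)]
    (hP : IsExactAugmented (fun n => (dP n).toAddMonoidHom) εP.toAddMonoidHom)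
    (hQ : IsExactAugmented (fun n => (dQ n).toAddMonoidHom) εQ.toAddMonoidHom) :
    ∃ f : ∀ n, P n →ₗ[R] Q n, εQ ∘ₗ f 0 = εP ∧ ∀ n, dQ n ∘ₗ f (n + 1) = f n ∘ₗ dP n := by
  obtain ⟨f₀, hf₀⟩ := Module.projective_lifting_property εQ εP hQ.surjective
  have h₁ : ∃ f₁, dQ 0 ∘ₗ f₁ = f₀ ∘ₗ dP 0 :=
    exists_lift _ εQ (fun x => (hQ.exact_zero x).1) _ fun x =>
      (LinearMap.congr_fun hf₀ _).trans ((hP.exact_zero _).2 ⟨x, rfl⟩)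
  have hs : ∀ n (f : P n →ₗ[R] Q n) (f' : P (n + 1) →ₗ[R] Q (n + 1)),
      dQ n ∘ₗ f' = f ∘ₗ dP n → ∃ f'', dQ (n + 1) ∘ₗ f'' = f' ∘ₗ dP (n + 1) := fun n f f' h =>
    exists_lift _ (dQ n) (fun x => (hQ.exact_succ n x).1) _ fun x =>
      (LinearMap.congr_fun h _).trans
        ((congrArg f ((hP.exact_succ n _).2 ⟨x, rfl⟩)).trans (map_zero f))
  choose f₁ hf₁ using h₁
  choose next hnext using hs
  -- The next map depends on the last two maps and on their commutation, so the recursion carries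
  -- this pair with its proof.
  let st : ∀ n, {p : (P n →ₗ[R] Q n) × (P (n + 1) →ₗ[R] Q (n + 1)) //
      dQ n ∘ₗ p.2 = p.1 ∘ₗ dP n} := fun n => Nat.rec ⟨(f₀, f₁), hf₁⟩
    (fun n p => ⟨(p.1.2, next n p.1.1 p.1.2 p.2), hnext n p.1.1 p.1.2 p.2⟩) n
  exact ⟨fun n => (st n).1.1, hf₀, fun n => (st n).2⟩

/-- A chain map between resolutions that is zero on the resolved module is null-homotopic. -/
theorem exists_homotopy [∀ n, Module.Projective R (P n)]
    (hP : ∀ n x, dP n (dP (n + 1) x) = 0)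
    (hQ : IsExactAugmented (fun n => (dQ n).toAddMonoidHom) εQ.toAddMonoidHom)
    (f : ∀ n, P n →ₗ[R] Q n) (h₀ : εQ ∘ₗ f 0 = 0) (hf : ∀ n, dQ n ∘ₗ f (n + 1) = f n ∘ₗ dP n) :
    ∃ h : ∀ n, P n →ₗ[R] Q (n + 1), dQ 0 ∘ₗ h 0 = f 0 ∧
      ∀ n, dQ (n + 1) ∘ₗ h (n + 1) + h n ∘ₗ dP n = f (n + 1) := by
  obtain ⟨g₀, hg₀⟩ := exists_lift (dQ 0) εQ (fun x => (hQ.exact_zero x).1) (f 0)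
    fun x => LinearMap.congr_fun h₀ x
  have h₁ : ∃ g₁, dQ 1 ∘ₗ g₁ + g₀ ∘ₗ dP 0 = f 1 := by
    -- What remains of `f 1` after subtracting `g₀ ∘ dP 0` is killed by `dQ 0`, hence lifts through
    -- `dQ 1`; higher degrees repeat this.
    obtain ⟨g₁, hg₁⟩ := exists_lift (dQ 1) (dQ 0) (fun x => (hQ.exact_succ 0 x).1)
      (f 1 - g₀ ∘ₗ dP 0) fun x => by
        have h1 := LinearMap.congr_fun (hf 0) x
        have h2 := LinearMap.congr_fun hg₀ (dP 0 x)
        simp only [LinearMap.comp_apply, LinearMap.sub_apply, map_sub] at h1 h2 ⊢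
        rw [h1, h2, sub_self]
    exact ⟨g₁, by rw [hg₁, sub_add_cancel]⟩
  have hs : ∀ n (g : P n →ₗ[R] Q (n + 1)) (g' : P (n + 1) →ₗ[R] Q (n + 2)),
      dQ (n + 1) ∘ₗ g' + g ∘ₗ dP n = f (n + 1) →
      ∃ g'', dQ (n + 2) ∘ₗ g'' + g' ∘ₗ dP (n + 1) = f (n + 2) := by
    intro n g g' hg
    obtain ⟨g'', hg''⟩ := exists_lift (dQ (n + 2)) (dQ (n + 1)) (fun x => (hQ.exact_succ (n + 1) x).1)
      (f (n + 2) - g' ∘ₗ dP (n + 1)) fun x => by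
        have h1 := LinearMap.congr_fun (hf (n + 1)) x
        have h2 := LinearMap.congr_fun hg (dP (n + 1) x)
        simp only [LinearMap.comp_apply, LinearMap.sub_apply, LinearMap.add_apply, map_sub, hP,
          map_zero, add_zero] at h1 h2 ⊢
        rw [h1, h2, sub_self]
    exact ⟨g'', by rw [hg'', sub_add_cancel]⟩
  choose g₁ hg₁ using h₁
  choose next hnext using hs
  let st : ∀ n, {p : (P n →ₗ[R] Q (n + 1)) × (P (n + 1) →ₗ[R] Q (n + 2)) //
      dQ (n + 1) ∘ₗ p.2 + p.1 ∘ₗ dP n = f (n + 1)} := fun n => Nat.rec ⟨(g₀, g₁), hg₁⟩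
    (fun n p => ⟨(p.1.2, next n p.1.1 p.1.2 p.2), hnext n p.1.1 p.1.2 p.2⟩) n
  exact ⟨fun n => (st n).1.1, hg₀, fun n => (st n).2⟩

/-- Two maps `f`, `g` of complexes such that `g ∘ f` is homotopic to the identity. -/
structure IsHomotopyRetract (dP : ∀ n, P (n + 1) →ₗ[R] P n) (dQ : ∀ n, Q (n + 1) →ₗ[R] Q n)
    (f : ∀ n, P n →ₗ[R] Q n) (g : ∀ n, Q n →ₗ[R] P n) (h : ∀ n, P n →ₗ[R] P (n + 1)) : Prop where
  comm_f : ∀ n, dQ n ∘ₗ f (n + 1) = f n ∘ₗ dP n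
  comm_g : ∀ n, dP n ∘ₗ g (n + 1) = g n ∘ₗ dQ n
  homotopy_zero : dP 0 ∘ₗ h 0 = g 0 ∘ₗ f 0 - LinearMap.id
  homotopy_succ : ∀ n, dP (n + 1) ∘ₗ h (n + 1) + h n ∘ₗ dP n = g (n + 1) ∘ₗ f (n + 1) - LinearMap.id

/-- Lifting the identity of `M` in both directions gives `f` and `g`. Each composite minus the
identity induces zero on `M` and is therefore null-homotopic. -/
theorem exists_isHomotopyRetract [∀ n, Module.Projective R (P n)] [∀ n, Module.Projective R (Q n)]
    (hP : IsExactAugmented (fun n => (dP n).toAddMonoidHom) εP.toAddMonoidHom)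
    (hQ : IsExactAugmented (fun n => (dQ n).toAddMonoidHom) εQ.toAddMonoidHom) :
    ∃ f g h h', IsHomotopyRetract dP dQ f g h ∧ IsHomotopyRetract dQ dP g f h' := by
  obtain ⟨f, hf₀, hf⟩ := exists_chain_map hP hQ
  obtain ⟨g, hg₀, hg⟩ := exists_chain_map hQ hP
  obtain ⟨h, hh₀, hh⟩ := exists_homotopy (dP := dP) (fun n x => (hP.exact_succ n _).2 ⟨x, rfl⟩) hP
    (fun n => g n ∘ₗ f n - LinearMap.id)
    (by rw [LinearMap.comp_sub, ← LinearMap.comp_assoc, hg₀, hf₀, LinearMap.comp_id, sub_self])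
    (fun n => by
      rw [LinearMap.comp_sub, ← LinearMap.comp_assoc, hg, LinearMap.comp_assoc, hf,
        LinearMap.sub_comp, LinearMap.comp_id, LinearMap.id_comp, LinearMap.comp_assoc])
  obtain ⟨h', hh₀', hh'⟩ := exists_homotopy (dP := dQ) (fun n x => (hQ.exact_succ n _).2 ⟨x, rfl⟩)
    hQ (fun n => f n ∘ₗ g n - LinearMap.id)
    (by rw [LinearMap.comp_sub, ← LinearMap.comp_assoc, hf₀, hg₀, LinearMap.comp_id, sub_self])
    (fun n => by
      rw [LinearMap.comp_sub, ← LinearMap.comp_assoc, hf, LinearMap.comp_assoc, hg,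
        LinearMap.sub_comp, LinearMap.comp_id, LinearMap.id_comp, LinearMap.comp_assoc])
  exact ⟨f, g, h, h', ⟨hf, hg, hh₀, hh⟩, ⟨hg, hf, hh₀', hh'⟩⟩

end Comparison

/-! ### Homotopy invariance of homology and cohomology -/

section Homology

variable {k : Type u} [Field k]

section

variable {C : ℕ → Type w} [∀ n, AddCommGroup (C n)] [∀ n, Module k (C n)]
  {C' : ℕ → Type w'} [∀ n, AddCommGroup (C' n)] [∀ n, Module k (C' n)]

/-- The map in homology induced by a map of complexes. -/
def homologyMap {d : ∀ n, C (n + 1) →ₗ[k] C n} {d' : ∀ n, C' (n + 1) →ₗ[k] C' n}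
    (f : ∀ n, C n →ₗ[k] C' n) (hf : ∀ n x, d' n (f (n + 1) x) = f n (d n x)) (n : ℕ) :
    homology d n →ₗ[k] homology d' n :=
  Submodule.mapQ _ _ ((f n).restrict (p := cycles d n) (q := cycles d' n) (by
      rcases n with _ | n
      · exact fun _ _ => Submodule.mem_top
      · intro x hx
        refine LinearMap.mem_ker.2 ?_
        rw [hf, LinearMap.mem_ker.1 hx, map_zero]))
    (by
      rintro x ⟨y, hy⟩
      exact ⟨f (n + 1) y, (hf n y).trans (congrArg (f n) hy)⟩)

/-- Mutually inverse isomorphisms in homology. -/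
theorem nonempty_homology_equiv {d : ∀ n, C (n + 1) →ₗ[k] C n} {d' : ∀ n, C' (n + 1) →ₗ[k] C' n}
    (f : ∀ n, C n →ₗ[k] C' n) (hf : ∀ n x, d' n (f (n + 1) x) = f n (d n x))
    (g : ∀ n, C' n →ₗ[k] C n) (hg : ∀ n x, d n (g (n + 1) x) = g n (d' n x))
    (hgf : ∀ n, ∀ x ∈ cycles d n, g n (f n x) - x ∈ LinearMap.range (d n))
    (hfg : ∀ n, ∀ x ∈ cycles d' n, f n (g n x) - x ∈ LinearMap.range (d' n)) (n : ℕ) :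
    Nonempty (homology d n ≃ₗ[k] homology d' n) := by
  refine ⟨LinearEquiv.ofLinearMap (homologyMap f hf n) (homologyMap g hg n) ?_ ?_⟩
  · refine Submodule.linearMap_qext _ (LinearMap.ext fun x => ?_)
    exact (Submodule.Quotient.eq _).2 (hfg n x.1 x.2)
  · refine Submodule.linearMap_qext _ (LinearMap.ext fun x => ?_)
    exact (Submodule.Quotient.eq _).2 (hgf n x.1 x.2)

/-- The map in cohomology induced by a map of complexes. -/
def cohomologyMap {d : ∀ n, C n →ₗ[k] C (n + 1)} {d' : ∀ n, C' n →ₗ[k] C' (n + 1)}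
    (f : ∀ n, C n →ₗ[k] C' n) (hf : ∀ n x, d' n (f n x) = f (n + 1) (d n x)) (n : ℕ) :
    cohomology d n →ₗ[k] cohomology d' n :=
  Submodule.mapQ _ _ ((f n).restrict (p := LinearMap.ker (d n)) (q := LinearMap.ker (d' n)) (by
      intro x hx
      refine LinearMap.mem_ker.2 ?_
      rw [hf, LinearMap.mem_ker.1 hx, map_zero]))
    (by
      rcases n with _ | n
      · rintro x hx
        refine (Submodule.mem_bot k).2 ?_
        have hx' : x.1 = 0 := (Submodule.mem_bot k).1 hx
        exact (congrArg (f 0) hx').trans (map_zero _)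
      · rintro x ⟨y, hy⟩
        exact ⟨f n y, (hf n y).trans (congrArg (f (n + 1)) hy)⟩)

theorem nonempty_cohomology_equiv {d : ∀ n, C n →ₗ[k] C (n + 1)}
    {d' : ∀ n, C' n →ₗ[k] C' (n + 1)}
    (f : ∀ n, C n →ₗ[k] C' n) (hf : ∀ n x, d' n (f n x) = f (n + 1) (d n x))
    (g : ∀ n, C' n →ₗ[k] C n) (hg : ∀ n x, d n (g n x) = g (n + 1) (d' n x))
    (hgf : ∀ n, ∀ x ∈ LinearMap.ker (d n), g n (f n x) - x ∈ coboundaries d n)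
    (hfg : ∀ n, ∀ x ∈ LinearMap.ker (d' n), f n (g n x) - x ∈ coboundaries d' n) (n : ℕ) :
    Nonempty (cohomology d n ≃ₗ[k] cohomology d' n) := by
  refine ⟨LinearEquiv.ofLinearMap (cohomologyMap f hf n) (cohomologyMap g hg n) ?_ ?_⟩
  · refine Submodule.linearMap_qext _ (LinearMap.ext fun x => ?_)
    exact (Submodule.Quotient.eq _).2 (hfg n x.1 x.2)
  · refine Submodule.linearMap_qext _ (LinearMap.ext fun x => ?_)
    exact (Submodule.Quotient.eq _).2 (hgf n x.1 x.2)

theorem nonempty_homology_equiv_of_equiv {d : ∀ n, C (n + 1) →ₗ[k] C n}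
    {d' : ∀ n, C' (n + 1) →ₗ[k] C' n} (f : ∀ n, C n ≃ₗ[k] C' n)
    (hf : ∀ n x, d' n (f (n + 1) x) = f n (d n x)) (n : ℕ) :
    Nonempty (homology d n ≃ₗ[k] homology d' n) :=
  nonempty_homology_equiv (fun n => (f n).toLinearMap) hf (fun n => (f n).symm.toLinearMap)
    (fun n x => by
      apply (f n).injective
      simp only [LinearEquiv.coe_coe, LinearEquiv.apply_symm_apply, ← hf])
    (fun n x _ => by simp) (fun n x _ => by simp) n

theorem nonempty_cohomology_equiv_of_equiv {d : ∀ n, C n →ₗ[k] C (n + 1)}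
    {d' : ∀ n, C' n →ₗ[k] C' (n + 1)} (f : ∀ n, C n ≃ₗ[k] C' n)
    (hf : ∀ n x, d' n (f n x) = f (n + 1) (d n x)) (n : ℕ) :
    Nonempty (cohomology d n ≃ₗ[k] cohomology d' n) :=
  nonempty_cohomology_equiv (fun n => (f n).toLinearMap) hf (fun n => (f n).symm.toLinearMap)
    (fun n x => by
      apply (f (n + 1)).injective
      simp only [LinearEquiv.coe_coe, LinearEquiv.apply_symm_apply, ← hf])
    (fun n x _ => by simp) (fun n x _ => by simp) n

end

variable {A : Type w} [Ring A] [Algebra k A]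
  {P Q : ℕ → Type w'} [∀ n, AddCommGroup (P n)] [∀ n, AddCommGroup (Q n)]
  [∀ n, Module (Env k A) (P n)] [∀ n, Module (Env k A) (Q n)]
  {dP : ∀ n, P (n + 1) →ₗ[Env k A] P n} {dQ : ∀ n, Q (n + 1) →ₗ[Env k A] Q n}
  {f : ∀ n, P n →ₗ[Env k A] Q n} {g : ∀ n, Q n →ₗ[Env k A] P n}
  {h : ∀ n, P n →ₗ[Env k A] P (n + 1)} {h' : ∀ n, Q n →ₗ[Env k A] Q (n + 1)}

/-- For a cocycle `x` the homotopy formula gives `x ∘ (d h + h d) = (x ∘ h) ∘ d`, a coboundary; in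
degree zero it gives zero. -/
theorem IsHomotopyRetract.envHom (H : IsHomotopyRetract dP dQ f g h) (n : ℕ) :
    ∀ x ∈ LinearMap.ker (envHomMap (k := k) (A := A) (dP n)),
      envHomMap (k := k) (f n) (envHomMap (k := k) (g n) x) - x ∈
        coboundaries (C := fun n => P n →ₗ[Env k A] A) (fun n => envHomMap (k := k) (dP n)) n := by
  intro x hx
  have hx' : x ∘ₗ dP n = 0 := hx
  have h1 : envHomMap (k := k) (f n) (envHomMap (k := k) (g n) x) - x =
      x ∘ₗ (g n ∘ₗ f n - LinearMap.id) := by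
    rw [LinearMap.comp_sub, LinearMap.comp_id]; rfl
  rw [h1]
  rcases n with _ | n
  · rw [← H.homotopy_zero, ← LinearMap.comp_assoc, hx', LinearMap.zero_comp]
    exact Submodule.zero_mem _
  · rw [← H.homotopy_succ, LinearMap.comp_add, ← LinearMap.comp_assoc, hx', LinearMap.zero_comp,
      zero_add]
    exact ⟨x ∘ₗ h n, rfl⟩

theorem nonempty_cohomology_envHom (H : IsHomotopyRetract dP dQ f g h)
    (H' : IsHomotopyRetract dQ dP g f h') (n : ℕ) :
    Nonempty (cohomology (C := fun n => P n →ₗ[Env k A] A) (fun n => envHomMap (k := k) (dP n)) n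
      ≃ₗ[k] cohomology (C := fun n => Q n →ₗ[Env k A] A)
        (fun n => envHomMap (k := k) (dQ n)) n) :=
  nonempty_cohomology_equiv (C := fun n => P n →ₗ[Env k A] A) (C' := fun n => Q n →ₗ[Env k A] A)
    -- `Hom` is contravariant, so the map from the complex of `P` to that of `Q` is induced by `g`.
    (fun n => envHomMap (g n))
    (fun n x => congrArg (x ∘ₗ ·) (H.comm_g n).symm)
    (fun n => envHomMap (f n))
    (fun n x => congrArg (x ∘ₗ ·) (H.comm_f n).symm)
    H.envHom H'.envHom n

section

theorem envTensor_hom_ext {M : Type w'} [AddCommGroup M] [Module k M] [Module (Env k A) M]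
    {X : Type*} [AddCommGroup X] [Module k X]
    {φ ψ : EnvTensor k A M →ₗ[k] X}
    (h : ∀ a m, φ (Submodule.Quotient.mk (a ⊗ₜ m)) = ψ (Submodule.Quotient.mk (a ⊗ₜ m))) :
    φ = ψ :=
  Submodule.linearMap_qext _ (TensorProduct.ext' h)

variable {M N L : Type w'} [AddCommGroup M] [Module k M] [Module (Env k A) M]
  [IsScalarTower k (Env k A) M] [AddCommGroup N] [Module k N] [Module (Env k A) N]
  [IsScalarTower k (Env k A) N] [AddCommGroup L] [Module k L] [Module (Env k A) L]
  [IsScalarTower k (Env k A) L]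

theorem envTensorMap_mk (φ : M →ₗ[Env k A] N) (a : A) (m : M) :
    envTensorMap φ (Submodule.Quotient.mk (a ⊗ₜ m)) = Submodule.Quotient.mk (a ⊗ₜ φ m) := rfl

theorem envTensorMap_comp (φ : M →ₗ[Env k A] N) (ψ : N →ₗ[Env k A] L) :
    envTensorMap (ψ ∘ₗ φ) = envTensorMap ψ ∘ₗ envTensorMap φ :=
  envTensor_hom_ext fun _ _ => rfl

theorem envTensorMap_add (φ ψ : M →ₗ[Env k A] N) :
    envTensorMap (φ + ψ) = envTensorMap φ + envTensorMap ψ :=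
  envTensor_hom_ext fun a m => by
    rw [LinearMap.add_apply, envTensorMap_mk, envTensorMap_mk, envTensorMap_mk,
      LinearMap.add_apply, TensorProduct.tmul_add]
    rfl

theorem envTensorMap_sub_id (φ : M →ₗ[Env k A] M) :
    envTensorMap (φ - LinearMap.id) = envTensorMap φ - LinearMap.id :=
  envTensor_hom_ext fun a m => by
    rw [LinearMap.sub_apply, envTensorMap_mk, envTensorMap_mk, LinearMap.sub_apply,
      TensorProduct.tmul_sub]
    rfl

end

variable [∀ n, Module k (P n)] [∀ n, Module k (Q n)]
  [∀ n, IsScalarTower k (Env k A) (P n)] [∀ n, IsScalarTower k (Env k A) (Q n)]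

/-- On a cycle the term `h d` of the homotopy formula vanishes, and the term `d h` is a boundary. -/
theorem IsHomotopyRetract.envTensor (H : IsHomotopyRetract dP dQ f g h) (n : ℕ) :
    ∀ x ∈ cycles (k := k) (C := fun n => EnvTensor k A (P n)) (fun n => envTensorMap (dP n)) n,
      envTensorMap (g n) (envTensorMap (f n) x) - x ∈
        LinearMap.range (envTensorMap (dP n)) := by
  intro x hx
  have h1 : ∀ n (x : EnvTensor k A (P n)), envTensorMap (g n) (envTensorMap (f n) x) - x =
      envTensorMap (g n ∘ₗ f n - LinearMap.id) x := fun n x => by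
    rw [envTensorMap_sub_id, envTensorMap_comp]; rfl
  rw [h1]
  rcases n with _ | n
  · rw [← H.homotopy_zero, envTensorMap_comp]
    exact ⟨_, rfl⟩
  · rw [← H.homotopy_succ, envTensorMap_add, envTensorMap_comp, envTensorMap_comp,
      LinearMap.add_apply, LinearMap.comp_apply, LinearMap.comp_apply,
      show envTensorMap (dP n) x = 0 from hx, map_zero, add_zero]
    exact ⟨_, rfl⟩

theorem nonempty_homology_envTensor (H : IsHomotopyRetract dP dQ f g h)
    (H' : IsHomotopyRetract dQ dP g f h') (n : ℕ) :
    Nonempty (homology (k := k) (C := fun n => EnvTensor k A (P n)) (fun n => envTensorMap (dP n)) n ≃ₗ[k]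
      homology (k := k) (C := fun n => EnvTensor k A (Q n)) (fun n => envTensorMap (dQ n)) n) :=
  nonempty_homology_equiv (k := k) (C := fun n => EnvTensor k A (P n)) (C' := fun n => EnvTensor k A (Q n))
    (fun n => envTensorMap (f n))
    (fun n x => by
      rw [← LinearMap.comp_apply, ← envTensorMap_comp, H.comm_f, envTensorMap_comp]; rfl)
    (fun n => envTensorMap (g n))
    (fun n x => by
      rw [← LinearMap.comp_apply, ← envTensorMap_comp, H.comm_g, envTensorMap_comp]; rfl)
    H.envTensor H'.envTensor n

end Homology

/-! ## The bar resolution -/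

section Bar

variable {k : Type u} [Field k] {A : Type w} [Ring A] [Algebra k A]

/-- The linear map `e ⊗ w ↦ e • f w` on a free module `B ⊗ W`. -/
def freeLift {B : Type*} [Ring B] [Algebra k B] {W X : Type*} [AddCommGroup W] [Module k W]
    [AddCommGroup X] [Module k X] [Module B X] [IsScalarTower k B X] (f : W →ₗ[k] X) :
    B ⊗[k] W →ₗ[B] X :=
  TensorProduct.AlgebraTensorModule.lift (LinearMap.toSpanSingleton B _ f)

@[simp] theorem freeLift_tmul {B : Type*} [Ring B] [Algebra k B] {W X : Type*} [AddCommGroup W]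
    [Module k W] [AddCommGroup X] [Module k X] [Module B X] [IsScalarTower k B X] (f : W →ₗ[k] X)
    (b : B) (x : W) : freeLift f (b ⊗ₜ x) = b • f x := by
  simp [freeLift]

section Coboundary

variable {X : Type w'} [AddCommGroup X] [Module k X] [Module (Env k A) X]
  [IsScalarTower k (Env k A) X]

/-- The two actions of `A` on a bimodule. -/
def leftAct : A →ₗ[k] X →ₗ[k] X :=
  LinearMap.mk₂ k (fun a x => (Env.tmul a 1 : Env k A) • x)
    (fun a b x => by rw [Env.add_tmul, add_smul])
    (fun c a x => by rw [← Env.smul_tmul, smul_assoc])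
    (fun a x y => smul_add _ _ _) (fun c a x => smul_comm _ _ _)

def rightAct : X →ₗ[k] A →ₗ[k] X :=
  LinearMap.mk₂ k (fun x a => (Env.tmul 1 a : Env k A) • x)
    (fun x y a => smul_add _ _ _) (fun c x a => smul_comm _ _ _)
    (fun x a b => by rw [Env.tmul_add, add_smul])
    (fun c x a => by rw [← Env.smul_tmul_right, smul_assoc])

/-- The Hochschild coboundary of a cochain with values in a bimodule. -/
def bimoduleCoboundary {n : ℕ} (f : MultilinearMap k (fun _ : Fin n => A) X) :
    MultilinearMap k (fun _ : Fin (n + 1) => A) X :=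
  LinearMap.uncurryLeft
      { toFun := fun a => (leftAct a).compMultilinearMap f
        map_add' := fun a b => by ext; simp
        map_smul' := fun c a => by ext; simp } +
    ∑ j : Fin n, (-1 : k) ^ ((j : ℕ) + 1) • contract f j +
    (-1 : k) ^ (n + 1) • (rightAct.compMultilinearMap f).uncurryRight

theorem bimoduleCoboundary_apply {n : ℕ} (f : MultilinearMap k (fun _ : Fin n => A) X)
    (a : Fin (n + 1) → A) :
    bimoduleCoboundary f a = (Env.tmul (a 0) 1 : Env k A) • f (Fin.tail a) +
      ∑ j : Fin n, (-1 : k) ^ ((j : ℕ) + 1) • f (Fin.contractNth j.castSucc (· * ·) a) +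
      (-1 : k) ^ (n + 1) • (Env.tmul 1 (a (Fin.last n)) : Env k A) • f (Fin.init a) := by
  simp [bimoduleCoboundary, contract, leftAct, rightAct]

end Coboundary

theorem hochschildCoboundary_eq {n : ℕ} (f : HochschildCochain k A n) :
    hochschildCoboundary k A n f = bimoduleCoboundary f := by
  ext a
  rw [hochschildCoboundary_apply, bimoduleCoboundary_apply, Env.tmul_smul, Env.tmul_smul, mul_one,
    one_mul]

variable (k A)

/-- The terms `A ⊗ A^{⊗ n} ⊗ A` of the bar resolution. -/
abbrev Bar (n : ℕ) : Type (max u w) := Env k A ⊗[k] (⨂[k] _ : Fin n, A)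

/-- The universal cochain `(a_1, …, a_n) ↦ 1 ⊗ a_1 ⊗ ⋯ ⊗ a_n ⊗ 1`. -/
def barCochain (n : ℕ) : MultilinearMap k (fun _ : Fin n => A) (Bar k A n) :=
  (TensorProduct.mk k (Env k A) (⨂[k] _ : Fin n, A) 1).compMultilinearMap (PiTensorProduct.tprod k)

variable {k A} in
theorem barCochain_apply {n : ℕ} (a : Fin n → A) :
    barCochain k A n a = 1 ⊗ₜ PiTensorProduct.tprod k a := rfl

/-- The differential of the bar resolution. -/
def barDiff (n : ℕ) : Bar k A (n + 1) →ₗ[Env k A] Bar k A n :=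
  freeLift (PiTensorProduct.lift (bimoduleCoboundary (barCochain k A n)))

/-- The augmentation of the bar resolution. -/
def barAug : Bar k A 0 →ₗ[Env k A] A :=
  freeLift (PiTensorProduct.lift (MultilinearMap.constOfIsEmpty k (fun _ : Fin 0 => A) (1 : A)))

variable {k A}

theorem barDiff_tmul {n : ℕ} (e : Env k A) (a : Fin (n + 1) → A) :
    barDiff k A n (e ⊗ₜ PiTensorProduct.tprod k a) =
      e • bimoduleCoboundary (barCochain k A n) a := by
  rw [barDiff, freeLift_tmul, PiTensorProduct.lift.tprod]

theorem barAug_tmul (e : Env k A) (a : Fin 0 → A) :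
    barAug k A (e ⊗ₜ PiTensorProduct.tprod k a) = e • (1 : A) := by
  rw [barAug, freeLift_tmul, PiTensorProduct.lift.tprod]; rfl

/-- `(a, a_1 ⊗ ⋯ ⊗ a_n) ↦ a ⊗ a_1 ⊗ ⋯ ⊗ a_n`. -/
def tprodCons (n : ℕ) : A →ₗ[k] (⨂[k] _ : Fin n, A) →ₗ[k] (⨂[k] _ : Fin (n + 1), A) :=
  PiTensorProduct.lift.toLinearMap ∘ₗ
    (PiTensorProduct.tprod k : MultilinearMap k (fun _ : Fin (n + 1) => A) _).curryLeft

@[simp] theorem tprodCons_tprod (n : ℕ) (a : A) (b : Fin n → A) :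
    tprodCons n a (PiTensorProduct.tprod k b) = PiTensorProduct.tprod k (Fin.cons a b) := by
  simp [tprodCons]

/-- Linear maps on the bar resolution are determined by their values on pure tensors. -/
theorem bar_hom_ext {n : ℕ} {X : Type*} [AddCommGroup X] [Module k X] {f g : Bar k A n →ₗ[k] X}
    (h : ∀ a b c, f (Env.tmul a b ⊗ₜ PiTensorProduct.tprod k c) =
      g (Env.tmul a b ⊗ₜ PiTensorProduct.tprod k c)) : f = g := by
  refine TensorProduct.ext (Env.hom_ext fun a b => PiTensorProduct.ext ?_)
  ext c
  exact h a b c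

/-- The contracting homotopy `a ⊗ w ⊗ b ↦ 1 ⊗ a ⊗ w ⊗ b`. -/
def barHomotopy (n : ℕ) : Bar k A n →ₗ[k] Bar k A (n + 1) :=
  TensorProduct.lift (Env.lift (LinearMap.mk₂ k
    (fun a b => (TensorProduct.mk k (Env k A) _ (Env.tmul 1 b)) ∘ₗ tprodCons n a)
    (fun a a' b => by rw [map_add, LinearMap.comp_add])
    (fun c a b => by rw [map_smul, LinearMap.comp_smul])
    (fun a b b' => by rw [Env.tmul_add, map_add, LinearMap.add_comp])
    (fun c a b => by rw [← Env.smul_tmul_right, map_smul, LinearMap.smul_comp])))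

theorem barHomotopy_tmul {n : ℕ} (a b : A) (c : Fin n → A) :
    barHomotopy n (Env.tmul a b ⊗ₜ PiTensorProduct.tprod k c) =
      Env.tmul 1 b ⊗ₜ PiTensorProduct.tprod k (Fin.cons a c) := by
  rw [barHomotopy, TensorProduct.lift.tmul, Env.lift_tmul, LinearMap.mk₂_apply,
    LinearMap.comp_apply, tprodCons_tprod, TensorProduct.mk_apply]

def barSection : A →ₗ[k] Bar k A 0 :=
  (TensorProduct.mk k (Env k A) (⨂[k] _ : Fin 0, A)).flip (PiTensorProduct.tprod k Fin.elim0) ∘ₗ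
    Env.mk 1

theorem barSection_apply (a : A) :
    (barSection a : Bar k A 0) = Env.tmul 1 a ⊗ₜ PiTensorProduct.tprod k Fin.elim0 := rfl

theorem barAug_barSection (a : A) : barAug k A (barSection a) = a := by
  rw [barSection_apply, barAug_tmul, Env.tmul_smul, mul_one, one_mul]

theorem smul_barCochain {n : ℕ} (e : Env k A) (a : Fin n → A) :
    e • barCochain k A n a = e ⊗ₜ PiTensorProduct.tprod k a := by
  rw [barCochain_apply, TensorProduct.smul_tmul', smul_eq_mul, mul_one]

theorem smul_smul_barCochain {n : ℕ} (e e' : Env k A) (a : Fin n → A) :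
    e • e' • barCochain k A n a = (e * e') ⊗ₜ PiTensorProduct.tprod k a := by
  rw [← mul_smul, smul_barCochain]

theorem smul_smul_bar {n : ℕ} (e : Env k A) (r : k) (x : Bar k A n) : e • r • x = r • e • x :=
  smul_comm e r x

theorem neg_smul_bar {n : ℕ} (r : k) (x : Bar k A n) : (-r) • x = -(r • x) :=
  neg_smul r x

theorem barDiff_barHomotopy_zero (x : Bar k A 0) :
    barDiff k A 0 (barHomotopy 0 x) + barSection (barAug k A x) = x := by
  have : ((barDiff k A 0).restrictScalars k ∘ₗ barHomotopy 0 +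
      barSection ∘ₗ (barAug k A).restrictScalars k) = LinearMap.id := by
    refine bar_hom_ext fun a b c => ?_
    simp only [LinearMap.add_apply, LinearMap.comp_apply, LinearMap.restrictScalars_apply,
      LinearMap.id_apply]
    rw [barHomotopy_tmul, barDiff_tmul, barAug_tmul, barSection_apply, bimoduleCoboundary_apply,
      Subsingleton.elim Fin.elim0 c, Subsingleton.elim (Fin.tail _) c,
      Subsingleton.elim (Fin.init _) c, smul_add, smul_add, smul_smul_bar,
      smul_smul_barCochain, smul_smul_barCochain, Env.tmul_mul_tmul, Env.tmul_mul_tmul,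
      Env.tmul_smul, pow_one, neg_smul_bar]
    simp
  exact LinearMap.congr_fun this x

theorem contractNth_cons_zero {n : ℕ} (a : A) (c : Fin (n + 1) → A) :
    Fin.contractNth (0 : Fin (n + 1)).castSucc (· * ·) (Fin.cons a c : Fin (n + 2) → A) =
      Fin.cons (a * c 0) (Fin.tail c) := by
  ext l
  refine Fin.cases ?_ (fun l => ?_) l
  · rw [Fin.contractNth_apply_of_eq _ _ _ _ (by simp)]; simp
  · rw [Fin.contractNth_apply_of_gt _ _ _ _ (by simp)]; simp [Fin.tail]

theorem contractNth_cons_succ {n : ℕ} (j : Fin n) (a : A) (c : Fin (n + 1) → A) :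
    Fin.contractNth j.succ.castSucc (· * ·) (Fin.cons a c : Fin (n + 2) → A) =
      Fin.cons a (Fin.contractNth j.castSucc (· * ·) c) := by
  ext l
  refine Fin.cases ?_ (fun l => ?_) l
  · rw [Fin.contractNth_apply_of_lt _ _ _ _ (by simp)]; simp
  · rw [Fin.cons_succ]
    rcases lt_trichotomy (l : ℕ) j with h | h | h
    · rw [Fin.contractNth_apply_of_lt _ _ _ _ (by simpa using h),
        Fin.contractNth_apply_of_lt _ _ _ _ (by simpa using h), Fin.castSucc_succ, Fin.cons_succ]
    · rw [Fin.contractNth_apply_of_eq _ _ _ _ (by simpa using h),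
        Fin.contractNth_apply_of_eq _ _ _ _ (by simpa using h), Fin.castSucc_succ, Fin.cons_succ,
        Fin.cons_succ]
    · rw [Fin.contractNth_apply_of_gt _ _ _ _ (by simpa using h),
        Fin.contractNth_apply_of_gt _ _ _ _ (by simpa using h), Fin.cons_succ]

omit [Ring A] in
theorem init_cons_eq {n : ℕ} (a : A) (c : Fin (n + 1) → A) :
    Fin.init (Fin.cons a c : Fin (n + 2) → A) = Fin.cons a (Fin.init c) := by
  ext l
  refine Fin.cases ?_ (fun l => ?_) l
  · simp [Fin.init]
  · rw [Fin.init, Fin.castSucc_succ, Fin.cons_succ, Fin.cons_succ, Fin.init]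

/-- In the differential of `1 ⊗ a ⊗ w ⊗ b` the first term returns `a ⊗ w ⊗ b`. All others reappear
in `barHomotopy n (barDiff k A n x)` with opposite sign. -/
theorem barDiff_barHomotopy_succ (n : ℕ) (x : Bar k A (n + 1)) :
    barDiff k A (n + 1) (barHomotopy (n + 1) x) + barHomotopy n (barDiff k A n x) = x := by
  have : ((barDiff k A (n + 1)).restrictScalars k ∘ₗ barHomotopy (n + 1) +
      barHomotopy n ∘ₗ (barDiff k A n).restrictScalars k) = LinearMap.id := by
    refine bar_hom_ext fun a b c => ?_
    simp only [LinearMap.add_apply, LinearMap.comp_apply, LinearMap.restrictScalars_apply,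
      LinearMap.id_apply]
    -- The summand `j = 0`, which multiplies `a` into the first entry, is split off: it cancels the
    -- term where that entry acts on the left. The other indices match after a shift.
    rw [barHomotopy_tmul, barDiff_tmul, barDiff_tmul, bimoduleCoboundary_apply,
      bimoduleCoboundary_apply, Fin.sum_univ_succ, contractNth_cons_zero]
    simp only [contractNth_cons_succ, init_cons_eq, smul_add, Finset.smul_sum, map_add, map_sum,
      Fin.cons_zero, Fin.tail_cons]
    simp only [smul_smul_bar, smul_smul_barCochain, Env.tmul_mul_tmul, mul_one, one_mul]
    simp only [smul_barCochain, map_smul, barHomotopy_tmul]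
    have hlast : (Fin.cons a c : Fin (n + 2) → A) (Fin.last (n + 1)) = c (Fin.last n) := by
      rw [← Fin.succ_last, Fin.cons_succ]
    simp only [hlast, Fin.val_zero, Fin.val_succ, pow_succ, pow_zero, mul_neg, mul_one, neg_smul_bar,
      one_smul, neg_neg, Finset.sum_neg_distrib]
    abel
  exact LinearMap.congr_fun this x

theorem barAug_barDiff (x : Bar k A 1) : barAug k A (barDiff k A 0 x) = 0 := by
  have : (barAug k A ∘ₗ barDiff k A 0).restrictScalars k = 0 := by
    refine bar_hom_ext fun a b c => ?_
    simp only [LinearMap.comp_apply, LinearMap.restrictScalars_apply, LinearMap.zero_apply]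
    rw [barDiff_tmul, bimoduleCoboundary_apply, map_smul, map_add, map_add,
      LinearMap.map_smul_of_tower _ ((-1 : k) ^ (0 + 1)), smul_barCochain, smul_barCochain,
      barAug_tmul, barAug_tmul, Env.tmul_smul, Env.tmul_smul]
    simp [Env.tmul_smul]
  exact LinearMap.congr_fun this x

/-- A linear map on the bar resolution vanishes if it does so on the image of the contracting
homotopy. -/
theorem bar_eq_zero_of_barHomotopy {n : ℕ} {X : Type*} [AddCommGroup X] [Module (Env k A) X]
    (f : Bar k A (n + 1) →ₗ[Env k A] X) (h : ∀ y, f (barHomotopy n y) = 0)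
    (x : Bar k A (n + 1)) : f x = 0 := by
  induction x using TensorProduct.induction_on with
  | zero => exact map_zero f
  | add x y hx hy => rw [map_add, hx, hy, add_zero]
  | tmul e w =>
    induction w using PiTensorProduct.induction_on with
    | smul_tprod r c =>
      -- Every pure tensor is an `A^e`-multiple of one starting with `1`, which the homotopy reaches
      -- from the tensor having its first entry moved to the left factor.
      have h1 := h (Env.tmul (c 0) 1 ⊗ₜ PiTensorProduct.tprod k (Fin.tail c))
      rw [barHomotopy_tmul, Fin.cons_self_tail] at h1
      have h2 : e ⊗ₜ[k] (r • PiTensorProduct.tprod k c) =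
          (r • e) • ((Env.tmul 1 1 : Env k A) ⊗ₜ[k] PiTensorProduct.tprod k c) := by
        rw [TensorProduct.smul_tmul', smul_eq_mul, ← Env.one_def, mul_one, TensorProduct.smul_tmul]
      rw [h2, map_smul, h1, smul_zero]
    | add x y hx hy => rw [TensorProduct.tmul_add, map_add, hx, hy, add_zero]

/-- The homotopy identities imply `d² = 0`: inductively `d d h = d - d h d = d - (d - h d d) = 0`,
and the image of `h` generates the bar module over `A^e`. -/
theorem barDiff_barDiff (n : ℕ) (x : Bar k A (n + 2)) :
    barDiff k A n (barDiff k A (n + 1) x) = 0 := by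
  induction n with
  | zero =>
    refine bar_eq_zero_of_barHomotopy (barDiff k A 0 ∘ₗ barDiff k A 1) (fun y => ?_) x
    have h1 := eq_sub_of_add_eq (barDiff_barHomotopy_succ 0 y)
    have h2 := barDiff_barHomotopy_zero (barDiff k A 0 y)
    rw [barAug_barDiff, map_zero, add_zero] at h2
    rw [LinearMap.comp_apply, h1, map_sub, h2, sub_self]
  | succ n ih =>
    refine bar_eq_zero_of_barHomotopy (barDiff k A (n + 1) ∘ₗ barDiff k A (n + 2)) (fun y => ?_) x
    have h1 := eq_sub_of_add_eq (barDiff_barHomotopy_succ (n + 1) y)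
    have h2 := barDiff_barHomotopy_succ n (barDiff k A (n + 1) y)
    rw [ih, map_zero, add_zero] at h2
    rw [LinearMap.comp_apply, h1, map_sub, h2, sub_self]

/-- The bar resolution is a resolution. -/
theorem bar_isExactAugmented : IsExactAugmented (C := fun n => Bar k A n)
    (fun n => (barDiff k A n).toAddMonoidHom) (barAug k A).toAddMonoidHom where
  surjective a := ⟨barSection a, barAug_barSection (k := k) a⟩
  exact_zero x := by
    refine ⟨fun hx => ⟨barHomotopy 0 x, ?_⟩, ?_⟩
    · have := barDiff_barHomotopy_zero x
      rwa [show barAug k A x = 0 from hx, map_zero, add_zero] at this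
    · rintro ⟨y, rfl⟩; exact barAug_barDiff y
  exact_succ n x := by
    refine ⟨fun hx => ⟨barHomotopy (n + 1) x, ?_⟩, ?_⟩
    · have := barDiff_barHomotopy_succ n x
      rwa [show barDiff k A n x = 0 from hx, map_zero, add_zero] at this
    · rintro ⟨y, rfl⟩; exact barDiff_barDiff n y

/-! ### The Hochschild complexes as complexes of the bar resolution -/

/-- `Hom_{A^e}(A ⊗ A^{⊗ n} ⊗ A, A) = C^n(A)`. -/
def homBarEquiv (n : ℕ) : (Bar k A n →ₗ[Env k A] A) ≃ₗ[k] HochschildCochain k A n where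
  toFun φ := (φ.restrictScalars k).compMultilinearMap (barCochain k A n)
  map_add' _ _ := rfl
  map_smul' _ _ := rfl
  invFun f := freeLift (PiTensorProduct.lift f)
  left_inv φ := by
    refine LinearMap.restrictScalars_injective k (bar_hom_ext fun a b c => ?_)
    rw [LinearMap.restrictScalars_apply, freeLift_tmul, PiTensorProduct.lift.tprod,
      ← smul_barCochain]
    exact (map_smul φ _ _).symm
  right_inv f := by
    ext c
    change freeLift (PiTensorProduct.lift f) (barCochain k A n c) = f c
    rw [barCochain_apply, freeLift_tmul, PiTensorProduct.lift.tprod, one_smul]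

/-- The bar differential extends the coboundary of the universal cochain, and bimodule maps commute
with coboundaries. -/
theorem homBarEquiv_comm (n : ℕ) (φ : Bar k A n →ₗ[Env k A] A) :
    hochschildCoboundary k A n (homBarEquiv n φ) =
      homBarEquiv (n + 1) (envHomMap (k := k) (barDiff k A n) φ) := by
  ext c
  rw [hochschildCoboundary_eq, bimoduleCoboundary_apply]
  change _ = φ (barDiff k A n (1 ⊗ₜ PiTensorProduct.tprod k c))
  rw [barDiff_tmul, one_smul, bimoduleCoboundary_apply]
  simp only [map_add, map_sum, map_smul, LinearMap.map_smul_of_tower]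
  rfl

/-- The right action `(a, c ⊗ b) ↦ b a c` of `A^e` on `A`. -/
def opAct : Env k A →ₗ[k] A →ₗ[k] A :=
  Env.lift (LinearMap.mk₂ k (fun c b => LinearMap.mulLeft k b ∘ₗ LinearMap.mulRight k c)
    (fun c c' b => by ext; simp [mul_add]) (fun r c b => by ext; simp)
    (fun c b b' => by ext; simp [add_mul]) (fun r c b => by ext; simp))

theorem opAct_tmul (c b a : A) : opAct (Env.tmul c b : Env k A) a = b * a * c := by
  rw [opAct, Env.lift_tmul, LinearMap.mk₂_apply]; simp [mul_assoc]

/-- The order is reversed because this is the right action used in forming `A ⊗_{A^e} -`. -/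
theorem opAct_mul (e e' : Env k A) (a : A) : opAct (e * e') a = opAct e' (opAct e a) := by
  induction e using Env.induction with
  | zero => simp
  | add x y hx hy => simp only [add_mul, map_add, LinearMap.add_apply, hx, hy]
  | tmul c b =>
    induction e' using Env.induction with
    | zero => simp
    | add x y hx hy => simp only [mul_add, map_add, LinearMap.add_apply, hx, hy]
    | tmul c' b' => simp only [Env.tmul_mul_tmul, opAct_tmul, mul_assoc]

/-- `a ⊗ (e ⊗ w) ↦ a e ⊗ w`. -/
def envTensorBarAux (n : ℕ) : A ⊗[k] Bar k A n →ₗ[k] HochschildChain k A n :=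
  TensorProduct.lift (LinearMap.flip (TensorProduct.lift
    (LinearMap.mk₂ k (fun e w => (tprodCons n).flip w ∘ₗ opAct e)
      (fun e e' w => by rw [map_add, LinearMap.comp_add])
      (fun c e w => by rw [map_smul, LinearMap.comp_smul])
      (fun e w w' => by rw [map_add, LinearMap.add_comp])
      (fun c e w => by rw [map_smul, LinearMap.smul_comp]))))

theorem envTensorBarAux_tmul {n : ℕ} (a : A) (e : Env k A) (w : ⨂[k] _ : Fin n, A) :
    envTensorBarAux n (a ⊗ₜ (e ⊗ₜ w)) = tprodCons n (opAct e a) w := by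
  simp [envTensorBarAux]

theorem envTensorBarAux_smul {n : ℕ} (a : A) (e : Env k A) (x : Bar k A n) :
    envTensorBarAux n (a ⊗ₜ (e • x)) = envTensorBarAux n (opAct e a ⊗ₜ x) := by
  induction x using TensorProduct.induction_on with
  | zero => simp
  | add x y hx hy => simp only [smul_add, TensorProduct.tmul_add, map_add, hx, hy]
  | tmul e' w =>
    rw [TensorProduct.smul_tmul', envTensorBarAux_tmul, envTensorBarAux_tmul, smul_eq_mul,
      opAct_mul]

/-- `A ⊗_{A^e} (A ⊗ A^{⊗ n} ⊗ A) = C_n(A)`. -/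
def envTensorBarEquiv (n : ℕ) : EnvTensor k A (Bar k A n) ≃ₗ[k] HochschildChain k A n :=
  LinearEquiv.ofLinearMap
    (Submodule.liftQ _ (envTensorBarAux n) (by
      rw [envTensorRel, Submodule.span_le]
      rintro _ ⟨a, b, c, m, rfl⟩
      rw [SetLike.mem_coe, LinearMap.mem_ker, map_sub, envTensorBarAux_smul, opAct_tmul, sub_self]))
    ((envTensorRel k A (Bar k A n)).mkQ ∘ₗ PiTensorProduct.lift (LinearMap.uncurryLeft
      { toFun := fun a => (TensorProduct.mk k A (Bar k A n) a).compMultilinearMap (barCochain k A n)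
        map_add' := fun a b => by ext; simp
        map_smul' := fun c a => by ext; simp [TensorProduct.smul_tmul'] }))
    (by
      refine PiTensorProduct.ext ?_
      ext a
      simp [barCochain_apply, envTensorBarAux_tmul, Env.one_def, opAct_tmul])
    (by
      refine Submodule.linearMap_qext _ (TensorProduct.ext (LinearMap.ext fun a =>
        bar_hom_ext fun c b w => ?_))
      change (envTensorRel k A (Bar k A n)).mkQ (PiTensorProduct.lift _ (envTensorBarAux n
        (a ⊗ₜ[k] (Env.tmul c b ⊗ₜ[k] PiTensorProduct.tprod k w)))) = Submodule.Quotient.mk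
          (a ⊗ₜ[k] (Env.tmul c b ⊗ₜ[k] PiTensorProduct.tprod k w))
      rw [envTensorBarAux_tmul, opAct_tmul, tprodCons_tprod, PiTensorProduct.lift.tprod,
        LinearMap.uncurryLeft_apply]
      change Submodule.Quotient.mk ((b * a * c) ⊗ₜ[k] barCochain k A n 
        (Fin.tail (Fin.cons (b * a * c) w : Fin (n + 1) → A))) = _
      rw [Fin.tail_cons]
      rw [← smul_barCochain]
      exact (Submodule.Quotient.eq _).2 (Submodule.subset_span ⟨a, b, c, _, rfl⟩))

theorem envTensorBarEquiv_mk {n : ℕ} (a : A) (x : Bar k A n) :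
    envTensorBarEquiv n (Submodule.Quotient.mk (a ⊗ₜ x)) = envTensorBarAux n (a ⊗ₜ x) := rfl

theorem envTensorBarAux_barCochain {n : ℕ} (a : A) (c : Fin n → A) :
    envTensorBarAux n (a ⊗ₜ barCochain k A n c) = PiTensorProduct.tprod k (Fin.cons a c) := by
  rw [barCochain_apply, envTensorBarAux_tmul, Env.one_def, opAct_tmul, tprodCons_tprod, one_mul,
    mul_one]

theorem envTensorBarEquiv_comm (n : ℕ) (x : EnvTensor k A (Bar k A (n + 1))) :
    hochschildBoundary k A n (envTensorBarEquiv (n + 1) x) =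
      envTensorBarEquiv n (envTensorMap (barDiff k A n) x) := by
  suffices h : hochschildBoundary k A n ∘ₗ (envTensorBarEquiv (n + 1)).toLinearMap =
      (envTensorBarEquiv n).toLinearMap ∘ₗ envTensorMap (barDiff k A n) from LinearMap.congr_fun h x
  -- Commutation is checked on Hochschild chains through the inverse equivalence, where a chain `a_0
  -- ⊗ ⋯` is represented by `a_0` tensored with a value of the universal cochain.
  have hsymm : ∀ y, hochschildBoundary k A n y = envTensorBarEquiv n (envTensorMap (barDiff k A n)
      ((envTensorBarEquiv (n + 1)).symm y)) := by
    intro y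
    refine LinearMap.congr_fun (g := (envTensorBarEquiv n).toLinearMap ∘ₗ
      envTensorMap (barDiff k A n) ∘ₗ (envTensorBarEquiv (n + 1)).symm.toLinearMap)
      (PiTensorProduct.ext ?_) y
    ext c
    obtain ⟨a, c, rfl⟩ : ∃ a c', c = Fin.cons a c' := ⟨c 0, Fin.tail c, (Fin.cons_self_tail c).symm⟩
    have h1 : (envTensorBarEquiv (n + 1)).symm (PiTensorProduct.tprod k (Fin.cons a c)) =
        Submodule.Quotient.mk (a ⊗ₜ barCochain k A (n + 1) c) := by
      rw [LinearEquiv.symm_apply_eq, envTensorBarEquiv_mk, envTensorBarAux_barCochain]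
    simp only [LinearMap.compMultilinearMap_apply, LinearMap.comp_apply, LinearEquiv.coe_coe]
    rw [h1, envTensorMap_mk, envTensorBarEquiv_mk, barCochain_apply, barDiff_tmul, one_smul,
      hochschildBoundary_tprod, bimoduleCoboundary_apply, Fin.sum_univ_succ, contractNth_cons_zero]
    -- Moving the outer actions across the tensor product turns the left one into the summand `a_0
    -- a_1 ⊗ ⋯` and the right one into the cyclic summand `a_{n+1} a_0 ⊗ ⋯`.
    simp only [contractNth_cons_succ, TensorProduct.tmul_add, TensorProduct.tmul_sum,
      TensorProduct.tmul_smul, map_add, map_sum, map_smul, envTensorBarAux_smul, opAct_tmul,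
      envTensorBarAux_barCochain, one_mul, mul_one, Fin.val_zero, pow_zero, one_smul, Fin.val_succ]
    have hlast : (Fin.cons a c : Fin (n + 2) → A) (Fin.last (n + 1)) = c (Fin.last n) := by
      rw [← Fin.succ_last, Fin.cons_succ]
    have hinit : (fun i : Fin n => (Fin.cons a c : Fin (n + 2) → A) i.succ.castSucc) =
        Fin.init c := by
      ext i
      rw [Fin.castSucc_succ, Fin.cons_succ, Fin.init]
    rw [hlast, hinit, Fin.cons_zero]
  refine LinearMap.ext fun x => ?_
  rw [LinearMap.comp_apply, LinearEquiv.coe_coe, hsymm, LinearEquiv.symm_apply_apply]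
  rfl

/-- Any projective bimodule resolution of `A` computes its Hochschild homology. -/
theorem nonempty_hochschildHomology_equiv {Q : ℕ → Type (max u w)} [∀ n, AddCommGroup (Q n)]
    [∀ n, Module k (Q n)] [∀ n, Module (Env k A) (Q n)] [∀ n, IsScalarTower k (Env k A) (Q n)]
    [∀ n, Module.Projective (Env k A) (Q n)]
    {dQ : ∀ n, Q (n + 1) →ₗ[Env k A] Q n} {εQ : Q 0 →ₗ[Env k A] A}
    (hQ : IsExactAugmented (fun n => (dQ n).toAddMonoidHom) εQ.toAddMonoidHom) (n : ℕ) :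
    Nonempty (HochschildHomology k A n ≃ₗ[k]
      homology (k := k) (C := fun n => EnvTensor k A (Q n)) (fun n => envTensorMap (k := k) (dQ n)) n) := by
  -- The given resolution is compared with the bar resolution, whose terms `A^e ⊗ A^{⊗ n}` are
  -- projective over `A^e`.
  obtain ⟨f, g, h, h', H, H'⟩ := exists_isHomotopyRetract (bar_isExactAugmented (k := k) (A := A)) hQ
  obtain ⟨e⟩ := nonempty_homology_envTensor (k := k) H H' n
  obtain ⟨e'⟩ := nonempty_homology_equiv_of_equiv (k := k)
    (C := fun n => EnvTensor k A (Bar k A n)) (C' := HochschildChain k A) envTensorBarEquiv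
    (d := fun n => envTensorMap (barDiff k A n)) (d' := hochschildBoundary k A) envTensorBarEquiv_comm n
  exact ⟨e'.symm.trans e⟩

/-- Any projective bimodule resolution of `A` computes its Hochschild cohomology. -/
theorem nonempty_hochschildCohomology_equiv {Q : ℕ → Type (max u w)} [∀ n, AddCommGroup (Q n)]
    [∀ n, Module (Env k A) (Q n)] [∀ n, Module.Projective (Env k A) (Q n)]
    {dQ : ∀ n, Q (n + 1) →ₗ[Env k A] Q n} {εQ : Q 0 →ₗ[Env k A] A}
    (hQ : IsExactAugmented (fun n => (dQ n).toAddMonoidHom) εQ.toAddMonoidHom) (n : ℕ) :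
    Nonempty (HochschildCohomology k A n ≃ₗ[k]
      cohomology (k := k) (C := fun n => Q n →ₗ[Env k A] A) (fun n => envHomMap (k := k) (dQ n)) n) := by
  obtain ⟨f, g, h, h', H, H'⟩ := exists_isHomotopyRetract (bar_isExactAugmented (k := k) (A := A)) hQ
  obtain ⟨e⟩ := nonempty_cohomology_envHom (k := k) H H' n
  obtain ⟨e'⟩ := nonempty_cohomology_equiv_of_equiv (k := k) homBarEquiv
    (d := fun n => envHomMap (barDiff k A n)) homBarEquiv_comm n
  exact ⟨e'.symm.trans e⟩

end Bar

end MultiKoszul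

/-! ### Assembly of the theorem -/

theorem mainTheorem6 {k : Type*} [Field k] {V : Type*} [AddCommGroup V] [Module k V]
    [FiniteDimensional k V] (D : MultiKoszul.Relations k V) :
    -- the augmented multi-Koszul bimodule complex is a complex
    ((D.bimoduleAug ∘ₗ D.bimoduleDiff 0 = 0 ∧
        ∀ i, D.bimoduleDiff i ∘ₗ D.bimoduleDiff (i + 1) = 0) ∧
      -- it is exact if and only if `A` is multi-Koszul (equivalently on the left or on the right)
      (MultiKoszul.IsExactAugmented
          (C := fun i => D.K (MultiKoszul.Env k D.Alg) i)
          (fun i => (D.bimoduleDiff i).toAddMonoidHom) D.bimoduleAug.toAddMonoidHom ↔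
        D.IsLeftMultiKoszul) ∧
      (MultiKoszul.IsExactAugmented
          (C := fun i => D.K (MultiKoszul.Env k D.Alg) i)
          (fun i => (D.bimoduleDiff i).toAddMonoidHom) D.bimoduleAug.toAddMonoidHom ↔
        D.IsRightMultiKoszul)) ∧
    -- in that case it is a minimal graded projective bimodule resolution of `A`, which computes
    -- Hochschild homology and cohomology
    (D.IsLeftMultiKoszul →
      MultiKoszul.IsMinimalGradedProjectiveResolution D.envGrading
          (C := fun i => D.K (MultiKoszul.Env k D.Alg) i) D.bimoduleGrading D.algGrading
          D.bimoduleDiff D.bimoduleAug ∧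
        (∀ n, Nonempty
          (MultiKoszul.HochschildHomology k D.Alg n ≃ₗ[k]
            MultiKoszul.homology (k := k)
              (C := fun i => MultiKoszul.EnvTensor k D.Alg (D.K (MultiKoszul.Env k D.Alg) i))
              (fun i => MultiKoszul.envTensorMap (D.bimoduleDiff i)) n)) ∧
        (∀ n, Nonempty
          (MultiKoszul.HochschildCohomology k D.Alg n ≃ₗ[k]
            MultiKoszul.cohomology (k := k)
              (C := fun i => D.K (MultiKoszul.Env k D.Alg) i →ₗ[MultiKoszul.Env k D.Alg] D.Alg)
              (fun i => MultiKoszul.envHomMap (D.bimoduleDiff i)) n))) := by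
  refine ⟨⟨⟨D.bimoduleAug_comp, D.bimoduleDiff_comp⟩, D.isExactAugmented_iff_left,
    D.isExactAugmented_iff_right⟩, fun h => ?_⟩
  have hex := D.isExactAugmented_iff_left.2 h
  have := D.projective_K (MultiKoszul.Env k D.Alg)
  exact ⟨D.isMinimalGradedProjectiveResolution hex,
    MultiKoszul.nonempty_hochschildHomology_equiv hex,
    MultiKoszul.nonempty_hochschildCohomology_equiv hex⟩
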